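/- **Setting.** Write $Z=(Z^\alpha)_{\alpha=0}^{3}=(\lambda_A,\mu^{A'})\in\mathbb C^4$ and, for $\Lambda\in\mathbb C$, let $I_{IJ}=\mathrm{diag}(\varepsilon^{AB},\Lambda\varepsilon_{A'B'})$, $I^{IJ}=\mathrm{diag}(\Lambda\varepsilon_{AB},\varepsilon^{A'B'})$ be the infinity twistors (with $\varepsilon^{AB}\varepsilon_{BC}=\delta^A_C$), so that $I^{IJ}I_{JK}=\Lambda\delta^I_K$. Their fermionic components are zero. Let $\tau=I_{IJ}Z^I\,dZ^J$. Let $W\subset\mathbb C^4\setminus\{0\}$ be the cone over an open subset of $\mathbb{CP}^3$. A wave function of weight $w$ is a smooth $\bar\partial$-closed $(0,1)$-form with values in $\mathcal O(w)$ on that open subset. Let $Z(\sigma)=U_0\sigma_0+U_1\sigma_1$ be a map of degree $1$ with $Z(\sigma)\in W$ for all $\sigma\in\mathbb C^2\setminus\{0\}$. Put $(\sigma\sigma')=\sigma_0\sigma_1'-\sigma_1\sigma_0'$ and $D\sigma=(\sigma\,d\sigma)$, and let $\xi\in\mathbb{CP}^1$ be an arbitrary reference point. For a vertex operator $V_f=\int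 f^IY_I$, the degree-one propagator $\langle Y_I(\sigma')Z^J(\sigma)\rangle_1=\frac{(\xi\sigma)^2}{(\xi\sigma')^2}\frac{\delta_I^J D\sigma'}{(\sigma'\sigma)}$ gives $$\langle Z^I(\sigma)V_f\rangle_1=\int_{\mathbb{CP}^1}\frac{D\sigma'}{(\sigma'\sigma)}\,\frac{(\xi\sigma)^2}{(\xi\sigma')^2}\wedge f^I(\sigma'),$$ a Cauchy principal value at $\sigma'=\xi$ (limit as $\epsilon\to0^+$ of the integral over the points at Fubini–Study chordal distance more than $\epsilon$ from $\xi$). **(1) Contraction with the contact form.** Let $h$ be a wave function of weight $2$, let $V_h=\int I^{IJ}Y_I\,\partial_Jh$ be its Einstein vertex operator, and let $$\langle\tau(\sigma)V_h\rangle_1=I_{IJ}\bigl(\langle Z^I(\sigma)V_h\rangle_1\,\partial Z^J(\sigma)+Z^I(\sigma)\,\partial\langle Z^J(\sigma)V_h\rangle_1\bigr),$$ where $\partial$ is the $(1,0)$-derivative in $\sigma$. For every $\sigma$ with $(\xi\sigma)\neq0$ the principal value $\langle Z^I(\sigma)V_h\rangle_1$ exists and is (real) differentiable in $\sigma$, and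 $$\langle\tau(\sigma)V_h\rangle_1=0 .$$ **(2) The MHV correlator.** Let $h_1,\dots,h_{n-2}$ ($n\ge2$) be wave functions of weight $2$, and let $\tilde h_j=\chi^4e_j$ for the two remaining labels $j$, with $e_j$ a wave function of weight $-6$ and $\chi^4=\chi^1\chi^2\chi^3\chi^4$, $\chi^a(\sigma)=\theta^a_0\sigma_0+\theta^a_1\sigma_1$ fermionic. Let $\mathcal C_{n,1}$ be the correlator of $V_{h_1},\dots,V_{h_{n-2}}$ and of $\tilde h_j\tau_j$ at $\sigma_j$, where $(\xi\sigma_j)\neq0$: the sum, over the Feynman diagrams that are maximally connected trees (all $n-2$ vertices $Y_i\cdot\partial h_i$ and one of the vertices $\tilde h_j\tau_j$ form a connected tree, the other $\tilde h_j\tau_j$ is isolated), of the products of contractions. In a diagram each $Y_i$ is contracted once, by the propagator above, either with a wave function $h_k$ ($k\ne i$) or $\tilde h_j$, which is differentiated, or with $Z^I$ or $dZ^J$ in a $\tau_j$ (each of these at most once), and the positions of the $Y_i$ are integrated over $\mathbb{CP}^1$ successively, from the leaves towards $\tilde h_j\tau_j$. All the principal value integrals in these diagrams exist and the resulting fields are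 differentiable away from $\xi$. The diagrams that contain at least one contraction $\langle Y_i\tau_j\rangle_1$ contribute zero in total: $$\mathcal C_{n,1}=\sum_{\text{diagrams without any }\langle Y_i\tau_j\rangle_1}(\text{contribution of the diagram}).$$ The same holds, convergence and differentiability included, if all diagrams without closed cycles, connected or not, are admitted. -/

import Mathlib

open Filter Topology MeasureTheory
open scoped ContDiff

noncomputable section

namespace TwistorString

/-- The bosonic part of non-projective twistor space. -/
abbrev Twistor := Fin 4 → ℂ

/-- Homogeneous coordinates on the worldsheet `ℂP¹`. -/
abbrev Spinor := Fin 2 → ℂ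

/-! ### Wirtinger derivatives -/

section Wirtinger

variable {E F : Type*} [NormedAddCommGroup E] [NormedSpace ℂ E]
  [NormedAddCommGroup F] [NormedSpace ℂ F]

/-- The `(1,0)`-derivative `∂_v f (x)` (complex linear in `v`). -/
def del (f : E → F) (x v : E) : F :=
  (1 / 2 : ℂ) • (fderiv ℝ f x v - Complex.I • fderiv ℝ f x (Complex.I • v))

/-- The `(0,1)`-derivative `∂̄_v f (x)` (conjugate linear in `v`). -/
def delBar (f : E → F) (x v : E) : F :=
  (1 / 2 : ℂ) • (fderiv ℝ f x v + Complex.I • fderiv ℝ f x (Complex.I • v))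

/-- The iterated `(1,0)`-derivative of `f` along constant vectors. -/
def iterDel (f : E → F) : List E → E → F
  | [] => f
  | v :: vs => fun x => del (iterDel f vs) x v

end Wirtinger

/-! ### Infinity twistors and the contact form

Blocks are ordered as `Z = (λ_A, μ^{A'})`, and `ε^{01} = 1`, `ε_{01} = -1`, so that
`ε^{AB} ε_{BC} = δ^A_C`; the same for primed indices. -/

/-- The infinity twistor with lower indices, `diag(ε^{AB}, Λ ε_{A'B'})`. -/
def infinityLower (Λ : ℂ) : Matrix (Fin 4) (Fin 4) ℂ :=
  !![0, 1, 0, 0; -1, 0, 0, 0; 0, 0, 0, -Λ; 0, 0, Λ, 0]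

/-- The infinity twistor with upper indices, `diag(Λ ε_{AB}, ε^{A'B'})`. -/
def infinityUpper (Λ : ℂ) : Matrix (Fin 4) (Fin 4) ℂ :=
  !![0, -Λ, 0, 0; Λ, 0, 0, 0; 0, 0, 0, 1; 0, 0, -1, 0]

theorem infinityUpper_mul_infinityLower (Λ : ℂ) :
    infinityUpper Λ * infinityLower Λ = Λ • (1 : Matrix (Fin 4) (Fin 4) ℂ) := by
  ext i j
  fin_cases i <;> fin_cases j <;>
    simp [infinityUpper, infinityLower, Matrix.mul_apply, Fin.sum_univ_succ]

/-- `I_{IJ} X^I dX^J`, the contact form `τ` evaluated on the values `X`, `dX`. -/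
def contactForm (Λ : ℂ) (X dX : Twistor) : ℂ :=
  ∑ i, ∑ j, infinityLower Λ i j * X i * dX j

/-! ### Twistor space and wave functions -/

/-- `W` is the cone over an open subset of projective twistor space `ℂP³`. -/
structure IsTwistorDomain (W : Set Twistor) : Prop where
  isOpen : IsOpen W
  zero_notMem : (0 : Twistor) ∉ W
  smul_mem : ∀ Z ∈ W, ∀ t : ℂ, t ≠ 0 → t • Z ∈ W

/-- `h = ∑ h_α dZ̄^α` is a smooth `∂̄`-closed `(0,1)`-form with values in `O(w)` on the open
subset of projective twistor space below `W`; `h Z α` is the coefficient of `dZ̄^α` at `Z`. -/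
structure IsWavefunction (W : Set Twistor) (w : ℤ) (h : Twistor → Twistor) : Prop where
  smooth : ContDiffOn ℝ ∞ h W
  homogeneous : ∀ Z ∈ W, ∀ t : ℂ, t ≠ 0 → star t • h (t • Z) = t ^ w • h Z
  horizontal : ∀ Z ∈ W, ∑ α, star (Z α) * h Z α = 0
  closed : ∀ Z ∈ W, ∀ α β : Fin 4,
    delBar h Z (Pi.single α 1) β = delBar h Z (Pi.single β 1) α

/-- The degree-one map `Z(σ) = U₀ σ₀ + U₁ σ₁`. -/
def line (U : Fin 2 → Twistor) (σ : Spinor) : Twistor := σ 0 • U 0 + σ 1 • U 1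

/-! ### Integration over the worldsheet and the propagator -/

/-- `(σ σ') = σ₀ σ'₁ - σ₁ σ'₀`. -/
def bracket (σ σ' : Spinor) : ℂ := σ 0 * σ' 1 - σ 1 * σ' 0

/-- The affine coordinate `z ↦ (1, z)` on `ℂP¹` minus a point; in it `Dσ = (σ dσ) = dz`. -/
def affine (z : ℂ) : Spinor := ![1, z]

/-- The propagator `⟨Y(σ')_I Z^J(σ)⟩_d = ((ξ σ)/(ξ σ'))^{d+1} δ_I^J Dσ' / (σ' σ)`, without
`δ_I^J Dσ'`. -/
def propagator (d : ℕ) (ξ σ' σ : Spinor) : ℂ :=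
  (bracket ξ σ / bracket ξ σ') ^ (d + 1) / bracket σ' σ

/-- The points of the worldsheet at chordal (Fubini-Study) distance more than `ε` from `ξ`, in the
affine coordinate. -/
def awayFrom (ξ : Spinor) (ε : ℝ) : Set ℂ :=
  {z | ε ^ 2 * ((‖ξ 0‖ ^ 2 + ‖ξ 1‖ ^ 2) * (1 + ‖z‖ ^ 2)) < ‖bracket ξ (affine z)‖ ^ 2}

/-- `⟨Z(σ) V_f⟩_1 = ∫ Dσ' ∧ f(σ') (ξ σ)² / ((ξ σ')² (σ' σ))` over `awayFrom ξ ε`, for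
`V_f = ∫ f^I Y_I`. The `(0,1)`-form is `f^I = f z I dz̄` in the affine coordinate, and
`dz ∧ dz̄ = -2i d²z`. -/
def truncatedContraction (ξ : Spinor) (f : ℂ → Twistor) (σ : Spinor) (ε : ℝ) : Twistor :=
  (-2 * Complex.I) • ∫ z in awayFrom ξ ε, propagator 1 ξ (affine z) σ • f z

/-- `⟨Z(σ) V_f⟩_1` as a Cauchy principal value at the double pole `σ' = ξ`. -/
def contraction (ξ : Spinor) (f : ℂ → Twistor) (σ : Spinor) : Twistor :=
  limUnder (𝓝[>] (0 : ℝ)) (truncatedContraction ξ f σ)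

/-- The principal value integral for `⟨Z(σ) V_f⟩_1` converges, with value `y`. -/
def HasContraction (ξ : Spinor) (f : ℂ → Twistor) (σ : Spinor) (y : Twistor) : Prop :=
  (∀ ε : ℝ, 0 < ε →
    IntegrableOn (fun z => propagator 1 ξ (affine z) σ • f z) (awayFrom ξ ε)) ∧
  Tendsto (truncatedContraction ξ f σ) (𝓝[>] (0 : ℝ)) (𝓝 y)

/-! ### The contraction of the contact form with an Einstein vertex operator -/

/-- The pullback of `f^I = I^{IJ} ∂_J g` to the line, as the coefficient of `dz̄` in the affine
coordinate, for a `(0,1)`-form `g = ∑ g_α dZ̄^α`. On the line, `dZ̄ = conj(U₁) dz̄`. -/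
def einsteinField (Λ : ℂ) (U : Fin 2 → Twistor) (g : Twistor → Twistor) (z : ℂ) : Twistor :=
  fun i => ∑ j, infinityUpper Λ i j *
    ∑ α, del g (line U (affine z)) (Pi.single j 1) α * star (U 1 α)

/-- `⟨Z(σ) V_h⟩_1` for `V_h = ∫ I^{IJ} Y_I ∂_J h`. -/
def contractionEinstein (Λ : ℂ) (U : Fin 2 → Twistor) (ξ : Spinor) (h : Twistor → Twistor)
    (σ : Spinor) : Twistor :=
  contraction ξ (einsteinField Λ U h) σ

/-- `⟨τ(σ) V_h⟩_1`, a `(1,0)`-form in `σ`, evaluated on the tangent vector `v`: the sum of the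
contraction of `V_h` with `Z^I(σ)` and of that with `dZ^J(σ)` in `τ = I_{IJ} Z^I dZ^J`. -/
def contractionTau (Λ : ℂ) (U : Fin 2 → Twistor) (ξ : Spinor) (h : Twistor → Twistor)
    (σ v : Spinor) : ℂ :=
  contactForm Λ (contractionEinstein Λ U ξ h σ) (del (line U) σ v) +
    contactForm Λ (line U σ) (del (contractionEinstein Λ U ξ h) σ v)

/-! ### Feynman diagrams for the MHV correlator

There are `m` white vertices `Y·∂h_i` and two black vertices `h̃_j τ_j`. In a diagram each `Y_i` is
contracted with one field: that of another white vertex (its wave function), or one of those in a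
black vertex, namely the wave function `h̃_j`, the `Z^I` in `τ_j`, or the `dZ^J` in `τ_j`. -/

/-- The fields of a black vertex `h̃ τ`, `τ = I_{IJ} Z^I dZ^J`, that a `Y` can be contracted with. -/
inductive Slot where
  | wave
  | tauZ
  | tauDZ
  deriving DecidableEq

instance : Fintype Slot where
  elems := {Slot.wave, Slot.tauZ, Slot.tauDZ}
  complete := by intro x; cases x <;> simp

/-- What a `Y` can be contracted with: a white vertex, or a slot of a black vertex. -/
abbrev Target (m : ℕ) := Fin m ⊕ (Fin 2 × Slot)

/-- A system of contractions: `p i` is the target of the edge that leaves the white vertex `i`. -/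
abbrev Diagram (m : ℕ) := Fin m → Target m

namespace Diagram

variable {m : ℕ}

/-- Following the edges from the white vertex `i` one arrives at the black vertex `j`. -/
inductive Reaches (p : Diagram m) (j : Fin 2) : Fin m → Prop
  | black (i : Fin m) (s : Slot) : p i = Sum.inr (j, s) → Reaches p j i
  | white (i k : Fin m) : p i = Sum.inl k → Reaches p j k → Reaches p j i

/-- The `Z` and the `dZ` in `τ_j` can be contracted only once each. -/
def IsWick (p : Diagram m) : Prop :=
  ∀ i k j s, s ≠ Slot.wave → p i = Sum.inr (j, s) → p k = Sum.inr (j, s) → i = k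

/-- Diagrams without closed cycles, not necessarily connected. -/
def IsForest (p : Diagram m) : Prop := p.IsWick ∧ ∀ i, ∃ j, p.Reaches j i

/-- Maximally connected tree diagrams: all white vertices and one of the black vertices form a
connected tree, and the other black vertex is isolated. -/
def IsTree (p : Diagram m) : Prop := p.IsWick ∧ ∃ j, ∀ i, p.Reaches j i

/-- Some `Y_i` is contracted with some `τ_j`. -/
def HasTauContraction (p : Diagram m) : Prop :=
  ∃ i j s, s ≠ Slot.wave ∧ p i = Sum.inr (j, s)

/-- The white vertices whose `Y` is contracted with the target `t`. -/
def incoming (p : Diagram m) (t : Target m) : List (Fin m) :=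
  (List.finRange m).filter fun i => p i = t

end Diagram

section Correlator

variable {m : ℕ} (Λ : ℂ) (U : Fin 2 → Twistor) (ξ : Spinor) (h : Fin m → Twistor → Twistor)

/-- The field `I^{IJ} ∂_J h_i` at the white vertex `i`, differentiated once for every edge coming in
from a white vertex `c` and contracted with the field `X c` that propagates along that edge. -/
def vertexField (p : Diagram m) (X : Fin m → Spinor → Twistor) (i : Fin m) (z : ℂ) : Twistor :=
  einsteinField Λ U
    (iterDel (h i) ((p.incoming (Sum.inl i)).map fun c => X c (affine z))) z

/-- The fields that leave the white vertices, with at most `k` propagators in succession. -/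
def edgeFieldAux (p : Diagram m) : ℕ → Fin m → Spinor → Twistor
  | 0 => fun _ _ => 0
  | k + 1 => fun i σ => contraction ξ (vertexField Λ U h p (edgeFieldAux p k) i) σ

/-- The field `σ ↦ ⟨Z(σ) V_{h_i} ⋯⟩_1` that leaves the white vertex `i`, where `V_{h_i}` is already
contracted with everything upstream of `i`. In a diagram without cycles at most `m` propagators
follow each other. -/
def edgeField (p : Diagram m) (i : Fin m) (σ : Spinor) : Twistor :=
  edgeFieldAux Λ U ξ h p m i σ

/-- The field in the slot `t`: the map `Z` if no `Y` is contracted with this slot. -/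
def slotField (p : Diagram m) (t : Target m) : Spinor → Twistor :=
  match p.incoming t with
  | [] => line U
  | i :: _ => edgeField Λ U ξ h p i

/-- `τ_j` at `σ`, evaluated on `v`, after the contractions of the diagram. -/
def tauFactor (p : Diagram m) (j : Fin 2) (σ v : Spinor) : ℂ :=
  contactForm Λ (slotField Λ U ξ h p (Sum.inr (j, Slot.tauZ)) σ)
    (del (slotField Λ U ξ h p (Sum.inr (j, Slot.tauDZ))) σ v)

/-- The `(0,1)`-form `e` pulled back to the line at `σ` and evaluated on `v`, after the contractions
of the diagram with the wave function of the black vertex `j`. -/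
def waveFactor (p : Diagram m) (e : Twistor → Twistor) (j : Fin 2) (σ v : Spinor) : ℂ :=
  ∑ α, iterDel e ((p.incoming (Sum.inr (j, Slot.wave))).map fun i => edgeField Λ U ξ h p i σ)
    (line U σ) α * star (line U v α)

/-- The algebra of fermionic moduli, with generators `θ^a_A`, `a = 1, …, 4`, `A = 0, 1`. -/
abbrev Grassmann := ExteriorAlgebra ℂ (Fin 4 × Fin 2 → ℂ)

/-- The fermionic coordinate `χ^a(σ) = θ^a_0 σ₀ + θ^a_1 σ₁` of the degree-one map. -/
def chi (a : Fin 4) (σ : Spinor) : Grassmann :=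
  σ 0 • ExteriorAlgebra.ι ℂ (Pi.single (a, 0) 1) + σ 1 • ExteriorAlgebra.ι ℂ (Pi.single (a, 1) 1)

/-- `χ⁴ = χ¹ χ² χ³ χ⁴`. -/
def chi4 (σ : Spinor) : Grassmann := chi 0 σ * chi 1 σ * chi 2 σ * chi 3 σ

/-- The contribution of a diagram to the correlator of `V_{h_1}, …, V_{h_m}` and `h̃_j τ_j`,
`j = 0, 1`, where `h̃_j = χ⁴ e_j` and where the black vertex `j` is at `s j`. The forms `τ_j` and `e_j`
are evaluated on tangent vectors `v j` and `w j` there. -/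
def contribution (e : Fin 2 → Twistor → Twistor) (s v w : Fin 2 → Spinor) (p : Diagram m) :
    Grassmann :=
  (∏ j, waveFactor Λ U ξ h p (e j) j (s j) (w j) * tauFactor Λ U ξ h p j (s j) (v j)) •
    (chi4 (s 0) * chi4 (s 1))

open Classical in
/-- The part of the correlator that comes from the diagrams of the class `P`. -/
def correlator (P : Diagram m → Prop) (e : Fin 2 → Twistor → Twistor) (s v w : Fin 2 → Spinor) :
    Grassmann :=
  ∑ p with P p, contribution Λ U ξ h e s v w p

end Correlator

end TwistorString

end

open TwistorString

noncomputable section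

namespace TwistorString

section WirtingerCalculus

variable {V E F G : Type*} [NormedAddCommGroup V] [NormedSpace ℂ V]
  [NormedAddCommGroup E] [NormedSpace ℂ E] [NormedAddCommGroup F] [NormedSpace ℂ F]
  [NormedAddCommGroup G] [NormedSpace ℂ G]

/-! ### Wirtinger calculus -/

/-! All diagrams in which some `Y` ends on a given contact form `τ_j` are summed before anything is
concluded, because a single diagram need not vanish. As a function of the position `σ` of `τ_j`, the
sum is a `(1,0)`-form `G σ v`. Exchanging the roles of `Z` and `dZ`, together with the antisymmetry
of `I_{IJ}` and Euler's identity, gives `G σ σ = 0`. Hence `G = κ (σ dσ)` with `κ` of degree zero on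
`ℂP¹`. If `κ` is holomorphic it is constant, and it vanishes at `ξ` because the propagator has a
double zero in `σ` there; so `G = 0` (`oneForm_eq_zero`).

Holomorphy is the heart of the matter. The `∂̄`-derivative of a propagated field is `-2πi` times the
field at the vertex it leaves (`delBar_contraction_affine`), so `∂̄G` is a sum of local terms in
which `τ_j` and a vertex `a` sit at the same point. There `I^{IJ} I_{JK} = Λ δ` turns the
contraction into a derivative of `h_a` along the field in the other slot of `τ_j`. If that slot
carries the map `Z`, Euler's identity for weight 2 produces an integer depending on the number `N`
of fields flowing into `a`. If it carries the field of another vertex `b`, the term looks as if `b`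
flowed into `a`. So a diagram with one slot contracted must be combined with the `N` diagrams
obtained by moving one edge from `a` to the other slot. The coefficients are then `-N` against `N`,
and `2 - N` against `N - 2` (`sum_tauDefect`). The case `N = 0` is the statement on a single vertex
operator.

The vanishing at `ξ` has two halves. The field vanishes at `ξ` by inspection (`contraction_self`).
Its `(1,0)`-derivative vanishes as well (`del_contraction_self`), which is less evident because the
field is not holomorphic and the double pole collides with the Cauchy pole; a rotation by `i` about
`ξ` isolates this derivative.

The analysis rests on `propagator_eq`: the propagator is a unitarily invariant Cauchy kernel plus
two terms that are linear in `σ`, only one of which needs the principal value. In a unitary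
coordinate centred at `σ` the singularity of the Cauchy kernel is fixed, so smoothness follows by
differentiation under the integral (`contDiffOn_integral_clm_comp`), and the `∂̄`-equation from an
integration in polar coordinates (`delBar_cauchyPart`). A contraction sends sections of bidegree
`(1,-2)` to sections of bidegree `(1,0)`, and a vertex fed with the latter yields the former, so all
fields of a forest are controlled by induction from the leaves (`isSection_edgeField`).

The bookkeeping is isolated in `IsTauClosed`: a weighted set of diagrams closed under exchanging the
slots and under moving an edge as above. `correlator_eq` removes first the diagrams that touch
`τ_0`, then those that touch `τ_1` only. -/

theorem fderiv_eq_del_add_delBar (f : E → F) (x v : E) :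
    fderiv ℝ f x v = del f x v + delBar f x v := by
  simp only [del, delBar]
  module

theorem fderiv_I_smul_eq (f : E → F) (x v : E) :
    fderiv ℝ f x (Complex.I • v) = Complex.I • del f x v - Complex.I • delBar f x v := by
  simp only [del, delBar]
  match_scalars
  · linear_combination Complex.I_mul_I
  · ring

theorem del_add (f : E → F) (x v w : E) : del f x (v + w) = del f x v + del f x w := by
  simp only [del, smul_add, map_add]
  module

theorem delBar_add (f : E → F) (x v w : E) :
    delBar f x (v + w) = delBar f x v + delBar f x w := by
  simp only [delBar, smul_add, map_add]
  module

theorem fderiv_smul_eq (f : E → F) (x v : E) (c : ℂ) :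
    fderiv ℝ f x (c • v) =
      (c.re : ℂ) • fderiv ℝ f x v + (c.im : ℂ) • fderiv ℝ f x (Complex.I • v) := by
  have h : c • v = c.re • v + c.im • (Complex.I • v) := by
    rw [← Complex.coe_smul, ← Complex.coe_smul, smul_smul, ← add_smul, Complex.re_add_im]
  rw [h, map_add, map_smul, map_smul, Complex.coe_smul, Complex.coe_smul]

theorem del_smul (f : E → F) (x v : E) (c : ℂ) : del f x (c • v) = c • del f x v := by
  have h : Complex.I • c • v = (Complex.I * c) • v := smul_smul _ _ _
  rw [del, del, h, fderiv_smul_eq f x v c, fderiv_smul_eq f x v (Complex.I * c), Complex.I_mul_re,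
    Complex.I_mul_im]
  have hc : c = c.re + c.im * Complex.I := (Complex.re_add_im c).symm
  generalize c.re = a at *
  generalize c.im = b at *
  subst hc
  push_cast
  match_scalars
  · ring
  · linear_combination (1 / 2 * b : ℂ) * Complex.I_mul_I

theorem delBar_smul (f : E → F) (x v : E) (c : ℂ) :
    delBar f x (c • v) = star c • delBar f x v := by
  have h : Complex.I • c • v = (Complex.I * c) • v := smul_smul _ _ _
  rw [delBar, delBar, h, fderiv_smul_eq f x v c, fderiv_smul_eq f x v (Complex.I * c),
    Complex.I_mul_re, Complex.I_mul_im]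
  have hc : c = c.re + c.im * Complex.I := (Complex.re_add_im c).symm
  have hc' : star c = c.re - c.im * Complex.I := by
    apply Complex.ext <;> simp
  rw [hc']
  push_cast
  match_scalars
  · ring
  · linear_combination (1 / 2 * c.im : ℂ) * Complex.I_mul_I

theorem del_zero (f : E → F) (x : E) : del f x 0 = 0 := by
  simpa using del_smul f x 0 0

theorem del_sum {ι : Type*} (s : Finset ι) (f : E → F) (x : E) (v : ι → E) :
    del f x (∑ i ∈ s, v i) = ∑ i ∈ s, del f x (v i) := by
  classical
  induction s using Finset.induction_on with
  | empty => simp [del_zero]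
  | insert a s ha ih => simp [Finset.sum_insert ha, del_add, ih]

theorem del_congr {f g : E → F} {x : E} (h : f =ᶠ[𝓝 x] g) (v : E) : del f x v = del g x v := by
  simp only [del, h.fderiv_eq]

theorem delBar_congr {f g : E → F} {x : E} (h : f =ᶠ[𝓝 x] g) (v : E) :
    delBar f x v = delBar g x v := by
  simp only [delBar, h.fderiv_eq]

theorem delBar_fun_add {f g : E → F} {x : E} (hf : DifferentiableAt ℝ f x)
    (hg : DifferentiableAt ℝ g x) (v : E) :
    delBar (fun y => f y + g y) x v = delBar f x v + delBar g x v := by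
  simp only [delBar, fderiv_fun_add hf hg, add_apply]
  module

theorem del_const (c : F) (x v : E) : del (fun _ => c) x v = 0 := by simp [del]

theorem del_fun_sum {ι : Type*} (s : Finset ι) {f : ι → E → F} {x : E}
    (hf : ∀ i ∈ s, DifferentiableAt ℝ (f i) x) (v : E) :
    del (fun y => ∑ i ∈ s, f i y) x v = ∑ i ∈ s, del (f i) x v := by
  simp only [del, fderiv_fun_sum hf, sum_apply, Finset.smul_sum,
    Finset.sum_sub_distrib, smul_sub]

theorem delBar_fun_sum {ι : Type*} (s : Finset ι) {f : ι → E → F} {x : E}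
    (hf : ∀ i ∈ s, DifferentiableAt ℝ (f i) x) (v : E) :
    delBar (fun y => ∑ i ∈ s, f i y) x v = ∑ i ∈ s, delBar (f i) x v := by
  simp only [delBar, fderiv_fun_sum hf, sum_apply, Finset.smul_sum,
    Finset.sum_add_distrib, smul_add]

/-- Wirtinger derivatives of a bilinear expression. -/
theorem del_bilinear (B : E →L[ℂ] F →L[ℂ] G) {f : V → E} {g : V → F} {x : V}
    (hf : DifferentiableAt ℝ f x) (hg : DifferentiableAt ℝ g x) (v : V) :
    del (fun y => B (f y) (g y)) x v = B (del f x v) (g x) + B (f x) (del g x v) := by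
  have h := ((B.bilinearRestrictScalars ℝ).hasFDerivAt_of_bilinear hf.hasFDerivAt
    hg.hasFDerivAt).fderiv
  have h' : fderiv ℝ (fun y => B (f y) (g y)) x = _ := h
  simp only [del, h']
  simp
  module

theorem delBar_bilinear (B : E →L[ℂ] F →L[ℂ] G) {f : V → E} {g : V → F} {x : V}
    (hf : DifferentiableAt ℝ f x) (hg : DifferentiableAt ℝ g x) (v : V) :
    delBar (fun y => B (f y) (g y)) x v = B (delBar f x v) (g x) + B (f x) (delBar g x v) := by
  have h := ((B.bilinearRestrictScalars ℝ).hasFDerivAt_of_bilinear hf.hasFDerivAt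
    hg.hasFDerivAt).fderiv
  have h' : fderiv ℝ (fun y => B (f y) (g y)) x = _ := h
  simp only [delBar, h']
  simp
  module

theorem del_fun_smul {f : V → ℂ} {g : V → F} {x : V}
    (hf : DifferentiableAt ℝ f x) (hg : DifferentiableAt ℝ g x) (v : V) :
    del (fun y => f y • g y) x v = del f x v • g x + f x • del g x v :=
  del_bilinear (ContinuousLinearMap.lsmul ℂ ℂ) hf hg v

theorem delBar_fun_smul {f : V → ℂ} {g : V → F} {x : V}
    (hf : DifferentiableAt ℝ f x) (hg : DifferentiableAt ℝ g x) (v : V) :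
    delBar (fun y => f y • g y) x v = delBar f x v • g x + f x • delBar g x v :=
  delBar_bilinear (ContinuousLinearMap.lsmul ℂ ℂ) hf hg v

theorem del_clm_comp (L : E →L[ℂ] F) {f : V → E} {x : V} (hf : DifferentiableAt ℝ f x) (v : V) :
    del (fun y => L (f y)) x v = L (del f x v) := by
  have h : fderiv ℝ (fun y => L (f y)) x = (L.restrictScalars ℝ).comp (fderiv ℝ f x) :=
    ((L.restrictScalars ℝ).hasFDerivAt.comp x hf.hasFDerivAt).fderiv
  simp [del, h]

theorem delBar_clm_comp (L : E →L[ℂ] F) {f : V → E} {x : V} (hf : DifferentiableAt ℝ f x)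
    (v : V) : delBar (fun y => L (f y)) x v = L (delBar f x v) := by
  have h : fderiv ℝ (fun y => L (f y)) x = (L.restrictScalars ℝ).comp (fderiv ℝ f x) :=
    ((L.restrictScalars ℝ).hasFDerivAt.comp x hf.hasFDerivAt).fderiv
  simp [delBar, h]

theorem del_eq_of_hasFDerivAt {f : E → F} {f' : E →L[ℂ] F} {x : E} (hf : HasFDerivAt f f' x)
    (v : E) : del f x v = f' v := by
  have h : fderiv ℝ f x = f'.restrictScalars ℝ := (hf.restrictScalars ℝ).fderiv
  simp only [del, h, ContinuousLinearMap.coe_restrictScalars', map_smul, smul_smul,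
    Complex.I_mul_I]
  module

theorem delBar_eq_zero_of_hasFDerivAt {f : E → F} {f' : E →L[ℂ] F} {x : E}
    (hf : HasFDerivAt f f' x) (v : E) : delBar f x v = 0 := by
  have h : fderiv ℝ f x = f'.restrictScalars ℝ := (hf.restrictScalars ℝ).fderiv
  simp only [delBar, h, ContinuousLinearMap.coe_restrictScalars', map_smul, smul_smul,
    Complex.I_mul_I]
  module

/-- The chain rule for the Wirtinger derivatives of `f ∘ g` with `g` complex differentiable. -/
theorem del_comp {f : E → F} {g : V → E} {g' : V →L[ℂ] E} {x : V}
    (hf : DifferentiableAt ℝ f (g x)) (hg : HasFDerivAt g g' x) (v : V) :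
    del (fun y => f (g y)) x v = del f (g x) (g' v) := by
  have h : fderiv ℝ (fun y => f (g y)) x = (fderiv ℝ f (g x)).comp (g'.restrictScalars ℝ) :=
    (hf.hasFDerivAt.comp x (hg.restrictScalars ℝ)).fderiv
  simp [del, h]

theorem delBar_comp {f : E → F} {g : V → E} {g' : V →L[ℂ] E} {x : V}
    (hf : DifferentiableAt ℝ f (g x)) (hg : HasFDerivAt g g' x) (v : V) :
    delBar (fun y => f (g y)) x v = delBar f (g x) (g' v) := by
  have h : fderiv ℝ (fun y => f (g y)) x = (fderiv ℝ f (g x)).comp (g'.restrictScalars ℝ) :=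
    (hf.hasFDerivAt.comp x (hg.restrictScalars ℝ)).fderiv
  simp [delBar, h]

theorem contDiffOn_fderiv_apply {f : E → F} {s : Set E} (hs : IsOpen s)
    (hf : ContDiffOn ℝ ∞ f s) (v : E) : ContDiffOn ℝ ∞ (fun x => fderiv ℝ f x v) s :=
  (hf.fderiv_of_isOpen hs (m := ∞) (by simp)).clm_apply contDiffOn_const

theorem contDiffOn_del {f : E → F} {s : Set E} (hs : IsOpen s)
    (hf : ContDiffOn ℝ ∞ f s) (v : E) : ContDiffOn ℝ ∞ (fun x => del f x v) s :=
  ((contDiffOn_fderiv_apply hs hf v).sub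
    ((contDiffOn_fderiv_apply hs hf _).const_smul Complex.I)).const_smul (1 / 2 : ℂ)

theorem _root_.ContDiffOn.differentiableAt_of_isOpen {f : E → F} {s : Set E}
    (hf : ContDiffOn ℝ ∞ f s) (hs : IsOpen s) {x : E} (hx : x ∈ s) : DifferentiableAt ℝ f x :=
  (hf.contDiffAt (hs.mem_nhds hx)).differentiableAt (by simp)

theorem fderiv_fderiv_apply_comm {f : E → F} {s : Set E} (hs : IsOpen s)
    (hf : ContDiffOn ℝ ∞ f s) {x : E} (hx : x ∈ s) (v w : E) :
    fderiv ℝ (fun y => fderiv ℝ f y v) x w = fderiv ℝ (fun y => fderiv ℝ f y w) x v := by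
  have hd : DifferentiableAt ℝ (fderiv ℝ f) x :=
    (hf.fderiv_of_isOpen hs (m := ∞) (by simp)).differentiableAt_of_isOpen hs hx
  have h (u : E) : fderiv ℝ (fun y => fderiv ℝ f y u) x = (fderiv ℝ (fderiv ℝ f) x).flip u := by
    ext w
    rw [fderiv_clm_apply hd (differentiableAt_const _)]
    simp
  rw [h, h]
  have := (hf.contDiffAt (hs.mem_nhds hx)).isSymmSndFDerivAt (by
    simp only [minSmoothness_of_isRCLikeNormedField]; 
    exact WithTop.coe_le_coe.2 (le_top : (2 : ℕ∞) ≤ ⊤))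
  exact this w v

theorem fderiv_del {f : E → F} {s : Set E} (hs : IsOpen s)
    (hf : ContDiffOn ℝ ∞ f s) {x : E} (hx : x ∈ s) (v w : E) :
    fderiv ℝ (fun y => del f y v) x w = (1 / 2 : ℂ) • (fderiv ℝ (fun y => fderiv ℝ f y v) x w -
      Complex.I • fderiv ℝ (fun y => fderiv ℝ f y (Complex.I • v)) x w) := by
  have h (u : E) : DifferentiableAt ℝ (fun y => fderiv ℝ f y u) x :=
    (contDiffOn_fderiv_apply hs hf u).differentiableAt_of_isOpen hs hx
  have h' : DifferentiableAt ℝ (fun y => Complex.I • fderiv ℝ f y (Complex.I • v)) x :=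
    (h _).const_smul _
  simp only [del]
  rw [fderiv_fun_const_smul ((h v).fun_sub h'), fderiv_fun_sub (h v) h',
    fderiv_fun_const_smul (h (Complex.I • v))]
  simp

theorem fderiv_delBar {f : E → F} {s : Set E} (hs : IsOpen s)
    (hf : ContDiffOn ℝ ∞ f s) {x : E} (hx : x ∈ s) (v w : E) :
    fderiv ℝ (fun y => delBar f y v) x w =
      (1 / 2 : ℂ) • (fderiv ℝ (fun y => fderiv ℝ f y v) x w +
      Complex.I • fderiv ℝ (fun y => fderiv ℝ f y (Complex.I • v)) x w) := by
  have h (u : E) : DifferentiableAt ℝ (fun y => fderiv ℝ f y u) x :=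
    (contDiffOn_fderiv_apply hs hf u).differentiableAt_of_isOpen hs hx
  have h' : DifferentiableAt ℝ (fun y => Complex.I • fderiv ℝ f y (Complex.I • v)) x :=
    (h _).const_smul _
  simp only [delBar]
  rw [fderiv_fun_const_smul ((h v).fun_add h'), fderiv_fun_add (h v) h',
    fderiv_fun_const_smul (h (Complex.I • v))]
  simp

theorem del_del_comm {f : E → F} {s : Set E} (hs : IsOpen s)
    (hf : ContDiffOn ℝ ∞ f s) {x : E} (hx : x ∈ s) (v w : E) :
    del (fun y => del f y v) x w = del (fun y => del f y w) x v := by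
  rw [del, del, fderiv_del hs hf hx, fderiv_del hs hf hx, fderiv_del hs hf hx,
    fderiv_del hs hf hx, fderiv_fderiv_apply_comm hs hf hx v w,
    fderiv_fderiv_apply_comm hs hf hx (Complex.I • v) w,
    fderiv_fderiv_apply_comm hs hf hx v (Complex.I • w),
    fderiv_fderiv_apply_comm hs hf hx (Complex.I • v) (Complex.I • w)]
  module

theorem delBar_del_comm {f : E → F} {s : Set E} (hs : IsOpen s)
    (hf : ContDiffOn ℝ ∞ f s) {x : E} (hx : x ∈ s) (v w : E) :
    delBar (fun y => del f y v) x w = del (fun y => delBar f y w) x v := by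
  rw [del, delBar, fderiv_del hs hf hx, fderiv_delBar hs hf hx, fderiv_del hs hf hx,
    fderiv_delBar hs hf hx, fderiv_fderiv_apply_comm hs hf hx v w,
    fderiv_fderiv_apply_comm hs hf hx (Complex.I • v) w,
    fderiv_fderiv_apply_comm hs hf hx v (Complex.I • w),
    fderiv_fderiv_apply_comm hs hf hx (Complex.I • v) (Complex.I • w)]
  module

/-! ### Homogeneous functions -/

/-- `f` is homogeneous of bidegree `(p, q)` on the cone `s`. -/
def IsHomogeneousOn (p q : ℤ) (f : E → F) (s : Set E) : Prop :=
  ∀ x ∈ s, ∀ t : ℂ, t ≠ 0 → f (t • x) = (t ^ p * star t ^ q) • f x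

/-- Differentiate `f ((1 + r c) x)` at `r = 0` along real `r`. The directions `c = 1` and `c = i`
together yield both Euler identities below. -/
theorem fderiv_smul_of_isHomogeneousOn {p q : ℤ} {f : E → F} {s : Set E}
    (hf : IsHomogeneousOn p q f s) {x : E} (hx : x ∈ s) (hd : DifferentiableAt ℝ f x) (c : ℂ) :
    fderiv ℝ f x (c • x) = (p * c + q * star c) • f x := by
  have h1 : HasDerivAt (fun r : ℝ => (1 + r * c) • x) (c • x) 0 := by
    have : HasDerivAt (fun r : ℝ => (1 + (r : ℂ) * c)) c 0 := by
      simpa using ((Complex.ofRealCLM.hasDerivAt (x := (0 : ℝ))).mul_const c).const_add 1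
    exact this.smul_const x
  have h2 : HasDerivAt (fun r : ℝ => f ((1 + r * c) • x)) (fderiv ℝ f x (c • x)) 0 := by
    have h0 : (1 + ((0 : ℝ) : ℂ) * c) • x = x := by simp
    refine HasFDerivAt.comp_hasDerivAt (0 : ℝ) ?_ h1
    rw [h0]; exact hd.hasFDerivAt
  have h3 : HasDerivAt (fun r : ℝ => (1 + r * c) ^ p * (1 + r * star c) ^ q)
      (p * c + q * star c) 0 := by
    have h (d : ℂ) (n : ℤ) : HasDerivAt (fun r : ℝ => (1 + (r : ℂ) * d) ^ n) (n * d) 0 := by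
      have h4 : HasDerivAt (fun r : ℝ => (1 + (r : ℂ) * d)) d 0 := by
        simpa using ((Complex.ofRealCLM.hasDerivAt (x := (0 : ℝ))).mul_const d).const_add 1
      have h5 : HasDerivAt (fun x : ℂ => x ^ n) n (1 + ((0 : ℝ) : ℂ) * d) := by
        simpa using hasDerivAt_zpow n (1 + ((0 : ℝ) : ℂ) * d) (by simp)
      exact h5.comp (0 : ℝ) h4
    exact ((h c p).mul (h (star c) q)).congr_deriv (by simp)
  have h4 : (fun r : ℝ => f ((1 + r * c) • x)) =ᶠ[𝓝 0]
      fun r : ℝ => ((1 + r * c) ^ p * (1 + r * star c) ^ q) • f x := by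
    have hc : ContinuousAt (fun r : ℝ => (1 + (r : ℂ) * c)) 0 := by fun_prop
    have : ∀ᶠ r : ℝ in 𝓝 0, (1 + (r : ℂ) * c) ≠ 0 := hc.eventually_ne (by simp)
    filter_upwards [this] with r hr
    rw [hf x hx _ hr]
    simp
  exact h2.unique ((h3.smul_const (f x)).congr_of_eventuallyEq h4)

theorem del_self_of_isHomogeneousOn {p q : ℤ} {f : E → F} {s : Set E}
    (hf : IsHomogeneousOn p q f s) {x : E} (hx : x ∈ s) (hd : DifferentiableAt ℝ f x) :
    del f x x = (p : ℂ) • f x := by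
  have h1 := fderiv_smul_of_isHomogeneousOn hf hx hd 1
  rw [one_smul] at h1
  rw [del, h1, fderiv_smul_of_isHomogeneousOn hf hx hd, Complex.star_def, Complex.conj_I]
  simp only [map_one]
  match_scalars
  linear_combination (-(p - q) / 2 : ℂ) * Complex.I_mul_I

theorem delBar_self_of_isHomogeneousOn {p q : ℤ} {f : E → F} {s : Set E}
    (hf : IsHomogeneousOn p q f s) {x : E} (hx : x ∈ s) (hd : DifferentiableAt ℝ f x) :
    delBar f x x = (q : ℂ) • f x := by
  have h1 := fderiv_smul_of_isHomogeneousOn hf hx hd 1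
  rw [one_smul] at h1
  rw [delBar, h1, fderiv_smul_of_isHomogeneousOn hf hx hd, Complex.star_def, Complex.conj_I]
  simp only [map_one]
  match_scalars
  linear_combination ((p - q) / 2 : ℂ) * Complex.I_mul_I

/-- Differentiating `f (t • x) = t ^ p * star t ^ q • f x` pulls out one factor `t` on the left and
none of `star t`, since the `(1,0)`-derivative is complex linear in its direction. -/
theorem IsHomogeneousOn.del_const {p q : ℤ} {f : E → F} {s : Set E}
    (hf : IsHomogeneousOn p q f s) (hs : IsOpen s) (hsm : ∀ x ∈ s, ∀ t : ℂ, t ≠ 0 → t • x ∈ s)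
    (hd : ∀ x ∈ s, DifferentiableAt ℝ f x) (v : E) :
    IsHomogeneousOn (p - 1) q (fun x => del f x v) s := by
  intro x hx t ht
  have hg : HasFDerivAt (fun y : E => t • y) (t • ContinuousLinearMap.id ℂ E) x :=
    (ContinuousLinearMap.id ℂ E).hasFDerivAt.const_smul t
  have h1 := del_comp (hd _ (hsm x hx t ht)) hg v
  have h2 : (fun y => f (t • y)) =ᶠ[𝓝 x] fun y => (t ^ p * star t ^ q) • f y := by
    filter_upwards [hs.mem_nhds hx] with y hy using hf y hy t ht
  rw [del_congr h2] at h1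
  have h3 := del_clm_comp ((t ^ p * star t ^ q) • ContinuousLinearMap.id ℂ F) (hd x hx) v
  simp only [smul_apply, ContinuousLinearMap.id_apply] at h1 h3
  rw [h3, del_smul] at h1
  rw [zpow_sub_one₀ ht]
  change del f (t • x) v = _
  rw [← inv_smul_smul₀ ht (del f (t • x) v), ← h1, smul_smul]
  congr 1; ring

end WirtingerCalculus

section IteratedDerivatives

variable {V F : Type*} [NormedAddCommGroup V] [NormedSpace ℂ V]
  [NormedAddCommGroup F] [NormedSpace ℂ F]

/-! ### Iterated (1,0)-derivatives -/

theorem contDiffOn_iterDel {f : V → F} {s : Set V} (hs : IsOpen s) (hf : ContDiffOn ℝ ∞ f s)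
    (vs : List V) : ContDiffOn ℝ ∞ (iterDel f vs) s := by
  induction vs with
  | nil => exact hf
  | cons v vs ih => exact contDiffOn_del hs ih v

theorem iterDel_congr {f g : V → F} {s : Set V} (hs : IsOpen s) (h : ∀ x ∈ s, f x = g x)
    (vs : List V) {x : V} (hx : x ∈ s) : iterDel f vs x = iterDel g vs x := by
  induction vs generalizing x with
  | nil => exact h x hx
  | cons v vs ih =>
    exact del_congr (by filter_upwards [hs.mem_nhds hx] with y hy using ih hy) v

/-- Commutation of `(1,0)`-derivatives. It makes a list of directions behave like a multiset, so the
order in which fields are contracted into a vertex is immaterial. -/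
theorem iterDel_perm {f : V → F} {s : Set V} (hs : IsOpen s) (hf : ContDiffOn ℝ ∞ f s)
    {vs ws : List V} (h : vs.Perm ws) {x : V} (hx : x ∈ s) : iterDel f vs x = iterDel f ws x := by
  induction h generalizing x with
  | nil => rfl
  | cons v _ ih =>
    exact del_congr (by filter_upwards [hs.mem_nhds hx] with y hy using ih hy) v
  | swap v w l => exact del_del_comm hs (contDiffOn_iterDel hs hf l) hx v w
  | trans _ _ ih₁ ih₂ => exact (ih₁ hx).trans (ih₂ hx)

theorem iterDel_append_singleton (f : V → F) (vs : List V) (v : V) :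
    iterDel f (vs ++ [v]) = iterDel (fun y => del f y v) vs := by
  induction vs with
  | nil => rfl
  | cons w vs ih => simp only [List.cons_append, iterDel, ih]

/-- Moves the outermost derivative to the innermost place, where it is absorbed into the function;
inductions on the list can then run over all smooth functions. -/
theorem iterDel_cons' {f : V → F} {s : Set V} (hs : IsOpen s) (hf : ContDiffOn ℝ ∞ f s)
    (v : V) (vs : List V) {x : V} (hx : x ∈ s) :
    iterDel f (v :: vs) x = iterDel (fun y => del f y v) vs x := by
  rw [← iterDel_append_singleton]
  exact iterDel_perm hs hf (List.perm_append_singleton v vs).symm hx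

theorem iterDel_fun_sum_smul {ι : Type*} (t : Finset ι) {f : ι → V → F} {s : Set V}
    (hs : IsOpen s) (hf : ∀ i, ContDiffOn ℝ ∞ (f i) s) (c : ι → ℂ) (vs : List V) {x : V}
    (hx : x ∈ s) :
    iterDel (fun y => ∑ i ∈ t, c i • f i y) vs x = ∑ i ∈ t, c i • iterDel (f i) vs x := by
  induction vs generalizing x with
  | nil => rfl
  | cons v vs ih =>
    have hd (i : ι) : DifferentiableAt ℝ (iterDel (f i) vs) x :=
      (contDiffOn_iterDel hs (hf i) vs).differentiableAt_of_isOpen hs hx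
    simp only [iterDel]
    rw [del_congr (g := fun y => ∑ i ∈ t, c i • iterDel (f i) vs y)
      (by filter_upwards [hs.mem_nhds hx] with y hy using ih hy),
      del_fun_sum t (fun i _ => (hd i).fun_const_smul (c i))]
    refine Finset.sum_congr rfl fun i _ => ?_
    exact del_clm_comp (c i • ContinuousLinearMap.id ℂ F) (hd i) v

theorem iterDel_homogeneous {p q : ℤ} {f : V → F} {s : Set V} (hs : IsOpen s)
    (hsm : ∀ x ∈ s, ∀ t : ℂ, t ≠ 0 → t • x ∈ s) (hf : ContDiffOn ℝ ∞ f s)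
    (hh : IsHomogeneousOn p q f s) (vs : List V) :
    IsHomogeneousOn (p - vs.length) q (iterDel f vs) s := by
  induction vs with
  | nil => simpa [iterDel] using hh
  | cons v vs ih =>
    have := ih.del_const hs hsm
      (fun x hx => (contDiffOn_iterDel hs hf vs).differentiableAt_of_isOpen hs hx) v
    rw [List.length_cons]
    rw [show p - ((vs.length + 1 : ℕ) : ℤ) = p - vs.length - 1 by push_cast; ring]
    exact this

/-- The Euler identity for iterated derivatives. -/
theorem iterDel_cons_self {p q : ℤ} {f : V → F} {s : Set V} (hs : IsOpen s)
    (hsm : ∀ x ∈ s, ∀ t : ℂ, t ≠ 0 → t • x ∈ s) (hf : ContDiffOn ℝ ∞ f s)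
    (hh : IsHomogeneousOn p q f s) (vs : List V) {x : V} (hx : x ∈ s) :
    iterDel f (x :: vs) x = ((p - vs.length : ℤ) : ℂ) • iterDel f vs x :=
  del_self_of_isHomogeneousOn (iterDel_homogeneous hs hsm hf hh vs) hx
    ((contDiffOn_iterDel hs hf vs).differentiableAt_of_isOpen hs hx)

theorem iterDel_map_smul {f : V → F} {s : Set V} (hs : IsOpen s) (t : ℂ) (vs : List V)
    {x : V} (hf : ContDiffOn ℝ ∞ f s) (hx : x ∈ s) :
    iterDel f (vs.map (t • ·)) x = t ^ vs.length • iterDel f vs x := by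
  induction vs generalizing x with
  | nil => simp
  | cons v vs ih =>
    have hd : DifferentiableAt ℝ (iterDel f vs) x :=
      (contDiffOn_iterDel hs hf vs).differentiableAt_of_isOpen hs hx
    simp only [List.map_cons, iterDel, List.length_cons]
    rw [del_congr (g := fun y => t ^ vs.length • iterDel f vs y)
      (by filter_upwards [hs.mem_nhds hx] with y hy using ih hy), del_smul]
    have := del_clm_comp (t ^ vs.length • ContinuousLinearMap.id ℂ F) hd v
    simp only [smul_apply, ContinuousLinearMap.id_apply] at this
    rw [this, smul_smul, pow_succ']

end IteratedDerivatives

/-! ### Derivatives along directions that depend on a parameter -/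

section MovingDirections

variable {P F : Type*} [NormedAddCommGroup P] [NormedSpace ℂ P]
  [NormedAddCommGroup F] [NormedSpace ℂ F]

theorem del_eq_sum_single (f : Twistor → F) (x v : Twistor) :
    del f x v = ∑ j, v j • del f x (Pi.single j 1) := by
  conv_lhs => rw [← Finset.univ_sum_single v]
  rw [del_sum]
  refine Finset.sum_congr rfl fun j _ => ?_
  rw [← del_smul]
  congr 1
  ext k
  rcases eq_or_ne k j with rfl | hk
  · simp
  · simp [hk]

/-- Expanding in coordinates separates a moving direction into scalar coefficients and derivatives
along fixed vectors; this is what makes the product rule available for `iterDel`, which only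
differentiates along constants. -/
theorem iterDel_cons_eq_sum {f : Twistor → F} {s : Set Twistor} (hs : IsOpen s)
    (hf : ContDiffOn ℝ ∞ f s) (v : Twistor) (vs : List Twistor) {x : Twistor} (hx : x ∈ s) :
    iterDel f (v :: vs) x =
      ∑ j, v j • iterDel (fun y => del f y (Pi.single j 1)) vs x := by
  rw [iterDel_cons' hs hf v vs hx, ← iterDel_fun_sum_smul Finset.univ hs
    (fun j => contDiffOn_del hs hf _) v vs hx]
  exact iterDel_congr hs (fun y _ => del_eq_sum_single f y v) vs hx

theorem contDiffOn_iterDel_map {f : Twistor → F} {s : Set Twistor} (hs : IsOpen s)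
    (hf : ContDiffOn ℝ ∞ f s) {Ω : Set P} {Z : P → Twistor} (hZ : ContDiffOn ℝ ∞ Z Ω)
    (hZs : ∀ x ∈ Ω, Z x ∈ s) (L : List (P → Twistor)) (hL : ∀ X ∈ L, ContDiffOn ℝ ∞ X Ω) :
    ContDiffOn ℝ ∞ (fun x => iterDel f (L.map fun X => X x) (Z x)) Ω := by
  induction L generalizing f with
  | nil => exact hf.comp hZ hZs
  | cons X L ih =>
    have hX := hL X (by simp)
    have h : ContDiffOn ℝ ∞ (fun x => ∑ j, X x j •
        iterDel (fun y => del f y (Pi.single j 1)) (L.map fun X => X x) (Z x)) Ω := by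
      refine ContDiffOn.sum fun j _ => ?_
      exact (contDiffOn_pi.1 hX j).smul
        (ih (contDiffOn_del hs hf _) fun Y hY => hL Y (by simp [hY]))
    exact h.congr fun x hx => iterDel_cons_eq_sum hs hf _ _ (hZs x hx)

/-- The chain rule for an iterated derivative along moving directions. -/
theorem del_iterDel_map {ι : Type*} [DecidableEq ι] {f : Twistor → F} {s : Set Twistor}
    (hs : IsOpen s) (hf : ContDiffOn ℝ ∞ f s) {Z : P → Twistor} {Z' : P →L[ℂ] Twistor} {x : P}
    (hZ : HasFDerivAt Z Z' x) (hZs : ∀ᶠ y in 𝓝 x, Z y ∈ s) (X : ι → P → Twistor) (L : List ι)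
    (hLn : L.Nodup) (hL : ∀ c ∈ L, DifferentiableAt ℝ (X c) x) (u : P) :
    del (fun y => iterDel f (L.map fun c => X c y) (Z y)) x u =
      iterDel f (Z' u :: L.map fun c => X c x) (Z x) +
      (L.map fun c => iterDel f (del (X c) x u :: (L.erase c).map fun c => X c x) (Z x)).sum := by
  have hx : Z x ∈ s := hZs.self_of_nhds
  have hZd : DifferentiableAt ℝ Z x := (hZ.restrictScalars ℝ).differentiableAt
  induction L generalizing f with
  | nil =>
    simp only [List.map_nil, List.sum_nil, add_zero, iterDel]
    exact del_comp (hf.differentiableAt_of_isOpen hs hx) hZ u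
  | cons a L ih =>
    have hda := hL a (by simp)
    have hLn' := List.nodup_cons.1 hLn
    have hdL : ∀ c ∈ L, DifferentiableAt ℝ (X c) x := fun c hc => hL c (by simp [hc])
    -- Differentiability needs an induction of its own, over all smooth `g`, because each expansion
    -- replaces `g` by a coordinate derivative.
    have hdj (j : Fin 4) : DifferentiableAt ℝ (fun y =>
        iterDel (fun y => del f y (Pi.single j 1)) (L.map fun c => X c y) (Z y)) x := by
      have hfj := contDiffOn_del hs hf (Pi.single j (1 : ℂ))
      clear ih hLn hLn' hL hda
      generalize (fun y => del f y (Pi.single j (1 : ℂ))) = g at hfj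
      induction L generalizing g with
      | nil => exact (hfj.differentiableAt_of_isOpen hs hx).comp x hZd
      | cons b L ih =>
        have h1 : (fun y => iterDel g ((b :: L).map fun c => X c y) (Z y)) =ᶠ[𝓝 x] fun y =>
            ∑ j, X b y j • iterDel (fun y => del g y (Pi.single j 1)) (L.map fun c => X c y)
              (Z y) := by
          filter_upwards [hZs] with y hy using iterDel_cons_eq_sum hs hfj _ _ hy
        refine DifferentiableAt.congr_of_eventuallyEq ?_ h1
        refine DifferentiableAt.fun_sum fun j _ => ?_
        exact (differentiableAt_pi.1 (hdL b (by simp)) j).smul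
          (ih (fun c hc => hdL c (by simp [hc])) _ (contDiffOn_del hs hfj _))
    have hdX (j : Fin 4) : DifferentiableAt ℝ (fun y => X a y j) x := differentiableAt_pi.1 hda j
    have hXj (j : Fin 4) : del (fun y => X a y j) x u = del (X a) x u j :=
      del_clm_comp (ContinuousLinearMap.proj (R := ℂ) (φ := fun _ : Fin 4 => ℂ) j) hda u
    have h1 : (fun y => iterDel f ((a :: L).map fun c => X c y) (Z y)) =ᶠ[𝓝 x] fun y =>
        ∑ j, X a y j • iterDel (fun y => del f y (Pi.single j 1)) (L.map fun c => X c y)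
          (Z y) := by
      filter_upwards [hZs] with y hy using iterDel_cons_eq_sum hs hf _ _ hy
    rw [del_congr h1, del_fun_sum _ fun j _ => (hdX j).fun_smul (hdj j)]
    have h2 (j : Fin 4) := del_fun_smul (hdX j) (hdj j) u
    simp only [h2, ih (contDiffOn_del hs hf _) hLn'.2 hdL, hXj, Finset.sum_add_distrib, smul_add]
    have hswap (v w : Twistor) (vs : List Twistor) :
        iterDel f (v :: w :: vs) (Z x) = iterDel f (w :: v :: vs) (Z x) :=
      iterDel_perm hs hf (List.Perm.swap _ _ _) hx
    rw [← iterDel_cons_eq_sum hs hf _ _ hx, ← iterDel_cons_eq_sum hs hf _ _ hx]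
    have h3 : (∑ j, X a x j • (L.map fun c => iterDel (fun y => del f y (Pi.single j 1))
        (del (X c) x u :: (L.erase c).map fun c => X c x) (Z x)).sum) =
        (L.map fun c => iterDel f (del (X c) x u :: ((a :: L).erase c).map fun c => X c x)
          (Z x)).sum := by
      simp only [List.smul_sum, List.map_map]
      -- The list summed over is decoupled from the list inside `erase`, as the induction concerns
      -- only the former.
      have h4 (M : List ι) (hM : ∀ c ∈ M, c ∈ L) :
          (∑ j, (M.map ((X a x j • ·) ∘ fun c => iterDel (fun y => del f y (Pi.single j 1))
          (del (X c) x u :: (L.erase c).map fun c => X c x) (Z x))).sum) =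
          (M.map fun c => iterDel f (del (X c) x u :: ((a :: L).erase c).map fun c => X c x)
          (Z x)).sum := by
        induction M with
        | nil => simp
        | cons b M ihM =>
          have hb : b ∈ L := hM b (by simp)
          have hab : a ≠ b := by rintro rfl; exact hLn'.1 hb
          simp only [List.map_cons, List.sum_cons, Finset.sum_add_distrib,
            ihM fun c hc => hM c (by simp [hc])]
          congr 1
          rw [List.erase_cons_tail (by simpa using hab), List.map_cons, hswap,
            iterDel_cons_eq_sum hs hf _ _ hx]
          rfl
      exact h4 L fun c hc => hc
    rw [h3, List.map_cons, List.map_cons, List.sum_cons, List.erase_cons_head,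
      hswap (Z' u)]
    abel

end MovingDirections

/-! ### Geometry of the spinor space -/

/-- The Hermitian square norm of a spinor. -/
def nsq (σ : Spinor) : ℝ := ‖σ 0‖ ^ 2 + ‖σ 1‖ ^ 2

/-- The quaternionic conjugate of a spinor, a unitary complement. -/
def quat (σ : Spinor) : Spinor := ![-star (σ 1), star (σ 0)]

/-- The affine coordinate on the projective line that is centred at `σ`. -/
def chart (σ : Spinor) (z : ℂ) : Spinor := σ + z • quat σ

@[simp] theorem quat_zero_apply (σ : Spinor) : quat σ 0 = -star (σ 1) := rfl
@[simp] theorem quat_one_apply (σ : Spinor) : quat σ 1 = star (σ 0) := rfl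

@[simp] theorem chart_zero_apply (σ : Spinor) (z : ℂ) : chart σ z 0 = σ 0 - z * star (σ 1) := by
  simp [chart, sub_eq_add_neg]

@[simp] theorem chart_one_apply (σ : Spinor) (z : ℂ) : chart σ z 1 = σ 1 + z * star (σ 0) := by
  simp [chart]

theorem chart_zero (σ : Spinor) : chart σ 0 = σ := by simp [chart]

@[simp] theorem affine_zero_apply (z : ℂ) : affine z 0 = 1 := rfl
@[simp] theorem affine_one_apply (z : ℂ) : affine z 1 = z := rfl

theorem nsq_nonneg (σ : Spinor) : 0 ≤ nsq σ := by unfold nsq; positivity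

theorem spinor_ne_zero_iff {σ : Spinor} : σ ≠ 0 ↔ σ 0 ≠ 0 ∨ σ 1 ≠ 0 := by
  rw [Function.ne_iff]
  simp

theorem nsq_pos {σ : Spinor} (hσ : σ ≠ 0) : 0 < nsq σ := by
  unfold nsq
  rcases spinor_ne_zero_iff.1 hσ with h | h
  · have := norm_pos_iff.2 h; positivity
  · have := norm_pos_iff.2 h; positivity

theorem nsq_ne_zero_iff {σ : Spinor} : nsq σ ≠ 0 ↔ σ ≠ 0 := by
  refine ⟨fun h h0 => h (by simp [h0, nsq]), fun h => (nsq_pos h).ne'⟩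

theorem coe_nsq (σ : Spinor) : (nsq σ : ℂ) = σ 0 * star (σ 0) + σ 1 * star (σ 1) := by
  simp only [nsq, Complex.star_def, Complex.mul_conj, Complex.normSq_eq_norm_sq]
  push_cast; rfl

theorem nsq_smul (t : ℂ) (σ : Spinor) : nsq (t • σ) = ‖t‖ ^ 2 * nsq σ := by
  simp [nsq, mul_pow, mul_add]

theorem coe_one_add_norm_sq (z : ℂ) : ((1 + ‖z‖ ^ 2 : ℝ) : ℂ) = 1 + z * star z := by
  simp only [Complex.star_def, Complex.mul_conj, Complex.normSq_eq_norm_sq]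
  push_cast; rfl

theorem nsq_chart (σ : Spinor) (z : ℂ) : nsq (chart σ z) = nsq σ * (1 + ‖z‖ ^ 2) := by
  apply Complex.ofReal_injective
  rw [coe_nsq, Complex.ofReal_mul, coe_nsq, coe_one_add_norm_sq]
  simp only [chart_zero_apply, chart_one_apply, star_sub, star_add, star_mul', star_star]
  ring

theorem nsq_affine (z : ℂ) : nsq (affine z) = 1 + ‖z‖ ^ 2 := by simp [nsq]

theorem affine_ne_zero (z : ℂ) : affine z ≠ 0 := by
  rw [spinor_ne_zero_iff]; simp

theorem chart_ne_zero {σ : Spinor} (hσ : σ ≠ 0) (z : ℂ) : chart σ z ≠ 0 := by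
  rw [← nsq_ne_zero_iff, nsq_chart]
  have := nsq_pos hσ
  positivity

theorem bracket_chart (σ : Spinor) (z : ℂ) : bracket σ (chart σ z) = z * nsq σ := by
  rw [coe_nsq]; simp [bracket]; ring

theorem bracket_smul_left (t : ℂ) (σ τ : Spinor) : bracket (t • σ) τ = t * bracket σ τ := by
  simp [bracket]; ring

theorem bracket_smul_right (t : ℂ) (σ τ : Spinor) : bracket σ (t • τ) = t * bracket σ τ := by
  simp [bracket]; ring

theorem bracket_comm (σ τ : Spinor) : bracket σ τ = -bracket τ σ := by
  simp [bracket]; ring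

theorem ne_zero_of_bracket {ξ σ : Spinor} (h : bracket ξ σ ≠ 0) : σ ≠ 0 := by
  rintro rfl; simp [bracket] at h

/-! ### Changes of variables -/

variable {E : Type*} [NormedAddCommGroup E]

theorem abs_det_restrictScalars_toSpanSingleton (c : ℂ) :
    |((ContinuousLinearMap.toSpanSingleton ℂ c).restrictScalars ℝ).det| = ‖c‖ ^ 2 := by
  rw [ContinuousLinearMap.det, ContinuousLinearMap.coe_restrictScalars,
    LinearMap.det_restrictScalars, Algebra.norm_complex_apply, Complex.normSq_eq_norm_sq,
    LinearMap.det_ring]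
  simp

theorem volume_compl_subsingleton {p : ℂ → Prop} (h : {z | ¬ p z}.Subsingleton) :
    ({z | p z} : Set ℂ) =ᵐ[volume] Set.univ := by
  rw [eventuallyEq_univ]
  exact h.measure_zero volume

/-- The Möbius transformation between the affine coordinate centred at `σ` and the standard one. -/
theorem image_mobius {σ : Spinor} (hσ : σ ≠ 0) :
    (fun z => chart σ z 1 / chart σ z 0) '' {z | chart σ z 0 ≠ 0} =
      {u | star (σ 0) + u * star (σ 1) ≠ 0} ∧
    Set.InjOn (fun z => chart σ z 1 / chart σ z 0) {z | chart σ z 0 ≠ 0} := by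
  have hn : (nsq σ : ℂ) ≠ 0 := by exact_mod_cast (nsq_pos hσ).ne'
  -- This is the denominator of the inverse Möbius map evaluated on the image. It shows that the
  -- image avoids the pole of the inverse, and it gives injectivity.
  have h1 : ∀ z, chart σ z 0 ≠ 0 → star (σ 0) + chart σ z 1 / chart σ z 0 * star (σ 1) =
      nsq σ / chart σ z 0 := by
    intro z hz
    rw [coe_nsq, eq_div_iff hz, add_mul, mul_right_comm, div_mul_cancel₀ _ hz]
    simp only [chart_zero_apply, chart_one_apply]
    ring
  refine ⟨?_, ?_⟩
  · ext u
    simp only [Set.mem_image, Set.mem_ofPred_eq]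
    constructor
    · rintro ⟨z, hz, rfl⟩
      rw [h1 z hz]
      exact div_ne_zero hn hz
    · intro hu
      have h0 : chart σ ((u * σ 0 - σ 1) / (star (σ 0) + u * star (σ 1))) 0 =
          nsq σ / (star (σ 0) + u * star (σ 1)) := by
        rw [coe_nsq, eq_div_iff hu, chart_zero_apply, sub_mul, mul_right_comm,
          div_mul_cancel₀ _ hu]
        ring
      have h0' : chart σ ((u * σ 0 - σ 1) / (star (σ 0) + u * star (σ 1))) 0 ≠ 0 := by
        rw [h0]; exact div_ne_zero hn hu
      refine ⟨_, h0', ?_⟩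
      rw [div_eq_iff h0', h0, chart_one_apply, coe_nsq]
      field_simp
      ring
  · intro z hz w hw h
    have h2 : nsq σ / chart σ z 0 = nsq σ / chart σ w 0 := by
      rw [← h1 z hz, ← h1 w hw]
      simp only at h
      rw [h]
    have h3 : chart σ z 0 = chart σ w 0 := by
      have := div_left_inj' hn |>.1 (by simpa using congrArg (·⁻¹) h2)
      simpa using this
    have h4 : chart σ z 1 = chart σ w 1 := by
      simp only at h
      rw [h3] at h
      exact (div_left_inj' hw).1 h
    simp only [chart_zero_apply, chart_one_apply] at h3 h4
    rcases spinor_ne_zero_iff.1 hσ with h | h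
    · exact mul_right_cancel₀ (star_ne_zero.2 h) (by linear_combination h4)
    · exact mul_right_cancel₀ (star_ne_zero.2 h) (by linear_combination -h3)

variable [NormedSpace ℝ E]

/-- Invariance of the integral over the projective line under unitary transformations. -/
theorem integral_affine_eq_integral_chart {G : Spinor → E}
    (hG : ∀ σ : Spinor, σ ≠ 0 → ∀ t : ℂ, t ≠ 0 → G (t • σ) = (‖t‖ ^ 4)⁻¹ • G σ)
    {σ : Spinor} (hσ : σ ≠ 0) :
    (Integrable (fun z => G (affine z)) ↔ Integrable fun z => G (chart σ z)) ∧
    ∫ z, G (affine z) = nsq σ ^ 2 • ∫ z, G (chart σ z) := by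
  obtain ⟨himg, hinj⟩ := image_mobius hσ
  set φ : ℂ → ℂ := fun z => chart σ z 1 / chart σ z 0 with hφ
  have hn : (nsq σ : ℂ) ≠ 0 := by exact_mod_cast (nsq_pos hσ).ne'
  set S : Set ℂ := {z | chart σ z 0 ≠ 0} with hS
  have hSo : MeasurableSet S := by
    have : Continuous fun z => chart σ z 0 := by simp only [chart_zero_apply]; fun_prop
    exact (isOpen_ne_fun this continuous_const).measurableSet
  have hSae : S =ᵐ[volume] Set.univ := by
    refine volume_compl_subsingleton fun z hz w hw => ?_
    simp only [Set.mem_ofPred_eq, not_not, chart_zero_apply] at hz hw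
    rcases eq_or_ne (σ 1) 0 with h1 | h1
    · rw [h1] at hz
      rcases spinor_ne_zero_iff.1 hσ with h | h
      · simp_all
      · exact absurd h1 h
    · exact mul_right_cancel₀ (star_ne_zero.2 h1) (by linear_combination hw - hz)
  have hTae : φ '' S =ᵐ[volume] Set.univ := by
    rw [himg]
    refine volume_compl_subsingleton fun z hz w hw => ?_
    simp only [Set.mem_ofPred_eq, not_not] at hz hw
    rcases eq_or_ne (σ 1) 0 with h1 | h1
    · rw [h1] at hz
      rcases spinor_ne_zero_iff.1 hσ with h | h
      · simp_all
      · exact absurd h1 h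
    · exact mul_right_cancel₀ (star_ne_zero.2 h1) (by linear_combination hz - hw)
  have hderiv : ∀ z ∈ S, HasFDerivWithinAt φ ((ContinuousLinearMap.toSpanSingleton ℂ
      ((nsq σ : ℂ) / chart σ z 0 ^ 2)).restrictScalars ℝ) S z := by
    intro z hz
    have h0 : HasDerivAt (fun z => chart σ z 0) (-star (σ 1)) z := by
      simp only [chart_zero_apply]
      simpa using ((hasDerivAt_id z).mul_const (star (σ 1))).const_sub (σ 0)
    have h1 : HasDerivAt (fun z => chart σ z 1) (star (σ 0)) z := by
      simp only [chart_one_apply]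
      simpa using ((hasDerivAt_id z).mul_const (star (σ 0))).const_add (σ 1)
    have h2 : HasDerivAt φ ((nsq σ : ℂ) / chart σ z 0 ^ 2) z := by
      refine (h1.div h0 hz).congr_deriv ?_
      congr 1
      rw [coe_nsq]
      simp only [chart_zero_apply, chart_one_apply]
      ring
    exact (h2.hasFDerivAt.restrictScalars ℝ).hasFDerivWithinAt
  -- The Jacobian `‖nsq σ / chart₀²‖²` cancels the factor `‖chart₀‖⁻⁴` from the scaling of `G`,
  -- leaving only the constant `nsq σ ^ 2`.
  have hkey : ∀ z ∈ S, |((ContinuousLinearMap.toSpanSingleton ℂ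
      ((nsq σ : ℂ) / chart σ z 0 ^ 2)).restrictScalars ℝ).det| • G (affine (φ z)) =
      nsq σ ^ 2 • G (chart σ z) := by
    intro z hz
    have h1 : chart σ z = chart σ z 0 • affine (φ z) := by
      ext i
      fin_cases i
      · simp [affine]
      · simp only [Fin.mk_one, Pi.smul_apply, affine_one_apply, smul_eq_mul, hφ]
        rw [mul_div_cancel₀ _ hz]
    have h2 := hG (affine (φ z)) (affine_ne_zero _) _ hz
    rw [← h1] at h2
    rw [h2, abs_det_restrictScalars_toSpanSingleton, smul_smul, norm_div, norm_pow, div_pow,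
      Complex.norm_real, Real.norm_of_nonneg (nsq_nonneg _), ← pow_mul, div_eq_mul_inv]
  constructor
  · rw [← integrableOn_univ, ← integrableOn_congr_set_ae hTae,
      integrableOn_image_iff_integrableOn_abs_det_fderiv_smul volume hSo hderiv hinj,
      integrableOn_congr_fun hkey hSo, integrableOn_congr_set_ae hSae, integrableOn_univ]
    exact integrable_smul_iff (pow_ne_zero 2 (nsq_pos hσ).ne') _
  · rw [← setIntegral_univ, ← setIntegral_congr_set hTae,
      integral_image_eq_integral_abs_det_fderiv_smul volume hSo hderiv hinj,
      setIntegral_congr_fun hSo hkey, setIntegral_congr_set hSae, setIntegral_univ,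
      integral_smul]

/-- Rotations preserve the integral over the plane. -/
theorem integral_comp_I_mul (f : ℂ → E) : ∫ z, f (Complex.I * z) = ∫ z, f z := by
  let e : ℂ ≃ₗᵢ[ℝ] ℂ := rotation ⟨Complex.I, by simp [Submonoid.unitSphere]⟩
  have := e.measurePreserving.integral_comp e.toHomeomorph.measurableEmbedding f
  exact this

theorem integrable_radial {f : ℝ → ℝ} (hf : IntegrableOn (fun y => y * f y) (Set.Ioi 0)) :
    Integrable fun z : ℂ => f ‖z‖ := by
  rw [integrable_fun_norm_addHaar]
  simpa [Complex.finrank_real_complex] using hf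

theorem integral_polar {f : ℂ → E} (hf : Integrable f) :
    Integrable (fun p : ℝ × ℝ => p.1 • f (p.1 * (Real.cos p.2 + Real.sin p.2 * Complex.I)))
      ((volume.restrict (Set.Ioi 0)).prod (volume.restrict (Set.Ioo (-Real.pi) Real.pi))) ∧
    ∫ z, f z = ∫ p : ℝ × ℝ, p.1 • f (p.1 * (Real.cos p.2 + Real.sin p.2 * Complex.I))
      ∂((volume.restrict (Set.Ioi 0)).prod (volume.restrict (Set.Ioo (-Real.pi) Real.pi))) := by
  rw [Measure.prod_restrict, ← Measure.volume_eq_prod]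
  constructor
  · have h1 : Integrable (fun p : ℝ × ℝ => f (Complex.measurableEquivRealProd.symm p)) :=
      (Complex.volume_preserving_equiv_real_prod.symm).integrable_comp_emb
        Complex.measurableEquivRealProd.symm.measurableEmbedding |>.2 hf
    have h2 : IntegrableOn (fun p : ℝ × ℝ => f (Complex.measurableEquivRealProd.symm p))
        (polarCoord.symm '' polarCoord.target) := h1.integrableOn
    rw [integrableOn_image_iff_integrableOn_abs_det_fderiv_smul volume
      polarCoord.open_target.measurableSet
      (fun p _ ↦ (hasFDerivAt_polarCoord_symm p).hasFDerivWithinAt) polarCoord.symm.injOn] at h2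
    refine (integrableOn_congr_fun ?_ polarCoord.open_target.measurableSet).1 h2
    intro p hp
    simp only [det_fderivPolarCoordSymm, abs_of_pos (show 0 < p.1 from hp.1)]
    rw [Complex.measurableEquivRealProd_symm_polarCoord_symm_apply,
      Complex.polarCoord_symm_apply]
  · rw [← Complex.integral_comp_polarCoord_symm]
    simp only [Complex.polarCoord_symm_apply]
    rfl

/-! ### Smooth dependence of integrals on parameters -/

theorem continuous_nsq : Continuous nsq := by unfold nsq; fun_prop

theorem isCompact_shell (a b : ℝ) : IsCompact {σ : Spinor | a ≤ nsq σ ∧ nsq σ ≤ b} := by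
  refine Metric.isCompact_of_isClosed_isBounded ?_ ?_
  · exact (isClosed_le continuous_const continuous_nsq).inter
      (isClosed_le continuous_nsq continuous_const)
  · refine (Metric.isBounded_closedBall (x := (0 : Spinor)) (r := Real.sqrt b)).subset ?_
    intro σ hσ
    rw [mem_closedBall_zero_iff, pi_norm_le_iff_of_nonneg (Real.sqrt_nonneg _)]
    intro i
    apply Real.le_sqrt_of_sq_le
    have h := hσ.2
    unfold nsq at h
    fin_cases i
    · simp only [Fin.zero_eta]; nlinarith [sq_nonneg ‖σ 1‖]
    · simp only [Fin.mk_one]; nlinarith [sq_nonneg ‖σ 0‖]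

/-- Maps preserving `nsq` keep a spinor in a compact shell away from the origin, so a function
singular only at `0` is bounded along all of them at once. -/
theorem exists_bound_on_shell {F : Type*} [NormedAddCommGroup F] {G : Spinor → F}
    (hG : ContinuousOn G {0}ᶜ) {a : ℝ} (ha : 0 < a) (b : ℝ) :
    ∃ C, 0 ≤ C ∧ ∀ σ, a ≤ nsq σ → nsq σ ≤ b → ‖G σ‖ ≤ C := by
  have h : ContinuousOn G {σ : Spinor | a ≤ nsq σ ∧ nsq σ ≤ b} :=
    hG.mono fun σ hσ => nsq_ne_zero_iff.1 (ha.trans_le hσ.1).ne'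
  obtain ⟨C, hC⟩ := (isCompact_shell a b).exists_bound_of_continuousOn h
  exact ⟨max C 0, le_max_right _ _, fun σ h1 h2 => (hC σ ⟨h1, h2⟩).trans (le_max_left _ _)⟩

section Parametric

variable {F E : Type} [NormedAddCommGroup F] [NormedSpace ℝ F]
  [NormedAddCommGroup E] [NormedSpace ℝ E]

theorem integrable_clm_comp {T : ℂ → F →L[ℝ] E} {g : ℂ → ℝ} (hT : AEStronglyMeasurable T)
    (hg : Integrable g) (hTg : ∀ z, ‖T z‖ ≤ g z) {N : ℂ → Spinor →L[ℝ] Spinor}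
    (hN : Continuous N) (hNn : ∀ z σ, nsq (N z σ) = nsq σ) {G : Spinor → F}
    (hG : ContinuousOn G {0}ᶜ) {σ : Spinor} (hσ : σ ≠ 0) :
    Integrable fun z => T z (G (N z σ)) := by
  obtain ⟨C, hC0, hC⟩ := exists_bound_on_shell hG (nsq_pos hσ) (nsq σ)
  have hGN : Continuous fun z => G (N z σ) :=
    hG.comp_continuous (by fun_prop) fun z =>
      nsq_ne_zero_iff.1 (by rw [hNn]; exact nsq_ne_zero_iff.2 hσ)
  refine (hg.mul_const C).mono'
    ((ContinuousLinearMap.id ℝ (F →L[ℝ] E)).aestronglyMeasurable_comp₂ hT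
      hGN.aestronglyMeasurable) (ae_of_all _ fun z => ?_)
  refine ((T z).le_opNorm _).trans ?_
  exact mul_le_mul (hTg z) (hC _ (hNn z σ).ge (hNn z σ).le) (norm_nonneg _)
    ((norm_nonneg _).trans (hTg z))

/-- The operator `M ↦ T ∘ M ∘ N`. -/
def sandwich (T : F →L[ℝ] E) (N : Spinor →L[ℝ] Spinor) :
    (Spinor →L[ℝ] F) →L[ℝ] (Spinor →L[ℝ] E) :=
  (ContinuousLinearMap.compL ℝ Spinor F E T).comp
    ((ContinuousLinearMap.compL ℝ Spinor Spinor F).flip N)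

theorem sandwich_apply (T : F →L[ℝ] E) (N : Spinor →L[ℝ] Spinor) (M : Spinor →L[ℝ] F) :
    sandwich T N M = T.comp (M.comp N) := rfl

theorem norm_sandwich_le (T : F →L[ℝ] E) (N : Spinor →L[ℝ] Spinor) :
    ‖sandwich T N‖ ≤ ‖T‖ * ‖N‖ := by
  refine ContinuousLinearMap.opNorm_le_bound _ (by positivity) fun M => ?_
  rw [sandwich_apply]
  refine (ContinuousLinearMap.opNorm_comp_le _ _).trans ?_
  rw [mul_assoc]
  refine mul_le_mul_of_nonneg_left ?_ (norm_nonneg _)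
  rw [mul_comm]
  exact ContinuousLinearMap.opNorm_comp_le _ _

theorem aestronglyMeasurable_sandwich {T : ℂ → F →L[ℝ] E} (hT : AEStronglyMeasurable T)
    {N : ℂ → Spinor →L[ℝ] Spinor} (hN : Continuous N) :
    AEStronglyMeasurable fun z => sandwich (T z) (N z) := by
  have h : Continuous fun p : (F →L[ℝ] E) × (Spinor →L[ℝ] Spinor) => sandwich p.1 p.2 := by
    unfold sandwich
    exact ((ContinuousLinearMap.continuous _).comp continuous_fst).clm_comp
      ((ContinuousLinearMap.continuous _).comp continuous_snd)
  exact h.comp_aestronglyMeasurable (hT.prodMk hN.aestronglyMeasurable)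

theorem aestronglyMeasurable_clm_apply {T : ℂ → F →L[ℝ] E} (hT : AEStronglyMeasurable T)
    {f : ℂ → F} (hf : AEStronglyMeasurable f) : AEStronglyMeasurable fun z => T z (f z) :=
  isBoundedBilinearMap_apply.continuous.comp_aestronglyMeasurable (hT.prodMk hf)

/-- Since `N z` is linear in the spinor, the derivative of the integrand is again an operator,
integrable in norm, applied to a function at `N z σ`. The derivative thus has the same shape as the
integral, with `fderiv ℝ G` in place of `G`. -/
theorem hasFDerivAt_integral_clm_comp {T : ℂ → F →L[ℝ] E} {g : ℂ → ℝ}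
    (hT : AEStronglyMeasurable T) (hg : Integrable g) (hTg : ∀ z, ‖T z‖ ≤ g z)
    {N : ℂ → Spinor →L[ℝ] Spinor} {K : ℝ} (hNK : ∀ z, ‖N z‖ ≤ K)
    (hN : Continuous N) (hNn : ∀ z σ, nsq (N z σ) = nsq σ) {G : Spinor → F}
    (hG : ContDiffOn ℝ 1 G {0}ᶜ) {σ : Spinor} (hσ : σ ≠ 0) :
    HasFDerivAt (fun σ => ∫ z, T z (G (N z σ)))
      (∫ z, sandwich (T z) (N z) (fderiv ℝ G (N z σ))) σ := by
  have hK : 0 ≤ K := (norm_nonneg _).trans (hNK 0)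
  have hg0 : ∀ z, 0 ≤ g z := fun z => (norm_nonneg _).trans (hTg z)
  have hne : ∀ z, ∀ τ : Spinor, τ ≠ 0 → N z τ ≠ 0 := fun z τ hτ =>
    nsq_ne_zero_iff.1 (by rw [hNn]; exact nsq_ne_zero_iff.2 hτ)
  have hDG : ContinuousOn (fderiv ℝ G) {0}ᶜ :=
    hG.continuousOn_fderiv_of_isOpen isOpen_compl_singleton le_rfl
  have hpos := nsq_pos hσ
  obtain ⟨C, hC0, hC⟩ := exists_bound_on_shell hDG (half_pos hpos) (2 * nsq σ)
  -- On this neighbourhood all points `N z τ` stay in the shell where `C` bounds the derivative of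
  -- `G`, so the domination is uniform.
  have hs : {τ : Spinor | nsq σ / 2 < nsq τ ∧ nsq τ < 2 * nsq σ} ∈ 𝓝 σ := by
    refine IsOpen.mem_nhds ((isOpen_lt continuous_const continuous_nsq).inter
      (isOpen_lt continuous_nsq continuous_const)) ⟨?_, ?_⟩
    · exact half_lt_self hpos
    · linarith
  have hsn : ∀ τ ∈ {τ : Spinor | nsq σ / 2 < nsq τ ∧ nsq τ < 2 * nsq σ}, τ ≠ 0 := fun τ hτ =>
    nsq_ne_zero_iff.1 (by have := hτ.1; linarith)
  have hgm := aestronglyMeasurable_sandwich hT hN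
  refine hasFDerivAt_integral_of_dominated_of_fderiv_le
    (F' := fun τ z => sandwich (T z) (N z) (fderiv ℝ G (N z τ)))
    (bound := fun z => g z * K * C) hs ?_
    (integrable_clm_comp hT hg hTg hN hNn hG.continuousOn hσ) ?_ ?_
    ((hg.mul_const K).mul_const C) ?_
  · filter_upwards [hs] with τ hτ
    exact (integrable_clm_comp hT hg hTg hN hNn hG.continuousOn (hsn τ hτ)).1
  · have : Continuous fun z => fderiv ℝ G (N z σ) :=
      hDG.comp_continuous (by fun_prop) fun z => hne z σ hσ
    exact aestronglyMeasurable_clm_apply hgm this.aestronglyMeasurable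
  · refine ae_of_all _ fun z τ hτ => ?_
    refine (ContinuousLinearMap.le_opNorm _ _).trans ?_
    refine mul_le_mul ((norm_sandwich_le _ _).trans
      (mul_le_mul (hTg z) (hNK z) (norm_nonneg _) (hg0 z))) ?_ (norm_nonneg _)
      (mul_nonneg (hg0 z) hK)
    exact hC _ (by rw [hNn]; exact hτ.1.le) (by rw [hNn]; exact hτ.2.le)
  · refine ae_of_all _ fun z τ hτ => ?_
    have h1 : HasFDerivAt G (fderiv ℝ G (N z τ)) (N z τ) :=
      ((hG.contDiffAt (isOpen_compl_singleton.mem_nhds (hne z τ (hsn τ hτ)))).differentiableAt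
        (by simp)).hasFDerivAt
    exact ((T z).hasFDerivAt.comp τ (h1.comp τ (N z).hasFDerivAt))

end Parametric

/-- The spaces and the data `T`, `g`, `G` are quantified inside the induction: each derivative
replaces the spaces by spaces of operators, `T` by `sandwich`, `g` by `g * K` and `G` by its
derivative. -/
theorem contDiffOn_integral_clm_comp_nat {N : ℂ → Spinor →L[ℝ] Spinor} {K : ℝ}
    (hNK : ∀ z, ‖N z‖ ≤ K) (hN : Continuous N) (hNn : ∀ z σ, nsq (N z σ) = nsq σ) (n : ℕ) :
    ∀ (F E : Type) [NormedAddCommGroup F] [NormedSpace ℝ F] [NormedAddCommGroup E]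
      [NormedSpace ℝ E] [CompleteSpace E] (T : ℂ → F →L[ℝ] E) (g : ℂ → ℝ),
      AEStronglyMeasurable T → Integrable g → (∀ z, ‖T z‖ ≤ g z) → ∀ G : Spinor → F,
      ContDiffOn ℝ ∞ G {0}ᶜ → ContDiffOn ℝ n (fun σ => ∫ z, T z (G (N z σ))) {0}ᶜ := by
  induction n with
  | zero =>
    intro F E _ _ _ _ _ T g hT hg hTg G hG
    refine contDiffOn_zero.2 fun σ hσ => ?_
    exact (hasFDerivAt_integral_clm_comp hT hg hTg hNK hN hNn (hG.of_le (by simp))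
      hσ).continuousAt.continuousWithinAt
  | succ n ih =>
    intro F E _ _ _ _ _ T g hT hg hTg G hG
    have hd : ∀ σ ∈ ({0}ᶜ : Set Spinor), HasFDerivAt (fun σ => ∫ z, T z (G (N z σ)))
        (∫ z, sandwich (T z) (N z) (fderiv ℝ G (N z σ))) σ := fun σ hσ =>
      hasFDerivAt_integral_clm_comp hT hg hTg hNK hN hNn (hG.of_le (by simp)) hσ
    have h1 : ContDiffOn ℝ n (fun σ => ∫ z, sandwich (T z) (N z) (fderiv ℝ G (N z σ)))
        {0}ᶜ := by
      refine ih _ _ (fun z => sandwich (T z) (N z)) (fun z => g z * K)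
        (aestronglyMeasurable_sandwich hT hN) (hg.mul_const K) (fun z => ?_) (fderiv ℝ G)
        (hG.fderiv_of_isOpen isOpen_compl_singleton (by simp))
      exact (norm_sandwich_le _ _).trans (mul_le_mul (hTg z) (hNK z) (norm_nonneg _)
        ((norm_nonneg _).trans (hTg z)))
    push_cast
    rw [contDiffOn_succ_iff_fderiv_of_isOpen isOpen_compl_singleton]
    refine ⟨fun σ hσ => (hd σ hσ).differentiableAt.differentiableWithinAt, by simp, ?_⟩
    exact h1.congr fun σ hσ => (hd σ hσ).fderiv

theorem contDiffOn_integral_clm_comp {N : ℂ → Spinor →L[ℝ] Spinor} {K : ℝ}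
    (hNK : ∀ z, ‖N z‖ ≤ K) (hN : Continuous N) (hNn : ∀ z σ, nsq (N z σ) = nsq σ)
    {F E : Type} [NormedAddCommGroup F] [NormedSpace ℝ F] [NormedAddCommGroup E]
    [NormedSpace ℝ E] [CompleteSpace E] {T : ℂ → F →L[ℝ] E} {g : ℂ → ℝ}
    (hT : AEStronglyMeasurable T) (hg : Integrable g) (hTg : ∀ z, ‖T z‖ ≤ g z) {G : Spinor → F}
    (hG : ContDiffOn ℝ ∞ G {0}ᶜ) : ContDiffOn ℝ ∞ (fun σ => ∫ z, T z (G (N z σ))) {0}ᶜ :=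
  contDiffOn_infty.2 fun n =>
    contDiffOn_integral_clm_comp_nat hNK hN hNn n F E T g hT hg hTg G hG

/-! ### Integrals of radial and angular derivatives over the plane -/

section Polar

variable {E : Type*} [NormedAddCommGroup E] [NormedSpace ℝ E] [CompleteSpace E]

theorem norm_polar (r θ : ℝ) :
    ‖(r : ℂ) * (Real.cos θ + Real.sin θ * Complex.I)‖ = |r| := by
  rw [norm_mul, Complex.norm_real, Complex.ofReal_cos, Complex.ofReal_sin,
    Complex.norm_cos_add_sin_mul_I, mul_one, Real.norm_eq_abs]

/-- In polar coordinates the weight `r⁻²`, the area factor `r` and the length of the vector `z`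
leave exactly `∂β/∂r`. Each ray contributes `-β 0`, and the rays have total angle `2π`. -/
theorem integral_radial_derivative {β : ℂ → E} (hβ : ContDiff ℝ 1 β)
    (h0 : Tendsto β (cocompact ℂ) (𝓝 0))
    (hi : Integrable fun z => (‖z‖ ^ 2)⁻¹ • fderiv ℝ β z z) :
    ∫ z, (‖z‖ ^ 2)⁻¹ • fderiv ℝ β z z = -(2 * Real.pi) • β 0 := by
  obtain ⟨h1, h2⟩ := integral_polar hi
  rw [h2, integral_prod_symm _ h1]
  have h3 : ∀ᵐ θ ∂(volume.restrict (Set.Ioo (-Real.pi) Real.pi)),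
      (∫ r in Set.Ioi (0 : ℝ), r • (‖(r : ℂ) * (Real.cos θ + Real.sin θ * Complex.I)‖ ^ 2)⁻¹ •
        fderiv ℝ β ((r : ℂ) * (Real.cos θ + Real.sin θ * Complex.I))
          ((r : ℂ) * (Real.cos θ + Real.sin θ * Complex.I))) = -β 0 := by
    filter_upwards [h1.prod_left_ae] with θ hθ
    set u : ℂ := Real.cos θ + Real.sin θ * Complex.I with hu
    have hun : ‖u‖ = 1 := by
      have := norm_polar 1 θ
      simpa only [Complex.ofReal_one, one_mul, abs_one] using this
    have hd : ∀ r : ℝ, HasDerivAt (fun r : ℝ => β (r * u)) (fderiv ℝ β (r * u) u) r := by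
      intro r
      have h4 : HasDerivAt (fun r : ℝ => (r : ℂ) * u) u r := by
        simpa using (Complex.ofRealCLM.hasDerivAt (x := r)).mul_const u
      exact (hβ.differentiable (by simp) _).hasFDerivAt.comp_hasDerivAt r h4
    have he : ∀ r ∈ Set.Ioi (0 : ℝ), r • (‖(r : ℂ) * u‖ ^ 2)⁻¹ • fderiv ℝ β (r * u) (r * u) =
        fderiv ℝ β (r * u) u := by
      intro r hr
      have hr' : r ≠ 0 := (Set.mem_Ioi.1 hr).ne'
      have : (r : ℂ) * u = r • u := by simp
      rw [norm_mul, hun, Complex.norm_real, mul_one, Real.norm_eq_abs, sq_abs]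
      conv_lhs => rw [this, map_smul, smul_smul, smul_smul]
      rw [show r * (r ^ 2)⁻¹ * r = 1 by field_simp, one_smul, this]
    rw [setIntegral_congr_fun measurableSet_Ioi he]
    have hint : IntegrableOn (fun r : ℝ => fderiv ℝ β (r * u) u) (Set.Ioi 0) :=
      (integrableOn_congr_fun he measurableSet_Ioi).1 hθ
    have hlim : Tendsto (fun r : ℝ => β (r * u)) atTop (𝓝 0) := by
      refine h0.comp ?_
      rw [← Metric.cobounded_eq_cocompact, ← tendsto_norm_atTop_iff_cobounded]
      have : (fun r : ℝ => ‖(r : ℂ) * u‖) = fun r => |r| := by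
        ext r; rw [norm_mul, hun, mul_one, Complex.norm_real, Real.norm_eq_abs]
      rw [this]
      exact tendsto_abs_atTop_atTop
    have := integral_Ioi_of_hasDerivAt_of_tendsto (hd 0).continuousAt.continuousWithinAt
      (fun r _ => hd r) hint hlim
    simpa using this
  rw [integral_congr_ae h3, setIntegral_const]
  simp only [Real.volume_real_Ioo_of_le (show -Real.pi ≤ Real.pi by linarith [Real.pi_pos])]
  rw [smul_neg, ← neg_smul]
  congr 1; ring

end Polar

section Angular

variable {E : Type*} [NormedAddCommGroup E] [NormedSpace ℂ E] [CompleteSpace E]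

/-- The direction `i z` is `∂/∂θ`, so on every circle the integral of a derivative of a periodic
function appears; the radial weight plays no role. -/
theorem integral_angular_derivative {β : ℂ → E} (hβ : ContDiff ℝ 1 β) (w : ℝ → ℂ)
    (hi : Integrable fun z => w ‖z‖ • fderiv ℝ β z (Complex.I * z)) :
    ∫ z, w ‖z‖ • fderiv ℝ β z (Complex.I * z) = 0 := by
  obtain ⟨h1, h2⟩ := integral_polar hi
  rw [h2, integral_prod _ h1]
  refine integral_eq_zero_of_ae (ae_of_all _ fun r => ?_)
  have hd : ∀ θ : ℝ, HasDerivAt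
      (fun θ : ℝ => β (r * (Real.cos θ + Real.sin θ * Complex.I)))
      (fderiv ℝ β (r * (Real.cos θ + Real.sin θ * Complex.I))
        (Complex.I * (r * (Real.cos θ + Real.sin θ * Complex.I)))) θ := by
    intro θ
    have h4 : HasDerivAt (fun θ : ℝ => (r : ℂ) * (Real.cos θ + Real.sin θ * Complex.I))
        (Complex.I * (r * (Real.cos θ + Real.sin θ * Complex.I))) θ := by
      have hc := (Real.hasDerivAt_cos θ).ofReal_comp
      have hs := (Real.hasDerivAt_sin θ).ofReal_comp
      refine ((hc.add (hs.mul_const Complex.I)).const_mul (r : ℂ)).congr_deriv ?_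
      push_cast
      linear_combination (-(r : ℂ) * Complex.sin θ) * Complex.I_mul_I
    exact (hβ.differentiable (by simp) _).hasFDerivAt.comp_hasDerivAt θ h4
  have hcont : Continuous fun θ : ℝ => fderiv ℝ β (r * (Real.cos θ + Real.sin θ * Complex.I))
        (Complex.I * (r * (Real.cos θ + Real.sin θ * Complex.I))) := by
    have h5 := hβ.continuous_fderiv (by simp)
    exact (h5.comp (by fun_prop)).clm_apply (by fun_prop)
  have h6 := intervalIntegral.integral_eq_sub_of_hasDerivAt (a := -Real.pi) (b := Real.pi)
    (fun θ _ => hd θ) (hcont.intervalIntegrable _ _)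
  rw [intervalIntegral.integral_of_le (by linarith [Real.pi_pos]),
    integral_Ioc_eq_integral_Ioo] at h6
  simp only [norm_polar, Pi.zero_apply]
  rw [integral_smul, integral_smul, h6]
  simp

end Angular

/-! ### Sections over the line -/

/-- Smooth functions on `ℂ² ∖ {0}` of bidegree `(p, q)`. -/
structure IsSection (p q : ℤ) (b : Spinor → Twistor) : Prop where
  smooth : ContDiffOn ℝ ∞ b {0}ᶜ
  homogeneous : IsHomogeneousOn p q b {0}ᶜ

theorem IsSection.differentiableAt {p q : ℤ} {b : Spinor → Twistor} (hb : IsSection p q b)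
    {σ : Spinor} (hσ : σ ≠ 0) : DifferentiableAt ℝ b σ :=
  hb.smooth.differentiableAt_of_isOpen isOpen_compl_singleton hσ

/-- The quaternionic conjugation as a real linear map. -/
def quatL : Spinor →L[ℝ] Spinor :=
  LinearMap.toContinuousLinearMap
    { toFun := quat
      map_add' := fun σ τ => by ext i; fin_cases i <;> simp [add_comm]
      map_smul' := fun r σ => by ext i; fin_cases i <;> simp }

theorem quatL_apply (σ : Spinor) : quatL σ = quat σ := rfl

theorem quat_quat (σ : Spinor) : quat (quat σ) = -σ := by ext i; fin_cases i <;> simp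

theorem quat_smul (t : ℂ) (σ : Spinor) : quat (t • σ) = star t • quat σ := by
  ext i; fin_cases i <;> simp

/-- `σ ↦ chart σ z` as a real linear map. -/
def chartL (z : ℂ) : Spinor →L[ℝ] Spinor := ContinuousLinearMap.id ℝ Spinor + z • quatL

theorem chartL_apply (z : ℂ) (σ : Spinor) : chartL z σ = chart σ z := rfl

/-- `√(1 + |z|²)`. -/
def scale (z : ℂ) : ℝ := Real.sqrt (1 + ‖z‖ ^ 2)

theorem scale_pos (z : ℂ) : 0 < scale z := Real.sqrt_pos.2 (by positivity)

theorem scale_sq (z : ℂ) : scale z ^ 2 = 1 + ‖z‖ ^ 2 := Real.sq_sqrt (by positivity)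

theorem one_le_scale (z : ℂ) : 1 ≤ scale z := by
  rw [scale, Real.one_le_sqrt]; nlinarith [sq_nonneg ‖z‖]

theorem continuous_scale : Continuous scale := by unfold scale; fun_prop

/-- The unitary transformation of the spinor space in the direction of `z`, a multiple of
`chartL z`. -/
def unitChartL (z : ℂ) : Spinor →L[ℝ] Spinor := (scale z)⁻¹ • chartL z

theorem unitChartL_apply (z : ℂ) (σ : Spinor) :
    unitChartL z σ = ((scale z : ℂ)⁻¹) • chart σ z := by
  change (scale z)⁻¹ • chart σ z = _
  rw [← Complex.ofReal_inv, Complex.coe_smul]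

theorem nsq_unitChartL (z : ℂ) (σ : Spinor) : nsq (unitChartL z σ) = nsq σ := by
  rw [unitChartL_apply, nsq_smul, nsq_chart, ← scale_sq, norm_inv, Complex.norm_real,
    Real.norm_of_nonneg (scale_pos z).le]
  have := (scale_pos z).ne'
  field_simp

theorem continuous_unitChartL : Continuous unitChartL := by
  unfold unitChartL chartL
  exact (continuous_scale.inv₀ fun z => (scale_pos z).ne').smul (by fun_prop)

theorem norm_sq_le_nsq (σ : Spinor) : ‖σ‖ ^ 2 ≤ nsq σ := by
  have h : ‖σ‖ ≤ Real.sqrt (nsq σ) := by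
    rw [pi_norm_le_iff_of_nonneg (Real.sqrt_nonneg _)]
    intro i
    apply Real.le_sqrt_of_sq_le
    unfold nsq
    fin_cases i
    · simp only [Fin.zero_eta]; nlinarith [sq_nonneg ‖σ 1‖]
    · simp only [Fin.mk_one]; nlinarith [sq_nonneg ‖σ 0‖]
  calc ‖σ‖ ^ 2 ≤ Real.sqrt (nsq σ) ^ 2 := by gcongr
    _ = nsq σ := Real.sq_sqrt (nsq_nonneg _)

theorem nsq_le_norm_sq (σ : Spinor) : nsq σ ≤ 2 * ‖σ‖ ^ 2 := by
  have h0 := norm_le_pi_norm σ 0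
  have h1 := norm_le_pi_norm σ 1
  unfold nsq
  nlinarith [norm_nonneg (σ 0), norm_nonneg (σ 1)]

theorem norm_unitChartL_le (z : ℂ) : ‖unitChartL z‖ ≤ 2 := by
  refine ContinuousLinearMap.opNorm_le_bound _ (by norm_num) fun σ => ?_
  refine abs_le_of_sq_le_sq' ?_ (by positivity) |>.2
  have h1 := norm_sq_le_nsq (unitChartL z σ)
  have h2 := nsq_le_norm_sq σ
  rw [nsq_unitChartL] at h1
  nlinarith [sq_nonneg ‖σ‖]

theorem chart_eq_scale_smul (z : ℂ) (σ : Spinor) :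
    chart σ z = (scale z : ℂ) • unitChartL z σ := by
  rw [unitChartL_apply, smul_inv_smul₀]
  exact_mod_cast (scale_pos z).ne'

theorem unitChartL_ne_zero (z : ℂ) {σ : Spinor} (hσ : σ ≠ 0) : unitChartL z σ ≠ 0 :=
  nsq_ne_zero_iff.1 (by rw [nsq_unitChartL]; exact nsq_ne_zero_iff.2 hσ)

theorem fderiv_smul_point {p q : ℤ} {b : Spinor → Twistor} (hb : IsSection p q b) {σ : Spinor}
    (hσ : σ ≠ 0) {t : ℂ} (ht : t ≠ 0) (v : Spinor) :
    fderiv ℝ b (t • σ) (t • v) = (t ^ p * star t ^ q) • fderiv ℝ b σ v := by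
  have h1 : HasFDerivAt (fun τ : Spinor => t • τ) (t • ContinuousLinearMap.id ℝ Spinor) σ :=
    (ContinuousLinearMap.id ℝ Spinor).hasFDerivAt.const_smul t
  have h2 : HasFDerivAt (fun τ => b (t • τ)) _ σ :=
    (hb.differentiableAt (smul_ne_zero ht hσ)).hasFDerivAt.comp σ h1
  have h3 : (fun τ => b (t • τ)) =ᶠ[𝓝 σ] fun τ => (t ^ p * star t ^ q) • b τ := by
    filter_upwards [isOpen_compl_singleton.mem_nhds hσ] with τ hτ using hb.homogeneous τ hτ t ht
  have h4 := ((hb.differentiableAt hσ).hasFDerivAt.const_smul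
    (t ^ p * star t ^ q)).congr_of_eventuallyEq h3
  have h5 := congrArg (fun L => L v) (h2.unique h4)
  simpa using h5

section FormSections

variable {b : Spinor → Twistor} (hb : IsSection 1 (-2) b)

include hb

/-- Bidegree `(1,-2)` gives the power `1 - 2` of the real number `scale z`. The unbounded chart is
thereby traded for a unitary map and a decaying factor. -/
theorem section_chart_eq {σ : Spinor} (hσ : σ ≠ 0) (z : ℂ) :
    b (chart σ z) = ((scale z : ℂ)⁻¹) • b (unitChartL z σ) := by
  have h0 : (scale z : ℂ) ≠ 0 := by exact_mod_cast (scale_pos z).ne'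
  rw [chart_eq_scale_smul, hb.homogeneous _ (unitChartL_ne_zero z hσ) _ h0]
  congr 1
  simp only [Complex.star_def, Complex.conj_ofReal, zpow_one, zpow_neg]
  field_simp

/-- One factor `(scale z)⁻¹` comes from the bidegree, as for the section itself, and a second
because the direction is not rescaled with the point. -/
theorem fderiv_section_chart_eq {σ : Spinor} (hσ : σ ≠ 0) (z : ℂ) (v : Spinor) :
    fderiv ℝ b (chart σ z) v =
      (((1 + ‖z‖ ^ 2 : ℝ) : ℂ)⁻¹) • fderiv ℝ b (unitChartL z σ) v := by
  have h0 : (scale z : ℂ) ≠ 0 := by exact_mod_cast (scale_pos z).ne'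
  have h1 := fderiv_smul_point hb (unitChartL_ne_zero z hσ) h0 ((scale z : ℂ)⁻¹ • v)
  rw [smul_inv_smul₀ h0, ← chart_eq_scale_smul] at h1
  rw [h1, ← scale_sq, ← Complex.ofReal_inv, Complex.coe_smul, map_smul, ← Complex.coe_smul,
    smul_smul]
  congr 1
  simp only [Complex.star_def, Complex.conj_ofReal, zpow_one, zpow_neg]
  push_cast
  field_simp

theorem exists_bound_chart {σ : Spinor} (hσ : σ ≠ 0) : ∃ C, 0 ≤ C ∧
    (∀ z, ‖b (chart σ z)‖ ≤ C) ∧ ∀ z v, ‖fderiv ℝ b (chart σ z) v‖ ≤ C * ‖v‖ := by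
  obtain ⟨C, hC0, hC⟩ := exists_bound_on_shell hb.smooth.continuousOn (nsq_pos hσ) (nsq σ)
  obtain ⟨C', hC0', hC'⟩ := exists_bound_on_shell
    (hb.smooth.continuousOn_fderiv_of_isOpen isOpen_compl_singleton (by simp)) (nsq_pos hσ)
    (nsq σ)
  refine ⟨max C C', le_max_of_le_left hC0, fun z => ?_, fun z v => ?_⟩
  · rw [section_chart_eq hb hσ, norm_smul, norm_inv, Complex.norm_real,
      Real.norm_of_nonneg (scale_pos z).le]
    refine (mul_le_of_le_one_left (norm_nonneg _) (inv_le_one_of_one_le₀ (one_le_scale z))).trans ?_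
    exact (hC _ (nsq_unitChartL z σ).ge (nsq_unitChartL z σ).le).trans (le_max_left _ _)
  · rw [fderiv_section_chart_eq hb hσ, norm_smul, norm_inv, Complex.norm_real,
      Real.norm_of_nonneg (by positivity)]
    refine (mul_le_of_le_one_left (norm_nonneg _) (inv_le_one_of_one_le₀
      (by nlinarith [sq_nonneg ‖z‖]))).trans ?_
    refine (ContinuousLinearMap.le_opNorm _ _).trans ?_
    gcongr
    exact (hC' _ (nsq_unitChartL z σ).ge (nsq_unitChartL z σ).le).trans (le_max_right _ _)

end FormSections

/-! ### The Cauchy transform on the line -/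

/-- The radial function `r⁻¹ (1 + r²)⁻¹`, which is integrable over the plane. -/
def radialBound (r : ℝ) : ℝ := r⁻¹ * (1 + r ^ 2)⁻¹

theorem radialBound_nonneg {r : ℝ} (hr : 0 ≤ r) : 0 ≤ radialBound r := by
  unfold radialBound; positivity

theorem integrable_radialBound : Integrable fun z : ℂ => radialBound ‖z‖ := by
  refine integrable_radial ?_
  refine (integrableOn_congr_fun ?_ measurableSet_Ioi).1
    (integrable_inv_one_add_sq.integrableOn (s := Set.Ioi 0))
  intro y hy
  have : y ≠ 0 := (Set.mem_Ioi.1 hy).ne'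
  simp only [radialBound]
  field_simp

/-- The kernel `1 / (z (1 + |z|²)²)`. -/
def cauchyKernel (z : ℂ) : ℂ := (z * (1 + z * star z) ^ 2)⁻¹

theorem norm_one_add_mul_star (z : ℂ) : ‖1 + z * star z‖ = 1 + ‖z‖ ^ 2 := by
  rw [← coe_one_add_norm_sq, Complex.norm_real, Real.norm_of_nonneg (by positivity)]

theorem one_add_mul_star_ne_zero (z : ℂ) : 1 + z * star z ≠ 0 := by
  rw [← norm_pos_iff, norm_one_add_mul_star]; positivity

theorem norm_cauchyKernel (z : ℂ) : ‖cauchyKernel z‖ = ‖z‖⁻¹ * ((1 + ‖z‖ ^ 2) ^ 2)⁻¹ := by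
  rw [cauchyKernel, norm_inv, norm_mul, norm_pow, norm_one_add_mul_star, mul_inv]

theorem norm_cauchyKernel_le (z : ℂ) : ‖cauchyKernel z‖ ≤ radialBound ‖z‖ := by
  rw [norm_cauchyKernel, radialBound]
  gcongr
  nlinarith [sq_nonneg ‖z‖, sq_nonneg (‖z‖ ^ 2)]

theorem measurable_cauchyKernel : Measurable cauchyKernel := by
  unfold cauchyKernel
  have : Continuous fun z : ℂ => z * (1 + z * star z) ^ 2 := by fun_prop
  exact this.measurable.inv

/-- The Cauchy transform with the unitarily invariant kernel, up to a factor. -/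
def cauchyPart (b : Spinor → Twistor) (σ : Spinor) : Twistor :=
  ∫ z, cauchyKernel z • b (chart σ z)

/-- The kernel of the Cauchy transform in terms of unitary transformations. -/
def cauchyOperator (z : ℂ) : Twistor →L[ℝ] Twistor :=
  (cauchyKernel z * (scale z : ℂ)⁻¹) • ContinuousLinearMap.id ℝ Twistor

theorem norm_cauchyOperator_le (z : ℂ) : ‖cauchyOperator z‖ ≤ radialBound ‖z‖ := by
  rw [cauchyOperator, norm_smul, norm_mul, norm_inv, Complex.norm_real,
    Real.norm_of_nonneg (scale_pos z).le]
  have h1 : ‖ContinuousLinearMap.id ℝ Twistor‖ ≤ 1 := ContinuousLinearMap.norm_id_le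
  calc _ ≤ ‖cauchyKernel z‖ * 1 * 1 := by
        gcongr
        exact inv_le_one_of_one_le₀ (one_le_scale z)
    _ ≤ _ := by simpa using norm_cauchyKernel_le z

theorem aestronglyMeasurable_cauchyOperator : AEStronglyMeasurable cauchyOperator := by
  unfold cauchyOperator
  refine AEStronglyMeasurable.smul_const ?_ _
  refine (measurable_cauchyKernel.mul ?_).aestronglyMeasurable
  have : Continuous fun z => (scale z : ℂ) := Complex.continuous_ofReal.comp continuous_scale
  exact this.measurable.inv

theorem contDiff_chart (σ : Spinor) : ContDiff ℝ ∞ (chart σ) := by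
  unfold chart; fun_prop

theorem hasFDerivAt_chart (σ : Spinor) (z : ℂ) :
    HasFDerivAt (chart σ) (ContinuousLinearMap.toSpanSingleton ℂ (quat σ)) z := by
  have := ((hasDerivAt_id z).smul_const (quat σ)).const_add σ
  rw [one_smul] at this
  exact this.hasFDerivAt

section FormSections

variable {b : Spinor → Twistor} (hb : IsSection 1 (-2) b)

include hb

theorem cauchyPart_eq {σ : Spinor} (hσ : σ ≠ 0) :
    cauchyPart b σ = ∫ z, cauchyOperator z (b (unitChartL z σ)) := by
  refine integral_congr_ae (ae_of_all _ fun z => ?_)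
  simp only [section_chart_eq hb hσ, smul_smul]
  rfl

theorem integrable_cauchyPart {σ : Spinor} (hσ : σ ≠ 0) :
    Integrable fun z => cauchyKernel z • b (chart σ z) := by
  have := integrable_clm_comp aestronglyMeasurable_cauchyOperator integrable_radialBound
    norm_cauchyOperator_le continuous_unitChartL nsq_unitChartL hb.smooth.continuousOn hσ
  refine this.congr (ae_of_all _ fun z => ?_)
  simp only [section_chart_eq hb hσ, smul_smul]
  rfl

theorem contDiffOn_cauchyPart : ContDiffOn ℝ ∞ (cauchyPart b) {0}ᶜ :=
  (contDiffOn_integral_clm_comp norm_unitChartL_le continuous_unitChartL nsq_unitChartL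
    aestronglyMeasurable_cauchyOperator integrable_radialBound norm_cauchyOperator_le
    hb.smooth).congr fun _ hσ => cauchyPart_eq hb hσ

/-- The chart is real linear in its centre, so moving the centre along `u` moves the argument of `b`
along `chart u z`; the kernel does not depend on `σ`. -/
theorem fderiv_cauchyPart {σ : Spinor} (hσ : σ ≠ 0) (u : Spinor) :
    Integrable (fun z => cauchyKernel z • fderiv ℝ b (chart σ z) (chart u z)) ∧
    fderiv ℝ (cauchyPart b) σ u =
      ∫ z, cauchyKernel z • fderiv ℝ b (chart σ z) (chart u z) := by
  have hd := hasFDerivAt_integral_clm_comp aestronglyMeasurable_cauchyOperator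
    integrable_radialBound norm_cauchyOperator_le norm_unitChartL_le continuous_unitChartL
    nsq_unitChartL (hb.smooth.of_le (by simp)) hσ
  have he : cauchyPart b =ᶠ[𝓝 σ] fun σ => ∫ z, cauchyOperator z (b (unitChartL z σ)) := by
    filter_upwards [isOpen_compl_singleton.mem_nhds hσ] with τ hτ using cauchyPart_eq hb hτ
  have hi : Integrable fun z =>
      sandwich (cauchyOperator z) (unitChartL z) (fderiv ℝ b (unitChartL z σ)) := by
    refine integrable_clm_comp (aestronglyMeasurable_sandwich aestronglyMeasurable_cauchyOperator
      continuous_unitChartL) (integrable_radialBound.mul_const 2) (fun z => ?_)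
      continuous_unitChartL nsq_unitChartL
      (hb.smooth.continuousOn_fderiv_of_isOpen isOpen_compl_singleton (by simp)) hσ
    exact (norm_sandwich_le _ _).trans (mul_le_mul (norm_cauchyOperator_le z)
      (norm_unitChartL_le z) (norm_nonneg _) (radialBound_nonneg (norm_nonneg _)))
  have hp : ∀ z, sandwich (cauchyOperator z) (unitChartL z) (fderiv ℝ b (unitChartL z σ)) u =
      cauchyKernel z • fderiv ℝ b (chart σ z) (chart u z) := by
    intro z
    have h0 : (scale z : ℂ) ≠ 0 := by exact_mod_cast (scale_pos z).ne'
    rw [fderiv_section_chart_eq hb hσ, chart_eq_scale_smul z u, Complex.coe_smul, map_smul,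
      ← Complex.coe_smul, smul_smul, smul_smul, ← scale_sq]
    change (cauchyKernel z * (scale z : ℂ)⁻¹) •
      fderiv ℝ b (unitChartL z σ) (unitChartL z u) = _
    congr 1
    push_cast
    field_simp
  refine ⟨(hi.apply_continuousLinearMap u).congr (ae_of_all _ hp), ?_⟩
  rw [he.fderiv_eq, hd.fderiv, ContinuousLinearMap.integral_apply hi]
  exact integral_congr_ae (ae_of_all _ hp)

/-- The antiholomorphic derivative of the Cauchy transform. -/
theorem delBar_cauchyPart {σ : Spinor} (hσ : σ ≠ 0) :
    delBar (cauchyPart b) σ (quat σ) = -(Real.pi : ℂ) • b σ := by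
  obtain ⟨C, hC0, hC, hC'⟩ := exists_bound_chart hb hσ
  set B : ℂ → Twistor := fun z => b (chart σ z) with hB
  have hBs : ContDiff ℝ ∞ B := by
    rw [← contDiffOn_univ]
    exact hb.smooth.comp (contDiff_chart σ).contDiffOn fun z _ => chart_ne_zero hσ z
  have hBd (z v : ℂ) : fderiv ℝ B z v = fderiv ℝ b (chart σ z) (v • quat σ) := by
    have := ((hb.differentiableAt (chart_ne_zero hσ z)).hasFDerivAt.comp z
      ((hasFDerivAt_chart σ z).restrictScalars ℝ)).fderiv
    exact congrArg (fun L => L v) this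
  have hBb (z v : ℂ) : ‖fderiv ℝ B z v‖ ≤ C * ‖quat σ‖ * ‖v‖ := by
    rw [hBd]
    refine (hC' _ _).trans ?_
    rw [norm_smul, mul_assoc, mul_comm ‖v‖]
  have hBc : Continuous (fderiv ℝ B) := hBs.continuous_fderiv (by simp)
  -- the radial part
  set β : ℂ → Twistor := fun z => ((1 + ‖z‖ ^ 2)⁻¹ : ℝ) • B z with hβ
  have hns : ContDiff ℝ ∞ fun z : ℂ => (1 + ‖z‖ ^ 2)⁻¹ :=
    (contDiff_const.add (contDiff_norm_sq ℝ)).inv fun z => by positivity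
  have hβs : ContDiff ℝ ∞ β := hns.smul hBs
  have hβd (z : ℂ) : fderiv ℝ β z z = ((1 + ‖z‖ ^ 2)⁻¹ : ℝ) • fderiv ℝ B z z -
      (2 * ‖z‖ ^ 2 * ((1 + ‖z‖ ^ 2) ^ 2)⁻¹) • B z := by
    have h1 : HasFDerivAt (fun z : ℂ => 1 + ‖z‖ ^ 2) (2 • (innerSL ℝ) z) z :=
      (hasStrictFDerivAt_norm_sq z).hasFDerivAt.const_add 1
    have h2 := (hasDerivAt_inv (show (1 + ‖z‖ ^ 2) ≠ 0 by positivity)).comp_hasFDerivAt z h1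
    have h3 := (h2.smul (hBs.differentiable (by simp) z).hasFDerivAt).fderiv
    have h4 : fderiv ℝ β z = _ := h3
    rw [h4]
    simp only [Function.comp_apply, add_apply, smul_apply,
      ContinuousLinearMap.smulRight_apply, innerSL_apply_apply, real_inner_self_eq_norm_sq]
    rw [sub_eq_add_neg, ← neg_smul]
    congr 2
    simp only [smul_eq_mul, nsmul_eq_mul]
    push_cast
    ring
  have hβ0 : Tendsto β (cocompact ℂ) (𝓝 0) := by
    have h1 : Tendsto (fun z : ℂ => (1 + ‖z‖ ^ 2)⁻¹ * C) (cocompact ℂ) (𝓝 0) := by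
      rw [show (0 : ℝ) = 0 * C by ring]
      refine Tendsto.mul_const C (tendsto_inv_atTop_zero.comp ?_)
      refine tendsto_atTop_add_const_left _ _ ?_
      exact (tendsto_pow_atTop (by norm_num)).comp tendsto_norm_cocompact_atTop
    refine squeeze_zero_norm (fun z => ?_) h1
    rw [hβ, norm_smul, Real.norm_of_nonneg (by positivity)]
    gcongr
    exact hC z
  have hfr : Integrable fun z => (‖z‖ ^ 2)⁻¹ • fderiv ℝ β z z := by
    refine (integrable_radialBound.mul_const (C * ‖quat σ‖ + 2 * C)).mono' ?_
      (ae_of_all _ fun z => ?_)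
    · refine (Measurable.aestronglyMeasurable (f := fun z : ℂ => (‖z‖ ^ 2)⁻¹) (by fun_prop)).smul ?_
      exact ((hβs.continuous_fderiv (by simp)).clm_apply continuous_id).aestronglyMeasurable
    · rcases eq_or_ne z 0 with rfl | hz
      · simp [radialBound]
      have hz' : 0 < ‖z‖ := norm_pos_iff.2 hz
      rw [hβd, norm_smul, norm_inv, norm_pow, norm_norm]
      calc _ ≤ (‖z‖ ^ 2)⁻¹ * ((1 + ‖z‖ ^ 2)⁻¹ * (C * ‖quat σ‖ * ‖z‖) +
            (2 * ‖z‖ ^ 2 * ((1 + ‖z‖ ^ 2) ^ 2)⁻¹) * C) := by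
            gcongr
            refine (norm_sub_le _ _).trans ?_
            rw [norm_smul, norm_smul, Real.norm_of_nonneg (by positivity),
              Real.norm_of_nonneg (by positivity)]
            gcongr
            · exact hBb z z
            · exact hC z
        _ = radialBound ‖z‖ * (C * ‖quat σ‖ + 2 * C * (‖z‖ / (1 + ‖z‖ ^ 2))) := by
            unfold radialBound; field_simp
        _ ≤ _ := by
            refine mul_le_mul_of_nonneg_left ?_ (radialBound_nonneg hz'.le)
            have : ‖z‖ / (1 + ‖z‖ ^ 2) ≤ 1 := by
              rw [div_le_one (by positivity)]; nlinarith [sq_nonneg (‖z‖ - 1)]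
            nlinarith
  -- the angular part
  set w : ℝ → ℂ := fun r =>
    ((1 / 2 * ((r ^ 2)⁻¹ - 1) * ((1 + r ^ 2) ^ 2)⁻¹ : ℝ) : ℂ) * Complex.I with hw
  have hfa : Integrable fun z => w ‖z‖ • fderiv ℝ B z (Complex.I * z) := by
    refine (integrable_radialBound.mul_const (C * ‖quat σ‖)).mono' ?_ (ae_of_all _ fun z => ?_)
    · have hwm : AEStronglyMeasurable fun z : ℂ => w ‖z‖ :=
        Measurable.aestronglyMeasurable (by fun_prop)
      exact hwm.smul (hBc.clm_apply (continuous_const.mul continuous_id)).aestronglyMeasurable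
    · rcases eq_or_ne z 0 with rfl | hz
      · simp [radialBound]
      have hz' : 0 < ‖z‖ := norm_pos_iff.2 hz
      rw [norm_smul, hw, norm_mul, Complex.norm_I, mul_one, Complex.norm_real, Real.norm_eq_abs,
        abs_mul, abs_mul, abs_of_nonneg (show (0 : ℝ) ≤ ((1 + ‖z‖ ^ 2) ^ 2)⁻¹ by positivity)]
      have h1 : |(‖z‖ ^ 2)⁻¹ - 1| ≤ (‖z‖ ^ 2)⁻¹ + 1 := by
        refine (abs_sub _ _).trans ?_
        rw [abs_of_nonneg (by positivity), abs_one]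
      calc _ ≤ |1 / 2| * ((‖z‖ ^ 2)⁻¹ + 1) * ((1 + ‖z‖ ^ 2) ^ 2)⁻¹ *
            (C * ‖quat σ‖ * ‖Complex.I * z‖) := by
            gcongr
            exact hBb z _
        _ = 1 / 2 * (radialBound ‖z‖ * (C * ‖quat σ‖)) := by
            unfold radialBound
            rw [norm_mul, Complex.norm_I, abs_of_nonneg (by norm_num : (0 : ℝ) ≤ 1 / 2)]
            field_simp
        _ ≤ _ := by
            have : 0 ≤ radialBound ‖z‖ * (C * ‖quat σ‖) :=
              mul_nonneg (radialBound_nonneg hz'.le) (by positivity)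
            linarith
  obtain ⟨hi1, he1⟩ := fderiv_cauchyPart hb hσ (quat σ)
  obtain ⟨hi2, he2⟩ := fderiv_cauchyPart hb hσ (Complex.I • quat σ)
  -- The integrand of `∂̄` is split into a pure radial derivative of `β` and a pure angular
  -- derivative of `B`. The damping factor in `β` is chosen so that its radial derivative absorbs
  -- the undifferentiated term `-z B`.
  have hpt : ∀ z : ℂ, z ≠ 0 →
      (1 / 2 : ℂ) • (cauchyKernel z • fderiv ℝ b (chart σ z) (chart (quat σ) z) +
        Complex.I • cauchyKernel z • fderiv ℝ b (chart σ z) (chart (Complex.I • quat σ) z)) =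
      (1 / 2 : ℝ) • ((‖z‖ ^ 2)⁻¹ • fderiv ℝ β z z) + w ‖z‖ • fderiv ℝ B z (Complex.I * z) := by
    intro z hz
    have hx := chart_ne_zero hσ z
    have hdB := (hb.differentiableAt hx)
    -- Wirtinger derivatives of `b` and of its restriction
    have h1 : (1 / 2 : ℂ) • (fderiv ℝ b (chart σ z) (chart (quat σ) z) +
        Complex.I • fderiv ℝ b (chart σ z) (chart (Complex.I • quat σ) z)) =
        delBar b (chart σ z) (quat σ) - z • del b (chart σ z) σ := by
      rw [← del_smul]
      simp only [chart, quat_quat, quat_smul, Complex.star_def, Complex.conj_I, delBar, del,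
        map_add, smul_neg, neg_smul, neg_neg, map_neg, smul_comm Complex.I z σ]
      module
    have h2 : delBar b (chart σ z) (quat σ) = delBar B z 1 := by
      rw [hB, delBar_comp hdB (hasFDerivAt_chart σ z)]
      simp
    -- Euler's identity in holomorphic degree one trades the derivative along `σ`, which leaves the
    -- chart, for derivatives along the chart.
    have h3 : z • del b (chart σ z) σ = z • (B z - del B z z) := by
      have h4 := del_self_of_isHomogeneousOn hb.homogeneous hx hdB
      have h5 : del B z z = z • del b (chart σ z) (quat σ) := by
        rw [hB, del_comp hdB (hasFDerivAt_chart σ z)]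
        simp [del_smul]
      rw [h5]
      conv at h4 => lhs; arg 3; rw [chart]
      rw [del_add, del_smul] at h4
      simp only [Int.cast_one, one_smul] at h4
      rw [← eq_sub_iff_add_eq] at h4
      rw [h4]
    have h6 : delBar B z 1 = (star z)⁻¹ • delBar B z z := by
      have := delBar_smul B z 1 z
      rw [smul_eq_mul, mul_one] at this
      rw [this, inv_smul_smul₀ (star_ne_zero.2 hz)]
    have h7 : cauchyKernel z • fderiv ℝ b (chart σ z) (chart (quat σ) z) +
        Complex.I • cauchyKernel z • fderiv ℝ b (chart σ z) (chart (Complex.I • quat σ) z) =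
        cauchyKernel z • (fderiv ℝ b (chart σ z) (chart (quat σ) z) +
        Complex.I • fderiv ℝ b (chart σ z) (chart (Complex.I • quat σ) z)) := by module
    rw [h7, smul_comm, h1, h2, h3, h6, hβd]
    simp only [delBar, del, smul_eq_mul]
    have hs : star z ≠ 0 := star_ne_zero.2 hz
    have hn := one_add_mul_star_ne_zero z
    have hnn : (‖z‖ : ℂ) ^ 2 = z * star z := by
      rw [Complex.star_def, Complex.mul_conj, Complex.normSq_eq_norm_sq]; push_cast; rfl
    rw [hw]
    simp only [← Complex.coe_smul, cauchyKernel]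
    push_cast
    rw [hnn]
    match_scalars
    · field_simp
      ring
    · field_simp
    · field_simp
  rw [delBar, he1, he2, ← integral_smul, ← integral_add hi1 (hi2.fun_smul Complex.I), ← integral_smul]
  have hae : ∀ᵐ z : ℂ, z ≠ 0 := by
    simp [ae_iff]
  -- Half of `-2π β(0)` gives the constant `-π`; the angular part drops out.
  rw [integral_congr_ae (hae.mono hpt), integral_add (hfr.fun_smul (1 / 2 : ℝ)) hfa, integral_smul,
    integral_radial_derivative (hβs.of_le (by simp)) hβ0 hfr,
    integral_angular_derivative (hBs.of_le (by simp)) w hfa]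
  simp only [hβ, hB, chart_zero, norm_zero]
  simp only [← Complex.coe_smul]
  push_cast
  module

end FormSections

/-! ### Convergence of the principal value -/

/-- The Hermitian product of spinors. -/
def herm (σ τ : Spinor) : ℂ := σ 0 * star (τ 0) + σ 1 * star (τ 1)

theorem herm_smul_right (t : ℂ) (σ τ : Spinor) : herm σ (t • τ) = star t * herm σ τ := by
  simp [herm]; ring

theorem herm_chart (σ : Spinor) (z : ℂ) : herm σ (chart σ z) = nsq σ := by
  rw [coe_nsq]; simp [herm]; ring

theorem bracket_quat_chart (ξ : Spinor) (w : ℂ) : bracket ξ (quat (chart ξ w)) = nsq ξ := by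
  rw [coe_nsq]; simp [bracket]; ring

/-- The unitarily invariant kernel with weight one in `σ`. -/
def invariantKernel (τ σ : Spinor) : ℂ := herm σ τ ^ 2 / ((nsq τ : ℂ) ^ 2 * bracket τ σ)

/-- The coefficient of `(ξ σ)` in the difference of the propagator and the invariant kernel. -/
def poleKernel (ξ τ : Spinor) : ℂ := bracket ξ (quat τ) / (bracket ξ τ ^ 2 * nsq τ)

/-- The remaining part of the difference, which has a simple pole at `ξ`. -/
def linearKernel (ξ τ σ : Spinor) : ℂ :=
  bracket ξ (quat τ) * herm σ τ / (bracket ξ τ * (nsq τ : ℂ) ^ 2)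

/-- The squares of `(ξσ)/(ξτ)` and `herm σ τ / nsq τ` differ by a product of difference and sum. By
the two-dimensional Plücker-type identity `h`, the difference contains the factor `(τσ)`, which
cancels the Cauchy pole. What remains is linear in `σ`. -/
theorem propagator_eq {ξ τ σ : Spinor} (hτσ : bracket τ σ ≠ 0) (hξτ : bracket ξ τ ≠ 0) :
    propagator 1 ξ τ σ =
      invariantKernel τ σ + poleKernel ξ τ * bracket ξ σ + linearKernel ξ τ σ := by
  have hn : (nsq τ : ℂ) ≠ 0 := by exact_mod_cast (nsq_pos (ne_zero_of_bracket hξτ)).ne'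
  have h : nsq τ * bracket ξ σ - herm σ τ * bracket ξ τ = bracket τ σ * bracket ξ (quat τ) := by
    rw [coe_nsq]; simp [bracket, herm]; ring
  have h' : bracket ξ (quat τ) =
      (nsq τ * bracket ξ σ - herm σ τ * bracket ξ τ) / bracket τ σ := by
    rw [h, mul_div_cancel_left₀ _ hτσ]
  simp only [propagator, Nat.reduceAdd]
  rw [invariantKernel, poleKernel, linearKernel, h', div_pow]
  field_simp
  ring

theorem zpow_one_neg_two (t : ℂ) :
    (t ^ (1 : ℤ) * star t ^ (-2 : ℤ)) = t / star t ^ 2 := by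
  rw [zpow_one, zpow_neg]; rfl

theorem norm_pow_four (t : ℂ) : (((‖t‖ ^ 4)⁻¹ : ℝ) : ℂ) = (t ^ 2 * star t ^ 2)⁻¹ := by
  have : (‖t‖ : ℂ) ^ 2 = t * star t := by
    rw [Complex.star_def, Complex.mul_conj, Complex.normSq_eq_norm_sq]; push_cast; rfl
  push_cast
  rw [show (‖t‖ : ℂ) ^ 4 = ((‖t‖ : ℂ) ^ 2) ^ 2 by ring, this, mul_pow]

theorem coe_nsq_smul (t : ℂ) (σ : Spinor) : (nsq (t • σ) : ℂ) = t * star t * nsq σ := by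
  rw [coe_nsq, coe_nsq]; simp; ring

theorem nsq_coe_ne_zero {σ : Spinor} (hσ : σ ≠ 0) : (nsq σ : ℂ) ≠ 0 := by
  exact_mod_cast (nsq_pos hσ).ne'

section FormSections

variable {b : Spinor → Twistor} (hb : IsSection 1 (-2) b)

include hb

/-- Together with the next two lemmas, this is the scaling required to integrate each of the three
pieces in a unitary coordinate of choice. -/
theorem invariantKernel_smul (σ : Spinor) :
    ∀ τ : Spinor, τ ≠ 0 → ∀ t : ℂ, t ≠ 0 → invariantKernel (t • τ) σ • b (t • τ) =
      (‖t‖ ^ 4)⁻¹ • invariantKernel τ σ • b τ := by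
  intro τ hτ t ht
  have hs : star t ≠ 0 := star_ne_zero.2 ht
  rw [hb.homogeneous τ hτ t ht, ← Complex.coe_smul, norm_pow_four, smul_smul, smul_smul,
    zpow_one_neg_two t, invariantKernel, invariantKernel, herm_smul_right, coe_nsq_smul,
    bracket_smul_left]
  congr 1
  field_simp

theorem poleKernel_smul (ξ : Spinor) :
    ∀ τ : Spinor, τ ≠ 0 → ∀ t : ℂ, t ≠ 0 → poleKernel ξ (t • τ) • b (t • τ) =
      (‖t‖ ^ 4)⁻¹ • poleKernel ξ τ • b τ := by
  intro τ hτ t ht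
  have hs : star t ≠ 0 := star_ne_zero.2 ht
  rw [hb.homogeneous τ hτ t ht, ← Complex.coe_smul, norm_pow_four, smul_smul, smul_smul,
    zpow_one_neg_two t, poleKernel, poleKernel, quat_smul, coe_nsq_smul,
    bracket_smul_right, bracket_smul_right]
  congr 1
  field_simp

theorem linearKernel_smul (ξ σ : Spinor) :
    ∀ τ : Spinor, τ ≠ 0 → ∀ t : ℂ, t ≠ 0 → linearKernel ξ (t • τ) σ • b (t • τ) =
      (‖t‖ ^ 4)⁻¹ • linearKernel ξ τ σ • b τ := by
  intro τ hτ t ht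
  have hs : star t ≠ 0 := star_ne_zero.2 ht
  rw [hb.homogeneous τ hτ t ht, ← Complex.coe_smul, norm_pow_four, smul_smul, smul_smul,
    zpow_one_neg_two t, linearKernel, linearKernel, quat_smul, coe_nsq_smul, herm_smul_right,
    bracket_smul_right, bracket_smul_right]
  congr 1
  field_simp

/-- In the coordinate centred at `σ` the Hermitian product is constant and `(τσ)` is a multiple of
`z`, so the kernel is `cauchyKernel` divided by `-nsq σ`. -/
theorem integral_invariantKernel {σ : Spinor} (hσ : σ ≠ 0) :
    Integrable (fun z => invariantKernel (affine z) σ • b (affine z)) ∧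
    ∫ z, invariantKernel (affine z) σ • b (affine z) = -(nsq σ : ℂ) • cauchyPart b σ := by
  obtain ⟨h1, h2⟩ := integral_affine_eq_integral_chart
    (G := fun τ => invariantKernel τ σ • b τ) (invariantKernel_smul hb σ) hσ
  have hn := nsq_coe_ne_zero hσ
  have h3 (z : ℂ) : invariantKernel (chart σ z) σ • b (chart σ z) =
      (-(nsq σ : ℂ)⁻¹) • cauchyKernel z • b (chart σ z) := by
    rw [smul_smul, invariantKernel, herm_chart, nsq_chart, bracket_comm, bracket_chart,
      cauchyKernel, Complex.ofReal_mul, coe_one_add_norm_sq]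
    congr 1
    have h4 := one_add_mul_star_ne_zero z
    rcases eq_or_ne z 0 with rfl | hz
    · simp
    field_simp
  simp only [h3] at h1 h2
  refine ⟨h1.2 ((integrable_cauchyPart hb hσ).fun_smul (-(nsq σ : ℂ)⁻¹)), ?_⟩
  rw [h2, integral_smul, ← Complex.coe_smul, smul_smul, cauchyPart]
  congr 1
  push_cast
  field_simp

/-- In the coordinate centred at `ξ` only a simple pole remains, which is integrable in the plane;
the growth of the Hermitian product at infinity is beaten by the decay of `cauchyKernel`. -/
theorem integrable_linearKernel {ξ : Spinor} (hξ : ξ ≠ 0) (σ : Spinor) :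
    Integrable (fun z => linearKernel ξ (affine z) σ • b (affine z)) := by
  refine (integral_affine_eq_integral_chart (G := fun τ => linearKernel ξ τ σ • b τ)
    (linearKernel_smul hb ξ σ) hξ).1.2 ?_
  have hn := nsq_coe_ne_zero hξ
  obtain ⟨C, hC0, hC, -⟩ := exists_bound_chart hb hξ
  have h3 (w : ℂ) : linearKernel ξ (chart ξ w) σ =
      ((nsq ξ : ℂ) ^ 2)⁻¹ * (herm σ (chart ξ w) * cauchyKernel w) := by
    rw [linearKernel, bracket_quat_chart, bracket_chart, nsq_chart, cauchyKernel,
      Complex.ofReal_mul, coe_one_add_norm_sq]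
    have h4 := one_add_mul_star_ne_zero w
    rcases eq_or_ne w 0 with rfl | hw
    · simp
    field_simp
  have hherm (w : ℂ) : ‖herm σ (chart ξ w)‖ ≤ ‖σ‖ * (4 * ‖ξ‖) * (1 + ‖w‖ ^ 2) := by
    have hσ0 := norm_le_pi_norm σ 0
    have hσ1 := norm_le_pi_norm σ 1
    have hξ0 := norm_le_pi_norm ξ 0
    have hξ1 := norm_le_pi_norm ξ 1
    have h0 : ‖chart ξ w 0‖ ≤ ‖ξ‖ * (1 + ‖w‖) := by
      rw [chart_zero_apply]
      refine (norm_sub_le _ _).trans ?_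
      rw [norm_mul, norm_star]
      nlinarith [norm_nonneg w]
    have h1 : ‖chart ξ w 1‖ ≤ ‖ξ‖ * (1 + ‖w‖) := by
      rw [chart_one_apply]
      refine (norm_add_le _ _).trans ?_
      rw [norm_mul, norm_star]
      nlinarith [norm_nonneg w]
    have h2 : 1 + ‖w‖ ≤ 2 * (1 + ‖w‖ ^ 2) := by nlinarith [sq_nonneg (‖w‖ - 1)]
    calc ‖herm σ (chart ξ w)‖ ≤ ‖σ 0‖ * ‖chart ξ w 0‖ + ‖σ 1‖ * ‖chart ξ w 1‖ := by
          refine (norm_add_le _ _).trans ?_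
          rw [norm_mul, norm_mul, norm_star, norm_star]
      _ ≤ ‖σ‖ * (‖ξ‖ * (1 + ‖w‖)) + ‖σ‖ * (‖ξ‖ * (1 + ‖w‖)) := by gcongr
      _ = ‖σ‖ * ‖ξ‖ * 2 * (1 + ‖w‖) := by ring
      _ ≤ ‖σ‖ * ‖ξ‖ * 2 * (2 * (1 + ‖w‖ ^ 2)) := by gcongr
      _ = _ := by ring
  have hbc : Continuous fun w => b (chart ξ w) :=
    hb.smooth.continuousOn.comp_continuous (contDiff_chart ξ).continuous
      fun w => chart_ne_zero hξ w
  have hhc : Continuous fun w => herm σ (chart ξ w) := by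
    simp only [herm, chart_zero_apply, chart_one_apply]; fun_prop
  refine (integrable_radialBound.mul_const
    (‖((nsq ξ : ℂ) ^ 2)⁻¹‖ * (‖σ‖ * (4 * ‖ξ‖)) * C)).mono' ?_ (ae_of_all _ fun w => ?_)
  · simp only [h3]
    exact ((measurable_const.mul (hhc.measurable.mul
      measurable_cauchyKernel)).aestronglyMeasurable).smul hbc.aestronglyMeasurable
  · rw [norm_smul, h3, norm_mul, norm_mul, norm_cauchyKernel]
    calc _ ≤ ‖((nsq ξ : ℂ) ^ 2)⁻¹‖ * (‖σ‖ * (4 * ‖ξ‖) * (1 + ‖w‖ ^ 2) *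
          (‖w‖⁻¹ * ((1 + ‖w‖ ^ 2) ^ 2)⁻¹)) * C := by
          gcongr
          · exact hherm w
          · exact hC w
      _ = _ := by
          unfold radialBound
          have : (1 + ‖w‖ ^ 2) * ((1 + ‖w‖ ^ 2) ^ 2)⁻¹ = (1 + ‖w‖ ^ 2)⁻¹ := by field_simp
          linear_combination ‖((nsq ξ : ℂ) ^ 2)⁻¹‖ * (‖σ‖ * (4 * ‖ξ‖)) * ‖w‖⁻¹ * C * this

end FormSections

/-- The spinors at chordal distance more than `ε` from `ξ`. -/
def awayCone (ξ : Spinor) (ε : ℝ) : Set Spinor :=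
  {τ | ε ^ 2 * (nsq ξ * nsq τ) < ‖bracket ξ τ‖ ^ 2}

theorem mem_awayFrom_iff (ξ : Spinor) (ε : ℝ) (z : ℂ) :
    z ∈ awayFrom ξ ε ↔ affine z ∈ awayCone ξ ε := by
  simp only [awayFrom, awayCone, Set.mem_ofPred_eq, nsq_affine]
  rfl

theorem smul_mem_awayCone_iff (ξ : Spinor) (ε : ℝ) {t : ℂ} (ht : t ≠ 0) (τ : Spinor) :
    t • τ ∈ awayCone ξ ε ↔ τ ∈ awayCone ξ ε := by
  simp only [awayCone, Set.mem_ofPred_eq, nsq_smul, bracket_smul_right, norm_mul, mul_pow]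
  have : 0 < ‖t‖ ^ 2 := by have := norm_pos_iff.2 ht; positivity
  rw [show ε ^ 2 * (nsq ξ * (‖t‖ ^ 2 * nsq τ)) = ‖t‖ ^ 2 * (ε ^ 2 * (nsq ξ * nsq τ)) by ring]
  exact mul_lt_mul_iff_right₀ this

/-- The complement of a disc in the coordinate centred at `ξ`. -/
def outside (ε : ℝ) : Set ℂ := {w | ε ^ 2 * (1 + ‖w‖ ^ 2) < ‖w‖ ^ 2}

theorem measurableSet_outside (ε : ℝ) : MeasurableSet (outside ε) :=
  (isOpen_lt (by fun_prop) (by fun_prop)).measurableSet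

theorem measurableSet_awayFrom (ξ : Spinor) (ε : ℝ) : MeasurableSet (awayFrom ξ ε) := by
  refine (isOpen_lt (by fun_prop) ?_).measurableSet
  simp only [bracket, affine_zero_apply, affine_one_apply]
  fun_prop

theorem chart_mem_awayCone_iff {ξ : Spinor} (hξ : ξ ≠ 0) (ε : ℝ) (w : ℂ) :
    chart ξ w ∈ awayCone ξ ε ↔ w ∈ outside ε := by
  have h := nsq_pos hξ
  simp only [awayCone, outside, Set.mem_ofPred_eq, nsq_chart, bracket_chart, norm_mul, mul_pow,
    Complex.norm_real, Real.norm_of_nonneg h.le]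
  rw [show ε ^ 2 * (nsq ξ * (nsq ξ * (1 + ‖w‖ ^ 2))) =
    nsq ξ ^ 2 * (ε ^ 2 * (1 + ‖w‖ ^ 2)) by ring, mul_comm (‖w‖ ^ 2)]
  exact mul_lt_mul_iff_right₀ (by positivity)

/-- The change of variables to the coordinate centred at `ξ`, for the truncated integrals. -/
theorem integral_awayFrom_eq {G : Spinor → Twistor}
    (hG : ∀ σ : Spinor, σ ≠ 0 → ∀ t : ℂ, t ≠ 0 → G (t • σ) = (‖t‖ ^ 4)⁻¹ • G σ)
    {ξ : Spinor} (hξ : ξ ≠ 0) (ε : ℝ) :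
    (IntegrableOn (fun z => G (affine z)) (awayFrom ξ ε) ↔
      IntegrableOn (fun z => G (chart ξ z)) (outside ε)) ∧
    ∫ z in awayFrom ξ ε, G (affine z) = nsq ξ ^ 2 • ∫ z in outside ε, G (chart ξ z) := by
  classical
  have hG' : ∀ σ : Spinor, σ ≠ 0 → ∀ t : ℂ, t ≠ 0 →
      (awayCone ξ ε).indicator G (t • σ) = (‖t‖ ^ 4)⁻¹ • (awayCone ξ ε).indicator G σ := by
    intro σ hσ t ht
    by_cases h : σ ∈ awayCone ξ ε
    · rw [Set.indicator_of_mem h, Set.indicator_of_mem ((smul_mem_awayCone_iff ξ ε ht σ).2 h),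
        hG σ hσ t ht]
    · rw [Set.indicator_of_notMem h,
        Set.indicator_of_notMem (fun h' => h ((smul_mem_awayCone_iff ξ ε ht σ).1 h')), smul_zero]
  have h1 : (fun z => (awayCone ξ ε).indicator G (affine z)) =
      (awayFrom ξ ε).indicator fun z => G (affine z) := by
    ext1 z
    simp only [Set.indicator, mem_awayFrom_iff]
  have h2 : (fun z => (awayCone ξ ε).indicator G (chart ξ z)) =
      (outside ε).indicator fun z => G (chart ξ z) := by
    ext1 z
    simp only [Set.indicator, chart_mem_awayCone_iff hξ]
  have h3 := integral_affine_eq_integral_chart hG' hξ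
  rw [h1, h2, integrable_indicator_iff (measurableSet_awayFrom ξ ε),
    integrable_indicator_iff (measurableSet_outside ε),
    integral_indicator (measurableSet_awayFrom ξ ε),
    integral_indicator (measurableSet_outside ε)] at h3
  exact h3

theorem lt_norm_of_mem_outside {ε : ℝ} {w : ℂ} (hw : w ∈ outside ε) : ε < ‖w‖ := by
  have h : ε ^ 2 * (1 + ‖w‖ ^ 2) < ‖w‖ ^ 2 := hw
  have h2 : ε ^ 2 < ‖w‖ ^ 2 := by nlinarith [mul_nonneg (sq_nonneg ε) (sq_nonneg ‖w‖)]
  exact lt_of_pow_lt_pow_left₀ 2 (norm_nonneg w) h2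

theorem eventually_mem_outside {w : ℂ} (hw : w ≠ 0) : ∀ᶠ ε in 𝓝[>] (0 : ℝ), w ∈ outside ε := by
  have h : Tendsto (fun ε : ℝ => ε ^ 2 * (1 + ‖w‖ ^ 2)) (𝓝[>] 0) (𝓝 0) := by
    have : Continuous fun ε : ℝ => ε ^ 2 * (1 + ‖w‖ ^ 2) := by fun_prop
    simpa using (this.tendsto 0).mono_left nhdsWithin_le_nhds
  exact h.eventually (gt_mem_nhds (by have := norm_pos_iff.2 hw; positivity))

theorem I_mul_mem_outside_iff (ε : ℝ) (w : ℂ) : Complex.I * w ∈ outside ε ↔ w ∈ outside ε := by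
  simp [outside]

/-- The kernel with a double pole, in the coordinate centred at the pole. -/
def doublePole (w : ℂ) : ℂ := (w ^ 2 * (1 + w * star w))⁻¹

theorem norm_doublePole (w : ℂ) : ‖doublePole w‖ = ‖w‖⁻¹ * radialBound ‖w‖ := by
  rw [doublePole, norm_inv, norm_mul, norm_pow, norm_one_add_mul_star, radialBound, mul_inv,
    pow_two, mul_inv, mul_assoc]

theorem measurable_doublePole : Measurable doublePole := by
  have : Continuous fun w : ℂ => w ^ 2 * (1 + w * star w) := by fun_prop
  exact this.measurable.inv

theorem integrableOn_doublePole_smul {ε : ℝ} (hε : 0 < ε) {B : ℂ → Twistor} (hB : Continuous B)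
    {C : ℝ} (hC : ∀ w, ‖B w‖ ≤ C) : IntegrableOn (fun w => doublePole w • B w) (outside ε) := by
  refine ((integrable_radialBound.mul_const (ε⁻¹ * C)).integrableOn (s := outside ε)).mono'
    ((measurable_doublePole.aestronglyMeasurable).smul hB.aestronglyMeasurable) ?_
  filter_upwards [ae_restrict_mem (measurableSet_outside ε)] with w hw
  rw [norm_smul, norm_doublePole]
  have h1 := lt_norm_of_mem_outside hw
  have h2 := radialBound_nonneg (norm_nonneg w)
  have h3 : ‖w‖⁻¹ ≤ ε⁻¹ := inv_anti₀ hε h1.le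
  calc _ ≤ ε⁻¹ * radialBound ‖w‖ * C := by gcongr; exact hC w
    _ = _ := by ring

/-- Rotation by `i` preserves the region and the measure and changes the sign of `w⁻²`. No
integrability is needed for this. -/
theorem integral_doublePole (ε : ℝ) (c : Twistor) : ∫ w in outside ε, doublePole w • c = 0 := by
  rw [← integral_indicator (measurableSet_outside ε)]
  have h := integral_comp_I_mul ((outside ε).indicator fun w => doublePole w • c)
  have h2 (w : ℂ) : (outside ε).indicator (fun w => doublePole w • c) (Complex.I * w) =
      -(outside ε).indicator (fun w => doublePole w • c) w := by
    have h3 : doublePole (Complex.I * w) = -doublePole w := by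
      simp only [doublePole, star_mul', Complex.star_def, Complex.conj_I]
      rw [← inv_neg]
      congr 1
      linear_combination (w ^ 2 - w ^ 3 * (starRingEnd ℂ) w * (Complex.I ^ 2 - 1)) *
        Complex.I_mul_I
    by_cases hw : w ∈ outside ε
    · rw [Set.indicator_of_mem hw, Set.indicator_of_mem ((I_mul_mem_outside_iff ε w).2 hw), h3,
        neg_smul]
    · rw [Set.indicator_of_notMem hw,
        Set.indicator_of_notMem (fun h' => hw ((I_mul_mem_outside_iff ε w).1 h')), neg_zero]
  simp only [h2, integral_neg] at h
  exact self_eq_neg.1 h.symm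

/-- The principal value of an integral with a double pole. -/
theorem exists_tendsto_doublePole {B : ℂ → Twistor} (hB : Continuous B)
    {C : ℝ} (hC : ∀ w, ‖B w‖ ≤ C) {K : ℝ} (hK : ∀ w, ‖B w - B 0‖ ≤ K * ‖w‖) :
    ∃ c, Tendsto (fun ε => ∫ w in outside ε, doublePole w • B w) (𝓝[>] (0 : ℝ)) (𝓝 c) := by
  -- Subtracting the constant `B 0` does not change the truncated integrals, by symmetry, and the
  -- Lipschitz bound reduces the double pole to an integrable simple one.
  refine ⟨∫ w, doublePole w • (B w - B 0), ?_⟩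
  have h1 : ∀ᶠ ε in 𝓝[>] (0 : ℝ), ∫ w, (outside ε).indicator
      (fun w => doublePole w • (B w - B 0)) w = ∫ w in outside ε, doublePole w • B w := by
    filter_upwards [self_mem_nhdsWithin] with ε hε
    rw [integral_indicator (measurableSet_outside ε)]
    simp only [smul_sub]
    rw [integral_sub (integrableOn_doublePole_smul hε hB hC)
      (integrableOn_doublePole_smul hε continuous_const (fun _ => le_rfl)),
      integral_doublePole, sub_zero]
  refine Tendsto.congr' h1 ?_
  refine tendsto_integral_filter_of_dominated_convergence (fun w => radialBound ‖w‖ * K) ?_ ?_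
    (integrable_radialBound.mul_const K) ?_
  · refine Eventually.of_forall fun ε => ?_
    exact ((measurable_doublePole.aestronglyMeasurable).smul
      (hB.sub continuous_const).aestronglyMeasurable).indicator (measurableSet_outside ε)
  · refine Eventually.of_forall fun ε => ae_of_all _ fun w => ?_
    refine (norm_indicator_le_norm_self _ _).trans ?_
    rw [norm_smul, norm_doublePole]
    rcases eq_or_ne w 0 with rfl | hw
    · simp [radialBound]
    have := norm_pos_iff.2 hw
    calc _ ≤ ‖w‖⁻¹ * radialBound ‖w‖ * (K * ‖w‖) := by
          gcongr
          · exact mul_nonneg (by positivity) (radialBound_nonneg this.le)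
          · exact hK w
      _ = _ := by field_simp
  · have : ∀ᵐ w : ℂ, w ≠ 0 := by simp [ae_iff]
    filter_upwards [this] with w hw
    refine tendsto_const_nhds.congr' ?_
    filter_upwards [eventually_mem_outside hw] with ε hε
    rw [Set.indicator_of_mem hε]

section FormSections

variable {b : Spinor → Twistor} (hb : IsSection 1 (-2) b)

include hb

theorem continuous_section_chart {σ : Spinor} (hσ : σ ≠ 0) : Continuous fun w => b (chart σ w) :=
  hb.smooth.continuousOn.comp_continuous (contDiff_chart σ).continuous
    fun w => chart_ne_zero hσ w

theorem exists_lipschitz_chart {σ : Spinor} (hσ : σ ≠ 0) :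
    ∃ K, 0 ≤ K ∧ ∀ z w, ‖b (chart σ z) - b (chart σ w)‖ ≤ K * ‖z - w‖ := by
  obtain ⟨C, hC0, -, hC'⟩ := exists_bound_chart hb hσ
  refine ⟨C * ‖quat σ‖, by positivity, fun z w => ?_⟩
  have hd (z : ℂ) := ((hb.differentiableAt (chart_ne_zero hσ z)).hasFDerivAt.comp z
      ((hasFDerivAt_chart σ z).restrictScalars ℝ))
  refine Convex.norm_image_sub_le_of_norm_hasFDerivWithin_le (𝕜 := ℝ) (s := Set.univ)
    (fun z _ => (hd z).hasFDerivWithinAt) (fun z _ => ?_) convex_univ (Set.mem_univ w)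
    (Set.mem_univ z)
  refine ContinuousLinearMap.opNorm_le_bound _ (by positivity) fun v => ?_
  refine (hC' _ _).trans ?_
  simp [norm_smul, mul_assoc, mul_comm ‖v‖]

/-- Chordal discs about `ξ` are Euclidean discs about `0` in the unitary coordinate centred at `ξ`;
this is why the Fubini–Study cutoff has the rotational symmetry that the principal value relies on.
-/
theorem exists_tendsto_poleKernel {ξ : Spinor} (hξ : ξ ≠ 0) :
    (∀ ε, 0 < ε → IntegrableOn (fun z => poleKernel ξ (affine z) • b (affine z))
      (awayFrom ξ ε)) ∧
    ∃ c, Tendsto (fun ε => ∫ z in awayFrom ξ ε, poleKernel ξ (affine z) • b (affine z))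
      (𝓝[>] (0 : ℝ)) (𝓝 c) := by
  obtain ⟨C, hC0, hC, -⟩ := exists_bound_chart hb hξ
  obtain ⟨K, hK0, hK⟩ := exists_lipschitz_chart hb hξ
  have hc := continuous_section_chart hb hξ
  have hn := nsq_coe_ne_zero hξ
  have h3 (w : ℂ) : poleKernel ξ (chart ξ w) • b (chart ξ w) =
      ((nsq ξ : ℂ) ^ 2)⁻¹ • doublePole w • b (chart ξ w) := by
    rw [smul_smul, poleKernel, bracket_quat_chart, bracket_chart, nsq_chart, doublePole,
      Complex.ofReal_mul, coe_one_add_norm_sq]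
    congr 1
    have h4 := one_add_mul_star_ne_zero w
    rcases eq_or_ne w 0 with rfl | hw
    · simp
    field_simp
  have hch := integral_awayFrom_eq (G := fun τ => poleKernel ξ τ • b τ)
    (poleKernel_smul hb ξ) hξ
  constructor
  · intro ε hε
    refine (hch ε).1.2 ?_
    simp only [h3]
    exact Integrable.fun_smul (((nsq ξ : ℂ) ^ 2)⁻¹) (integrableOn_doublePole_smul hε hc hC)
  · obtain ⟨c, hc'⟩ := exists_tendsto_doublePole hc hC (K := K) fun w => by simpa using hK w 0
    refine ⟨nsq ξ ^ 2 • ((nsq ξ : ℂ) ^ 2)⁻¹ • c, ?_⟩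
    simp only [fun ε => (hch ε).2, h3, integral_smul]
    exact (hc'.const_smul _).const_smul _

/-- Convergence of the principal value `⟨Z(σ) V_f⟩_1` for a smooth field, and its value. -/
theorem exists_hasContraction {ξ : Spinor} (hξ : ξ ≠ 0) :
    ∃ c c₀ c₁ : Twistor, ∀ σ : Spinor, σ ≠ 0 →
      HasContraction ξ (fun z => b (affine z)) σ
        ((-2 * Complex.I) • (-(nsq σ : ℂ) • cauchyPart b σ + bracket ξ σ • c +
          (σ 0 • c₀ + σ 1 • c₁))) := by
  obtain ⟨hi1, c, hc⟩ := exists_tendsto_poleKernel hb hξ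
  have hlin (τ σ : Spinor) : linearKernel ξ τ σ =
      σ 0 * linearKernel ξ τ ![1, 0] + σ 1 * linearKernel ξ τ ![0, 1] := by
    simp only [linearKernel, herm, Matrix.cons_val_zero, Matrix.cons_val_one]
    ring
  have hl0 := integrable_linearKernel hb hξ ![1, 0]
  have hl1 := integrable_linearKernel hb hξ ![0, 1]
  refine ⟨c, ∫ z, linearKernel ξ (affine z) ![1, 0] • b (affine z),
    ∫ z, linearKernel ξ (affine z) ![0, 1] • b (affine z), fun σ hσ => ?_⟩
  have hl := integrable_linearKernel hb hξ σ
  have hlv : ∫ z, linearKernel ξ (affine z) σ • b (affine z) =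
      σ 0 • (∫ z, linearKernel ξ (affine z) ![1, 0] • b (affine z)) +
      σ 1 • ∫ z, linearKernel ξ (affine z) ![0, 1] • b (affine z) := by
    rw [← integral_smul, ← integral_smul, ← integral_add (hl0.fun_smul _) (hl1.fun_smul _)]
    refine integral_congr_ae (ae_of_all _ fun z => ?_)
    simp only [hlin _ σ, add_smul, mul_smul]
  obtain ⟨hk, hkv⟩ := integral_invariantKernel hb hσ
  have hae : ∀ᵐ z : ℂ, bracket (affine z) σ ≠ 0 := by
    have : {z : ℂ | ¬ bracket (affine z) σ ≠ 0}.Subsingleton := by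
      intro z hz w hw
      simp only [Set.mem_ofPred_eq, not_not, bracket, affine_zero_apply, affine_one_apply,
        one_mul] at hz hw
      rcases eq_or_ne (σ 0) 0 with h0 | h0
      · rcases spinor_ne_zero_iff.1 hσ with h | h
        · exact absurd h0 h
        · rw [h0] at hz; exact absurd (by simpa using hz) h
      · exact mul_right_cancel₀ h0 (by linear_combination hw - hz)
    rw [ae_iff]
    exact this.measure_zero volume
  have hp (ε : ℝ) : ∀ᵐ z ∂(volume.restrict (awayFrom ξ ε)),
      propagator 1 ξ (affine z) σ • b (affine z) =
      invariantKernel (affine z) σ • b (affine z) +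
      bracket ξ σ • poleKernel ξ (affine z) • b (affine z) +
      linearKernel ξ (affine z) σ • b (affine z) := by
    filter_upwards [ae_restrict_of_ae hae, ae_restrict_mem (measurableSet_awayFrom ξ ε)]
      with z hz hzε
    have h1 : bracket ξ (affine z) ≠ 0 := by
      intro h0
      have h2 := (mem_awayFrom_iff ξ ε z).1 hzε
      simp only [awayCone, Set.mem_ofPred_eq, h0, norm_zero] at h2
      have := nsq_nonneg ξ
      have := nsq_nonneg (affine z)
      have : 0 ≤ ε ^ 2 * (nsq ξ * nsq (affine z)) := by positivity
      linarith
    rw [propagator_eq hz h1, smul_smul, ← add_smul, ← add_smul, mul_comm (bracket ξ σ)]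
  constructor
  · intro ε hε
    exact (((hk.integrableOn).add ((hi1 ε hε).smul (bracket ξ σ))).add hl.integrableOn).congr
      ((hp ε).mono fun z hz => hz.symm)
  -- For the two absolutely integrable pieces the cutoff is harmless by dominated convergence.
  · have hlim {f : ℂ → Twistor} (hf : Integrable f) :
        Tendsto (fun ε => ∫ z in awayFrom ξ ε, f z) (𝓝[>] (0 : ℝ)) (𝓝 (∫ z, f z)) := by
      have h1 : ∀ ε, ∫ z in awayFrom ξ ε, f z = ∫ z, (awayFrom ξ ε).indicator f z := fun ε =>
        (integral_indicator (measurableSet_awayFrom ξ ε)).symm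
      simp only [h1]
      refine tendsto_integral_filter_of_dominated_convergence (fun z => ‖f z‖) ?_ ?_ hf.norm ?_
      · exact Eventually.of_forall fun ε => hf.1.indicator (measurableSet_awayFrom ξ ε)
      · exact Eventually.of_forall fun ε => ae_of_all _ fun z => norm_indicator_le_norm_self _ _
      · have hae' : ∀ᵐ z : ℂ, bracket ξ (affine z) ≠ 0 := by
          have : {z : ℂ | ¬ bracket ξ (affine z) ≠ 0}.Subsingleton := by
            intro z hz w hw
            simp only [Set.mem_ofPred_eq, not_not, bracket, affine_zero_apply, affine_one_apply,
              mul_one] at hz hw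
            rcases eq_or_ne (ξ 0) 0 with h0 | h0
            · rcases spinor_ne_zero_iff.1 hξ with h | h
              · exact absurd h0 h
              · rw [h0] at hz; exact absurd (by simpa using hz) h
            · exact mul_left_cancel₀ h0 (by linear_combination hz - hw)
          rw [ae_iff]
          exact this.measure_zero volume
        filter_upwards [hae'] with z hz
        refine tendsto_const_nhds.congr' ?_
        have h2 : Tendsto (fun ε : ℝ => ε ^ 2 * (nsq ξ * nsq (affine z))) (𝓝[>] 0) (𝓝 0) := by
          have : Continuous fun ε : ℝ => ε ^ 2 * (nsq ξ * nsq (affine z)) := by fun_prop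
          simpa using (this.tendsto 0).mono_left nhdsWithin_le_nhds
        filter_upwards [h2.eventually (gt_mem_nhds (show 0 < ‖bracket ξ (affine z)‖ ^ 2 by
          have := norm_pos_iff.2 hz; positivity))] with ε hε
        rw [Set.indicator_of_mem ((mem_awayFrom_iff ξ ε z).2 hε)]
    have h3 : ∀ᶠ ε in 𝓝[>] (0 : ℝ), (-2 * Complex.I) •
        ((∫ z in awayFrom ξ ε, invariantKernel (affine z) σ • b (affine z)) +
        bracket ξ σ • (∫ z in awayFrom ξ ε, poleKernel ξ (affine z) • b (affine z)) +
        ∫ z in awayFrom ξ ε, linearKernel ξ (affine z) σ • b (affine z)) =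
        truncatedContraction ξ (fun z => b (affine z)) σ ε := by
      filter_upwards [self_mem_nhdsWithin] with ε hε
      rw [truncatedContraction, integral_congr_ae (hp ε),
        integral_add (hk.integrableOn.fun_add ((hi1 ε hε).fun_smul (bracket ξ σ))) hl.integrableOn,
        integral_add hk.integrableOn ((hi1 ε hε).fun_smul (bracket ξ σ)), integral_smul]
    refine Tendsto.congr' h3 ?_
    rw [← hkv, ← hlv]
    exact (((hlim hk).add (hc.const_smul _)).add (hlim hl)).const_smul _

end FormSections

/-! ### Properties of the contraction with a smooth field -/

theorem HasContraction.contraction_eq {ξ : Spinor} {f : ℂ → Twistor} {σ : Spinor} {y : Twistor}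
    (h : HasContraction ξ f σ y) : contraction ξ f σ = y :=
  h.2.limUnder_eq

/-- A spinor and its quaternionic conjugate form an orthogonal frame, so a linear form need only be
tested on these two directions. -/
theorem nsq_smul_eq (ξ v : Spinor) :
    (nsq ξ : ℂ) • v = herm v ξ • ξ + bracket ξ v • quat ξ := by
  rw [coe_nsq]
  ext i
  fin_cases i <;> simp [herm, bracket] <;> ring

/-- The majorant for the rescaled integral near `ξ`, with `a = ‖y‖` and `c = ‖1 - y‖`. At most one
of the two is small, and the smaller one carries the estimate. -/
theorem norm_bound_two_poles {a c : ℝ} (ha : 0 < a) (hc : 0 < c) (hac : 1 ≤ a + c) :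
    min a 1 * (a ^ 2 * c)⁻¹ ≤ 9 * (radialBound a + radialBound c) := by
  have hm1 : min a 1 ≤ a := min_le_left _ _
  have hm2 : min a 1 ≤ 1 := min_le_right _ _
  have hm0 : 0 ≤ min a 1 := le_min ha.le zero_le_one
  rcases le_total a c with h | h
  · have h1 : min a 1 * (a ^ 2 * c)⁻¹ ≤ 9 * radialBound a := by
      rw [radialBound, ← div_eq_mul_inv, ← mul_inv, ← div_eq_mul_inv,
        div_le_div_iff₀ (by positivity) (by positivity)]
      have h2 : 1 + a ≤ 3 * c := by linarith
      have h3 : min a 1 * (1 + a ^ 2) ≤ 2 * a * (1 + a) := by nlinarith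
      calc min a 1 * (a * (1 + a ^ 2)) = a * (min a 1 * (1 + a ^ 2)) := by ring
        _ ≤ a * (2 * a * (1 + a)) := by gcongr
        _ ≤ a * (2 * a * (3 * c)) := by gcongr
        _ ≤ 9 * (a ^ 2 * c) := by nlinarith [mul_pos (mul_pos ha ha) hc]
    linarith [radialBound_nonneg hc.le]
  · have h1 : min a 1 * (a ^ 2 * c)⁻¹ ≤ 9 * radialBound c := by
      rw [radialBound, ← div_eq_mul_inv, ← mul_inv, ← div_eq_mul_inv,
        div_le_div_iff₀ (by positivity) (by positivity)]
      have h2 : 1 + c ≤ 3 * a := by linarith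
      have h3 : (1 + c) ^ 2 ≤ (3 * a) ^ 2 := by gcongr
      calc min a 1 * (c * (1 + c ^ 2)) ≤ 1 * (c * (1 + c ^ 2)) := by gcongr
        _ ≤ c * (1 + c) ^ 2 := by nlinarith
        _ ≤ c * (3 * a) ^ 2 := by gcongr
        _ = 9 * (a ^ 2 * c) := by ring
    linarith [radialBound_nonneg ha.le]

theorem integrable_radialBound_sub : Integrable fun z : ℂ => radialBound ‖1 - z‖ :=
  integrable_radialBound.comp_sub_left 1

theorem integrable_comp_I_mul {f : ℂ → Twistor} (hf : Integrable f) :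
    Integrable fun z => f (Complex.I * z) := by
  let e : ℂ ≃ₗᵢ[ℝ] ℂ := rotation ⟨Complex.I, by simp [Submonoid.unitSphere]⟩
  exact (e.measurePreserving.integrable_comp_emb e.toHomeomorph.measurableEmbedding).2 hf

theorem indicator_outside_comp_I_mul (f : ℂ → Twistor) (ε : ℝ) (w : ℂ) :
    (outside ε).indicator f (Complex.I * w) =
      (outside ε).indicator (fun w => f (Complex.I * w)) w := by
  by_cases h : w ∈ outside ε
  · rw [Set.indicator_of_mem h, Set.indicator_of_mem ((I_mul_mem_outside_iff ε w).2 h)]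
  · rw [Set.indicator_of_notMem h, Set.indicator_of_notMem (mt (I_mul_mem_outside_iff ε w).1 h)]

theorem integral_comp_I_mul_outside (f : ℂ → Twistor) (ε : ℝ) :
    ∫ w in outside ε, f (Complex.I * w) = ∫ w in outside ε, f w := by
  rw [← integral_indicator (measurableSet_outside ε), ← integral_indicator
    (measurableSet_outside ε)]
  have h := integral_comp_I_mul ((outside ε).indicator f)
  simpa only [indicator_outside_comp_I_mul] using h

theorem integrableOn_comp_I_mul_outside {f : ℂ → Twistor} {ε : ℝ}
    (hf : IntegrableOn f (outside ε)) :
    IntegrableOn (fun w => f (Complex.I * w)) (outside ε) := by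
  rw [← integrable_indicator_iff (measurableSet_outside ε)] at hf ⊢
  exact (integrable_comp_I_mul hf).congr
    (ae_of_all _ fun w => indicator_outside_comp_I_mul f ε w)

/-- The propagator in the coordinate centred at the reference point, up to a factor. -/
def centredPropagator (η w : ℂ) : ℂ := (η / w) ^ 2 / (η - w)

theorem propagator_chart {ξ : Spinor} (hξ : ξ ≠ 0) (η w : ℂ) :
    propagator 1 ξ (chart ξ w) (chart ξ η) = (nsq ξ : ℂ)⁻¹ * centredPropagator η w := by
  have hn := nsq_coe_ne_zero hξ
  have h : bracket (chart ξ w) (chart ξ η) = (η - w) * nsq ξ := by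
    rw [coe_nsq]; simp [bracket]; ring
  rw [propagator, h, bracket_chart, bracket_chart, centredPropagator, mul_div_mul_right _ _ hn,
    div_mul_eq_div_div, div_eq_mul_inv _ (nsq ξ : ℂ), mul_comm]

/-- The propagator scales like `r⁻¹`; with the area factor `r²` the rescaled integral is of order
`r`, the order at which a first derivative is read off. -/
theorem norm_centredPropagator {r : ℝ} (hr : 0 < r) (y : ℂ) :
    ‖centredPropagator r (r * y)‖ = r⁻¹ * (‖y‖ ^ 2 * ‖1 - y‖)⁻¹ := by
  rw [centredPropagator, norm_div, norm_pow, norm_div, norm_mul, ← mul_one_sub, norm_mul,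
    Complex.norm_real, Real.norm_of_nonneg hr.le]
  rcases eq_or_ne y 0 with rfl | hy
  · simp
  have := norm_pos_iff.2 hy
  field_simp

/-- The contraction vanishes at the reference point. -/
theorem contraction_self (b : Spinor → Twistor) {ξ : Spinor} : contraction ξ (fun z => b (affine z)) ξ = 0 := by
  have h : truncatedContraction ξ (fun z => b (affine z)) ξ = fun _ => 0 := by
    ext1 ε
    have : bracket ξ ξ = 0 := by simp [bracket]; ring
    simp [truncatedContraction, propagator, this]
  rw [contraction, h]
  exact tendsto_const_nhds.limUnder_eq

theorem hasFDerivAt_affine (z : ℂ) :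
    HasFDerivAt affine (ContinuousLinearMap.toSpanSingleton ℂ (![0, 1] : Spinor)) z := by
  have h1 : affine = fun z : ℂ => (![1, 0] : Spinor) + z • ![0, 1] := by
    ext1 z; ext i; fin_cases i <;> simp [affine]
  have h2 := ((hasDerivAt_id z).smul_const (![0, 1] : Spinor)).const_add ![1, 0]
  rw [one_smul] at h2
  rw [h1]
  exact h2.hasFDerivAt

/-- Compares the coordinate direction with the unitary frame. The component along the point itself
disappears later through homogeneity or horizontality. -/
theorem nsq_affine_smul (z : ℂ) : (nsq (affine z) : ℂ) • (![0, 1] : Spinor) =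
    quat (affine z) + star z • affine z := by
  rw [coe_nsq]
  ext i
  fin_cases i
  · simp
  · simp; ring

section FormSections

variable {b : Spinor → Twistor} (hb : IsSection 1 (-2) b)

include hb

theorem hasContraction_contraction {ξ : Spinor} (hξ : ξ ≠ 0) {σ : Spinor} (hσ : σ ≠ 0) :
    HasContraction ξ (fun z => b (affine z)) σ (contraction ξ (fun z => b (affine z)) σ) := by
  obtain ⟨c, c₀, c₁, h⟩ := exists_hasContraction hb hξ
  rw [(h σ hσ).contraction_eq]
  exact h σ hσ

/-- Smoothness is read off the explicit value, including at `σ = ξ`. Homogeneity is seen before the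
limit, since the propagator has degree one in `σ`. -/
theorem isSection_contraction {ξ : Spinor} (hξ : ξ ≠ 0) :
    IsSection 1 0 (contraction ξ (fun z => b (affine z))) := by
  obtain ⟨c, c₀, c₁, h⟩ := exists_hasContraction hb hξ
  constructor
  · have hn : ContDiff ℝ ∞ fun σ : Spinor => -(nsq σ : ℂ) := by
      unfold nsq
      have (i : Fin 2) : ContDiff ℝ ∞ fun σ : Spinor => ‖σ i‖ ^ 2 :=
        (contDiff_norm_sq ℝ).comp (contDiff_apply ℝ ℂ i)
      exact (Complex.ofRealCLM.contDiff.comp ((this 0).add (this 1))).neg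
    have hp (i : Fin 2) : ContDiff ℝ ∞ fun σ : Spinor => σ i := contDiff_apply ℝ ℂ i
    have hbr : ContDiff ℝ ∞ fun σ : Spinor => bracket ξ σ :=
      (contDiff_const.mul (hp 1)).sub (contDiff_const.mul (hp 0))
    refine ContDiffOn.congr (f := fun σ => (-2 * Complex.I) • (-(nsq σ : ℂ) • cauchyPart b σ +
      bracket ξ σ • c + (σ 0 • c₀ + σ 1 • c₁))) ?_ fun σ hσ => (h σ hσ).contraction_eq
    refine ContDiffOn.const_smul _ ((ContDiffOn.add ?_ ?_).add (ContDiffOn.add ?_ ?_))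
    · exact hn.contDiffOn.smul (contDiffOn_cauchyPart hb)
    · exact (hbr.smul contDiff_const).contDiffOn
    · exact ((hp 0).smul contDiff_const).contDiffOn
    · exact ((hp 1).smul contDiff_const).contDiffOn
  · intro σ hσ t ht
    have h1 : Tendsto (truncatedContraction ξ (fun z => b (affine z)) (t • σ)) (𝓝[>] 0)
        (𝓝 (t • contraction ξ (fun z => b (affine z)) σ)) := by
      have h2 : truncatedContraction ξ (fun z => b (affine z)) (t • σ) =
          fun ε => t • truncatedContraction ξ (fun z => b (affine z)) σ ε := by
        ext1 ε
        have h3 (z : ℂ) : propagator 1 ξ (affine z) (t • σ) =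
            t * propagator 1 ξ (affine z) σ := by
          simp only [propagator, bracket_smul_right, Nat.reduceAdd, div_pow, mul_pow]
          field_simp
        simp only [truncatedContraction, h3, mul_smul, integral_smul]
        rw [smul_comm t, smul_comm t]
      rw [h2]
      exact (hasContraction_contraction hb hξ hσ).2.const_smul t
    rw [zpow_one, zpow_zero, mul_one]
    exact h1.limUnder_eq

/-- The linear terms are holomorphic, and `∂̄ nsq` vanishes on `quat σ` by orthogonality, so only
the Cauchy part contributes: `(-2i)(-nsq σ)(-π)`. -/
theorem delBar_contraction_quat {ξ : Spinor} (hξ : ξ ≠ 0) {σ : Spinor} (hσ : σ ≠ 0) :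
    delBar (contraction ξ (fun z => b (affine z))) σ (quat σ) =
      (-2 * Real.pi * Complex.I * nsq σ) • b σ := by
  obtain ⟨c, c₀, c₁, h⟩ := exists_hasContraction hb hξ
  have he : contraction ξ (fun z => b (affine z)) =ᶠ[𝓝 σ] fun σ => (-2 * Complex.I) •
      (-(nsq σ : ℂ) • cauchyPart b σ + (bracket ξ σ • c + (σ 0 • c₀ + σ 1 • c₁))) := by
    filter_upwards [isOpen_compl_singleton.mem_nhds hσ] with τ hτ
    rw [(h τ hτ).contraction_eq, add_assoc]
  let p (i : Fin 2) : Spinor →L[ℂ] ℂ := ContinuousLinearMap.proj i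
  let ℓ : Spinor →L[ℂ] Twistor := (ξ 0 • p 1 - ξ 1 • p 0).smulRight c +
    ((p 0).smulRight c₀ + (p 1).smulRight c₁)
  have hℓ : (fun σ : Spinor => bracket ξ σ • c + (σ 0 • c₀ + σ 1 • c₁)) = ℓ := by
    ext1 τ; rfl
  have hℓd : HasFDerivAt (fun σ : Spinor => bracket ξ σ • c + (σ 0 • c₀ + σ 1 • c₁)) ℓ σ := by
    rw [hℓ]; exact ℓ.hasFDerivAt
  have hΦ : DifferentiableAt ℝ (cauchyPart b) σ :=
    (contDiffOn_cauchyPart hb).differentiableAt_of_isOpen isOpen_compl_singleton hσ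
  let P (i : Fin 2) : Spinor →L[ℝ] ℂ := (p i).restrictScalars ℝ
  let Q (i : Fin 2) : Spinor →L[ℝ] ℂ := (Complex.conjCLE : ℂ →L[ℝ] ℂ).comp (P i)
  have hn : HasFDerivAt (fun σ : Spinor => -(nsq σ : ℂ))
      (-((σ 0 • Q 0 + star (σ 0) • P 0) + (σ 1 • Q 1 + star (σ 1) • P 1))) σ := by
    simp only [coe_nsq]
    exact (((P 0).hasFDerivAt.mul (Q 0).hasFDerivAt).add
      ((P 1).hasFDerivAt.mul (Q 1).hasFDerivAt)).neg
  have hnb : delBar (fun σ : Spinor => -(nsq σ : ℂ)) σ (quat σ) = 0 := by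
    rw [delBar, hn.fderiv]
    simp [P, Q, p]
    linear_combination (-(1 / 2 : ℂ)) * (-(σ 0 * σ 1) + σ 1 * σ 0) * Complex.I_mul_I
  have hd1 : DifferentiableAt ℝ (fun σ => -(nsq σ : ℂ) • cauchyPart b σ) σ :=
    hn.differentiableAt.smul hΦ
  have hd2 : DifferentiableAt ℝ
      (fun σ : Spinor => bracket ξ σ • c + (σ 0 • c₀ + σ 1 • c₁)) σ :=
    (hℓd.restrictScalars ℝ).differentiableAt
  rw [delBar_congr he]
  have h1 := delBar_clm_comp ((-2 * Complex.I) • ContinuousLinearMap.id ℂ Twistor)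
    (hd1.fun_add hd2) (quat σ)
  simp only [smul_apply, ContinuousLinearMap.id_apply] at h1
  rw [h1, delBar_fun_add hd1 hd2, delBar_eq_zero_of_hasFDerivAt hℓd,
    delBar_fun_smul hn.differentiableAt hΦ, hnb, delBar_cauchyPart hb hσ, smul_smul]
  module

/-- The contraction solves the `∂̄`-equation. -/
theorem delBar_contraction_affine {ξ : Spinor} (hξ : ξ ≠ 0) (z : ℂ) :
    delBar (fun z => contraction ξ (fun z => b (affine z)) (affine z)) z 1 =
      (-2 * Real.pi * Complex.I) • b (affine z) := by
  have hs := isSection_contraction hb hξ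
  have h0 := affine_ne_zero z
  rw [delBar_comp (hs.differentiableAt h0) (hasFDerivAt_affine z)]
  have h1 : ContinuousLinearMap.toSpanSingleton ℂ (![0, 1] : Spinor) 1 =
      (nsq (affine z) : ℂ)⁻¹ • (quat (affine z) + star z • affine z) := by
    have hn := nsq_coe_ne_zero h0
    rw [eq_inv_smul_iff₀ hn, ContinuousLinearMap.toSpanSingleton_apply, one_smul,
      nsq_affine_smul]
  -- Antiholomorphic degree zero removes the component along the point.
  have h2 := delBar_self_of_isHomogeneousOn hs.homogeneous h0 (hs.differentiableAt h0)
  rw [h1, delBar_smul, delBar_add, delBar_smul, h2, delBar_contraction_quat hb hξ h0]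
  have hn := nsq_coe_ne_zero h0
  simp only [Int.cast_zero, zero_smul, smul_zero, add_zero, smul_smul]
  congr 1
  rw [star_inv₀, Complex.star_def, Complex.conj_ofReal]
  field_simp

theorem truncatedContraction_chart {ξ : Spinor} (hξ : ξ ≠ 0) (η : ℂ) (ε : ℝ) :
    (IntegrableOn (fun z => propagator 1 ξ (affine z) (chart ξ η) • b (affine z)) (awayFrom ξ ε) ↔
      IntegrableOn (fun w => centredPropagator η w • b (chart ξ w)) (outside ε)) ∧
    truncatedContraction ξ (fun z => b (affine z)) (chart ξ η) ε =
      (-2 * Complex.I * nsq ξ) • ∫ w in outside ε, centredPropagator η w • b (chart ξ w) := by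
  have hn := nsq_coe_ne_zero hξ
  have hG : ∀ τ : Spinor, τ ≠ 0 → ∀ t : ℂ, t ≠ 0 →
      propagator 1 ξ (t • τ) (chart ξ η) • b (t • τ) =
      (‖t‖ ^ 4)⁻¹ • propagator 1 ξ τ (chart ξ η) • b τ := by
    intro τ hτ t ht
    have hs : star t ≠ 0 := star_ne_zero.2 ht
    rw [hb.homogeneous τ hτ t ht, ← Complex.coe_smul, norm_pow_four, smul_smul, smul_smul,
      zpow_one_neg_two t, propagator, propagator, bracket_smul_right, bracket_smul_left]
    congr 1
    simp only [Nat.reduceAdd, div_pow, mul_pow]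
    field_simp
  obtain ⟨h1, h2⟩ := integral_awayFrom_eq
    (G := fun τ => propagator 1 ξ τ (chart ξ η) • b τ) hG hξ ε
  simp only [propagator_chart hξ, mul_smul] at h1 h2
  constructor
  · rw [h1]
    exact integrable_smul_iff (inv_ne_zero hn) _
  · rw [truncatedContraction, h2, integral_smul, ← Complex.coe_smul]
    simp only [smul_smul]
    congr 1
    push_cast
    field_simp

/-- The holomorphic derivative of the contraction vanishes at the reference point. -/
theorem del_contraction_self {ξ : Spinor} (hξ : ξ ≠ 0) (v : Spinor) :
    del (contraction ξ (fun z => b (affine z))) ξ v = 0 := by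
  set X := contraction ξ (fun z => b (affine z)) with hX
  have hs : IsSection 1 0 X := isSection_contraction hb hξ
  have hd := hs.differentiableAt hξ
  have hXξ : X ξ = 0 := contraction_self b
  have hn := nsq_coe_ne_zero hξ
  obtain ⟨C, hC0, hC, -⟩ := exists_bound_chart hb hξ
  obtain ⟨K, hK0, hK⟩ := exists_lipschitz_chart hb hξ
  have hBc := continuous_section_chart hb hξ
  set B : ℂ → Twistor := fun w => b (chart ξ w) with hB
  -- The failure of the field to be invariant under rotation by `i` about `ξ`. It vanishes at `w =
  -- 0`, which is the source of the extra smallness.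
  set D : ℂ → ℝ := fun w => ‖B (Complex.I * w) - B w‖ with hD
  have hDc : Continuous D := ((hBc.comp (continuous_const.mul continuous_id)).sub hBc).norm
  have hDM (w : ℂ) : D w ≤ (2 * K + 2 * C) * min ‖w‖ 1 := by
    have h1 : D w ≤ 2 * K * ‖w‖ := by
      refine (hK _ _).trans ?_
      have : ‖Complex.I * w - w‖ ≤ 2 * ‖w‖ := by
        refine (norm_sub_le _ _).trans ?_
        rw [norm_mul, Complex.norm_I]; linarith
      nlinarith
    have h2 : D w ≤ 2 * C := by
      refine (norm_sub_le _ _).trans ?_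
      linarith [hC (Complex.I * w), hC w]
    rcases le_total ‖w‖ 1 with h | h
    · rw [min_eq_left h]; nlinarith [norm_nonneg w]
    · rw [min_eq_right h]; linarith
  set M := 2 * K + 2 * C with hM
  have hM0 : 0 ≤ M := by positivity
  have hbd : Integrable fun y : ℂ => M * (9 * (radialBound ‖y‖ + radialBound ‖1 - y‖)) :=
    ((integrable_radialBound.add integrable_radialBound_sub).const_mul 9).const_mul M
  have hae : ∀ᵐ y : ℂ, y ≠ 0 ∧ y ≠ 1 := by
    refine Filter.Eventually.and ?_ ?_ <;> simp [ae_iff]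
  have hle (r : ℝ) (hr0 : 0 ≤ r) (hr1 : r ≤ 1) : ∀ᵐ y : ℂ,
      ‖D (r * y) * (‖y‖ ^ 2 * ‖1 - y‖)⁻¹‖ ≤
        M * (9 * (radialBound ‖y‖ + radialBound ‖1 - y‖)) := by
    filter_upwards [hae] with y hy
    have hy0 := norm_pos_iff.2 hy.1
    have hy1 : 0 < ‖1 - y‖ := norm_pos_iff.2 (sub_ne_zero.2 hy.2.symm)
    rw [Real.norm_of_nonneg (mul_nonneg (norm_nonneg _) (by positivity))]
    calc D (r * y) * (‖y‖ ^ 2 * ‖1 - y‖)⁻¹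
        ≤ (M * min ‖y‖ 1) * (‖y‖ ^ 2 * ‖1 - y‖)⁻¹ := by
          gcongr
          refine (hDM _).trans ?_
          gcongr
          rw [norm_mul, Complex.norm_real, Real.norm_of_nonneg hr0]
          exact mul_le_of_le_one_left hy0.le hr1
      _ = M * (min ‖y‖ 1 * (‖y‖ ^ 2 * ‖1 - y‖)⁻¹) := by ring
      _ ≤ _ := by
          refine mul_le_mul_of_nonneg_left (norm_bound_two_poles hy0 hy1 ?_) hM0
          have := norm_add_le y (1 - y)
          simpa using this
  have hmeas (r : ℝ) :
      AEStronglyMeasurable fun y : ℂ => D (r * y) * (‖y‖ ^ 2 * ‖1 - y‖)⁻¹ := by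
    refine Measurable.aestronglyMeasurable ?_
    exact (hDc.comp (continuous_const.mul continuous_id)).measurable.mul (by fun_prop)
  set J : ℝ → ℝ := fun r => ∫ y : ℂ, D (r * y) * (‖y‖ ^ 2 * ‖1 - y‖)⁻¹ with hJ
  have hJ0 : Tendsto J (𝓝[>] 0) (𝓝 0) := by
    have h1 : Tendsto J (𝓝[>] 0) (𝓝 (∫ _ : ℂ, (0 : ℝ))) := ?_
    · simpa using h1
    refine tendsto_integral_filter_of_dominated_convergence _ (Eventually.of_forall hmeas) ?_ hbd
      (ae_of_all _ fun y => ?_)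
    · filter_upwards [self_mem_nhdsWithin, mem_nhdsWithin_of_mem_nhds (Iio_mem_nhds one_pos)]
        with r hr0 hr1
      exact hle r (Set.mem_Ioi.1 hr0).le (Set.mem_Iio.1 hr1).le
    · have h2 : Continuous fun r : ℝ => D (r * y) * (‖y‖ ^ 2 * ‖1 - y‖)⁻¹ :=
        (hDc.comp (Complex.continuous_ofReal.mul continuous_const)).mul continuous_const
      have h3 := (h2.tendsto 0).mono_left (nhdsWithin_le_nhds (s := Set.Ioi 0))
      simpa [hD] using h3
  -- the estimate of the symmetrized field
  have hest (r : ℝ) (hr0 : 0 < r) (hr1 : r ≤ 1) :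
      ‖X (chart ξ (Complex.I * r)) + Complex.I • X (chart ξ r)‖ ≤ r * (2 * nsq ξ * J r) := by
    have hc (η : ℂ) := hasContraction_contraction hb hξ (chart_ne_zero hξ η)
    have hi : Integrable fun w => ‖centredPropagator r w‖ * D w := by
      have h1 : Integrable fun y : ℂ => ‖centredPropagator r (r • y)‖ * D (r • y) := by
        refine ((hbd.mono' (hmeas r) (hle r hr0.le hr1)).const_mul r⁻¹).congr
          (ae_of_all _ fun y => ?_)
        simp only [Complex.real_smul, norm_centredPropagator hr0]
        ring
      exact (integrable_comp_smul_iff volume (fun w => ‖centredPropagator r w‖ * D w) hr0.ne').1 h1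
    have hiv : ∫ w, ‖centredPropagator r w‖ * D w = r * J r := by
      have h1 := Measure.integral_comp_smul volume (fun w : ℂ => ‖centredPropagator r w‖ * D w) r
      rw [Complex.finrank_real_complex, abs_of_pos (by positivity), smul_eq_mul] at h1
      have h2 : ∫ y : ℂ, ‖centredPropagator r (r • y)‖ * D (r • y) = r⁻¹ * J r := by
        rw [hJ, ← integral_const_mul]
        refine integral_congr_ae (ae_of_all _ fun y => ?_)
        simp only [Complex.real_smul, norm_centredPropagator hr0]
        ring
      rw [h2] at h1
      field_simp at h1
      linarith
    have hb1 (ε : ℝ) (hε : 0 < ε) :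
        ‖truncatedContraction ξ (fun z => b (affine z)) (chart ξ (Complex.I * r)) ε +
        Complex.I • truncatedContraction ξ (fun z => b (affine z)) (chart ξ r) ε‖ ≤
        r * (2 * nsq ξ * J r) := by
      obtain ⟨hi1, he1⟩ := truncatedContraction_chart hb hξ (Complex.I * r) ε
      obtain ⟨hi2, he2⟩ := truncatedContraction_chart hb hξ r ε
      have hi1' := integrableOn_comp_I_mul_outside (hi1.1 ((hc _).1 ε hε))
      have hi2' := hi2.1 ((hc _).1 ε hε)
      -- The propagator has degree `-1` under a joint rotation, so in the sum of the two
      -- contractions a rotation-invariant field would cancel completely and only `B (i w) - B w`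
      -- survives.
      have hq (w : ℂ) : centredPropagator (Complex.I * r) (Complex.I * w) =
          -Complex.I * centredPropagator r w := by
        rw [centredPropagator, centredPropagator, ← mul_sub, mul_div_mul_left _ _ Complex.I_ne_zero,
          div_mul_eq_div_div, div_right_comm, Complex.div_I, mul_comm, neg_mul]
      rw [he1, he2, ← integral_comp_I_mul_outside, smul_comm Complex.I, ← smul_add,
        ← integral_smul, ← integral_add hi1' (hi2'.fun_smul Complex.I)]
      have h3 (w : ℂ) : centredPropagator (Complex.I * r) (Complex.I * w) •
          b (chart ξ (Complex.I * w)) + Complex.I • centredPropagator r w • b (chart ξ w) =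
          (-Complex.I * centredPropagator r w) • (B (Complex.I * w) - B w) := by
        rw [hq]; module
      simp only [h3]
      rw [norm_smul]
      have h4 : ‖(-2 * Complex.I * nsq ξ : ℂ)‖ = 2 * nsq ξ := by
        simp [abs_of_nonneg (nsq_nonneg ξ)]
      rw [h4, mul_left_comm]
      refine mul_le_mul_of_nonneg_left ?_ (by have := nsq_nonneg ξ; positivity)
      rw [← hiv]
      refine (norm_integral_le_integral_norm _).trans ?_
      have h5 (w : ℂ) : ‖(-Complex.I * centredPropagator r w) • (B (Complex.I * w) - B w)‖ =
          ‖centredPropagator r w‖ * D w := by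
        rw [norm_smul, norm_mul, norm_neg, Complex.norm_I, one_mul]
      simp only [h5]
      exact setIntegral_le_integral hi (ae_of_all _ fun w => by positivity)
    refine le_of_tendsto (((hc _).2.add ((hc _).2.const_smul Complex.I)).norm) ?_
    filter_upwards [self_mem_nhdsWithin] with ε hε using hb1 ε hε
  -- comparison with the derivative
  have hderiv : HasDerivAt (fun r : ℝ => X (chart ξ (Complex.I * r)) + Complex.I • X (chart ξ r))
      (fderiv ℝ X ξ (Complex.I • quat ξ) + Complex.I • fderiv ℝ X ξ (quat ξ)) 0 := by
    have h1 (c : ℂ) : HasDerivAt (fun r : ℝ => X (chart ξ (c * r)))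
        (fderiv ℝ X ξ (c • quat ξ)) 0 := by
      have h2 : HasDerivAt (fun r : ℝ => chart ξ (c * r)) (c • quat ξ) 0 := by
        have h3 : HasDerivAt (fun r : ℝ => c * (r : ℂ)) c 0 := by
          simpa using (Complex.ofRealCLM.hasDerivAt (x := (0 : ℝ))).const_mul c
        exact (h3.smul_const (quat ξ)).const_add ξ
      have h5 : HasFDerivAt X (fderiv ℝ X ξ) (chart ξ (c * ((0 : ℝ) : ℂ))) := by
        simpa [chart_zero] using hd.hasFDerivAt
      exact h5.comp_hasDerivAt (0 : ℝ) h2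
    have h4 := h1 1
    simp only [one_mul, one_smul] at h4
    exact (h1 Complex.I).add (h4.const_smul Complex.I)
  -- The difference quotient is bounded by a multiple of `J r`, which tends to zero.
  have hzero : fderiv ℝ X ξ (Complex.I • quat ξ) + Complex.I • fderiv ℝ X ξ (quat ξ) = 0 := by
    have h1 := (hasDerivAt_iff_tendsto_slope.1 hderiv).mono_left
      (nhdsWithin_mono 0 (fun r (hr : r ∈ Set.Ioi (0 : ℝ)) => (Set.mem_Ioi.1 hr).ne'))
    refine tendsto_nhds_unique h1 ?_
    have h2 : Tendsto (fun r => 2 * nsq ξ * J r) (𝓝[>] 0) (𝓝 0) := by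
      simpa using hJ0.const_mul (2 * nsq ξ)
    refine squeeze_zero_norm' ?_ h2
    filter_upwards [self_mem_nhdsWithin, mem_nhdsWithin_of_mem_nhds (Iio_mem_nhds one_pos)]
      with r hr0 hr1
    have hr0' := Set.mem_Ioi.1 hr0
    have h3 := hest r hr0' (Set.mem_Iio.1 hr1).le
    rw [slope_def_module, sub_zero]
    simp only [Complex.ofReal_zero, mul_zero, chart_zero, hXξ, smul_zero, add_zero, sub_zero]
    rw [norm_smul, norm_inv, Real.norm_of_nonneg hr0'.le, inv_mul_le_iff₀ hr0']
    exact h3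
  -- In the combination `X'(i v) + i X'(v)` the antiholomorphic parts cancel and the holomorphic
  -- ones add up to `2i ∂_v X`.
  have hquat : del X ξ (quat ξ) = 0 := by
    rw [fderiv_I_smul_eq, fderiv_eq_del_add_delBar] at hzero
    have : (2 * Complex.I) • del X ξ (quat ξ) = 0 := by rw [← hzero]; module
    exact (smul_eq_zero.1 this).resolve_left (by simp)
  have hself : del X ξ ξ = 0 := by
    rw [del_self_of_isHomogeneousOn hs.homogeneous hξ hd, hXξ, smul_zero]
  have h1 := congrArg (del X ξ) (nsq_smul_eq ξ v)
  rw [del_smul, del_add, del_smul, del_smul, hself, hquat, smul_zero, smul_zero, add_zero] at h1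
  exact (smul_eq_zero.1 h1).resolve_left hn

end FormSections

/-! ### Wave functions on the line -/

/-- The line through `U` as a linear map. -/
def lineL (U : Fin 2 → Twistor) : Spinor →L[ℂ] Twistor :=
  (ContinuousLinearMap.proj (R := ℂ) (φ := fun _ : Fin 2 => ℂ) 0).smulRight (U 0) +
    (ContinuousLinearMap.proj (R := ℂ) (φ := fun _ : Fin 2 => ℂ) 1).smulRight (U 1)

theorem coe_lineL (U : Fin 2 → Twistor) : ⇑(lineL U) = line U := rfl

theorem line_add (U : Fin 2 → Twistor) (v w : Spinor) : line U (v + w) = line U v + line U w :=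
  (lineL U).map_add v w

theorem line_smul (U : Fin 2 → Twistor) (t : ℂ) (v : Spinor) : line U (t • v) = t • line U v :=
  (lineL U).map_smul t v

theorem hasFDerivAt_line (U : Fin 2 → Twistor) (σ : Spinor) :
    HasFDerivAt (line U) (lineL U) σ := (lineL U).hasFDerivAt

theorem contDiff_line (U : Fin 2 → Twistor) : ContDiff ℝ ∞ (line U) :=
  ((lineL U).restrictScalars ℝ).contDiff

theorem del_line (U : Fin 2 → Twistor) (σ v : Spinor) : del (line U) σ v = line U v :=
  del_eq_of_hasFDerivAt (hasFDerivAt_line U σ) v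

section Wavefunction

variable {W : Set Twistor} {w : ℤ} {h : Twistor → Twistor}

theorem IsWavefunction.isHomogeneousOn (hh : IsWavefunction W w h) :
    IsHomogeneousOn w (-1) h W := by
  intro Z hZ t ht
  have hs : star t ≠ 0 := star_ne_zero.2 ht
  rw [mul_comm, mul_smul, ← hh.homogeneous Z hZ t ht, smul_smul, zpow_neg_one, inv_mul_cancel₀ hs,
    one_smul]

theorem del_star_apply (α : Fin 4) (Z v : Twistor) :
    del (fun Z : Twistor => star (Z α)) Z v = 0 := by
  let P : Twistor →L[ℝ] ℂ :=
    (Complex.conjCLE : ℂ →L[ℝ] ℂ).comp (ContinuousLinearMap.proj (R := ℝ) (φ := fun _ => ℂ) α)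
  have hP : HasFDerivAt (fun Z : Twistor => star (Z α)) P Z := P.hasFDerivAt
  rw [del, hP.fderiv]
  have (u : Twistor) : P u = (starRingEnd ℂ) (u α) := rfl
  simp only [this, Pi.smul_apply, smul_eq_mul, map_mul, Complex.conj_I]
  linear_combination (1 / 2 : ℂ) * (starRingEnd ℂ) (v α) * Complex.I_mul_I

/-- The conjugate coordinates are constants for `(1,0)`-derivatives, so horizontality is inherited
by every derivative of the wave function. -/
theorem IsWavefunction.iterDel_horizontal (hW : IsTwistorDomain W) (hh : IsWavefunction W w h)
    (vs : List Twistor) {Z : Twistor} (hZ : Z ∈ W) :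
    ∑ α, star (Z α) * iterDel h vs Z α = 0 := by
  induction vs generalizing Z with
  | nil => exact hh.horizontal Z hZ
  | cons v vs ih =>
    have hd : DifferentiableAt ℝ (iterDel h vs) Z :=
      (contDiffOn_iterDel hW.isOpen hh.smooth vs).differentiableAt_of_isOpen hW.isOpen hZ
    have hp (α : Fin 4) : DifferentiableAt ℝ (fun Z => iterDel h vs Z α) Z :=
      differentiableAt_pi.1 hd α
    have hs (α : Fin 4) : DifferentiableAt ℝ (fun Z : Twistor => star (Z α)) Z :=
      (differentiableAt_apply (𝕜 := ℝ) α Z).star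
    have h0 : del (fun Z => ∑ α, star (Z α) • iterDel h vs Z α) Z v = 0 := by
      have : (fun Z => ∑ α, star (Z α) • iterDel h vs Z α) =ᶠ[𝓝 Z] fun _ => (0 : ℂ) := by
        filter_upwards [hW.isOpen.mem_nhds hZ] with Y hY using ih hY
      rw [del_congr this, del_const]
    rw [del_fun_sum _ fun α _ => (hs α).fun_smul (hp α)] at h0
    rw [← h0]
    refine Finset.sum_congr rfl fun α _ => ?_
    rw [del_fun_smul (hs α) (hp α), del_star_apply, zero_smul, zero_add, smul_eq_mul]
    congr 1
    exact (del_clm_comp (ContinuousLinearMap.proj (R := ℂ) (φ := fun _ : Fin 4 => ℂ) α) hd v).symm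

/-- The `(0,1)`-form `g`, pulled back to the line at `σ` and evaluated on `v`. -/
def pullback (U : Fin 2 → Twistor) (g : Twistor → Twistor) (σ v : Spinor) : ℂ :=
  ∑ α, g (line U σ) α * star (line U v α)

variable {U : Fin 2 → Twistor}

theorem pullback_add_right (g : Twistor → Twistor) (σ v v' : Spinor) :
    pullback U g σ (v + v') = pullback U g σ v + pullback U g σ v' := by
  simp only [pullback, line_add, Pi.add_apply, star_add, mul_add, Finset.sum_add_distrib]

theorem pullback_smul_right (g : Twistor → Twistor) (σ v : Spinor) (t : ℂ) :
    pullback U g σ (t • v) = star t * pullback U g σ v := by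
  simp only [pullback, line_smul, Pi.smul_apply, smul_eq_mul, star_mul', Finset.mul_sum]
  exact Finset.sum_congr rfl fun α _ => by ring

theorem pullback_iterDel_self (hW : IsTwistorDomain W) (hU : ∀ σ : Spinor, σ ≠ 0 → line U σ ∈ W)
    (hh : IsWavefunction W w h) (vs : List Twistor) {σ : Spinor} (hσ : σ ≠ 0) :
    pullback U (iterDel h vs) σ σ = 0 := by
  rw [← hh.iterDel_horizontal hW vs (hU σ hσ)]
  exact Finset.sum_congr rfl fun α _ => mul_comm _ _

theorem nsq_coe_affine_ne_zero (z : ℂ) : (nsq (affine z) : ℂ) ≠ 0 :=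
  nsq_coe_ne_zero (affine_ne_zero z)

/-- By horizontality only the component along `quat σ` counts. This replaces the coefficient of
`dz̄` by an expression that makes sense at every spinor and is homogeneous. -/
theorem pullback_affine (hW : IsTwistorDomain W) (hU : ∀ σ : Spinor, σ ≠ 0 → line U σ ∈ W)
    (hh : IsWavefunction W w h) (vs : List Twistor) (z : ℂ) :
    pullback U (iterDel h vs) (affine z) ![0, 1] =
      (nsq (affine z) : ℂ)⁻¹ * pullback U (iterDel h vs) (affine z) (quat (affine z)) := by
  have h1 := congrArg (pullback U (iterDel h vs) (affine z)) (nsq_affine_smul z)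
  rw [pullback_add_right, pullback_smul_right, pullback_smul_right,
    pullback_iterDel_self hW hU hh vs (affine_ne_zero z), mul_zero, add_zero, Complex.star_def,
    Complex.conj_ofReal] at h1
  rw [← h1, inv_mul_cancel_left₀ (nsq_coe_affine_ne_zero z)]

/-- The field of an Einstein vertex operator whose wave function is contracted with the fields in
a list, as a section over the line. -/
def vertexSection (Λ : ℂ) (U : Fin 2 → Twistor) (h : Twistor → Twistor)
    (L : List (Spinor → Twistor)) (σ : Spinor) : Twistor :=
  fun i => ∑ j, infinityUpper Λ i j * ((nsq σ : ℂ)⁻¹ *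
    pullback U (iterDel h (Pi.single j 1 :: L.map fun X => X σ)) σ (quat σ))

theorem contDiffOn_inv_nsq : ContDiffOn ℝ ∞ (fun σ : Spinor => (nsq σ : ℂ)⁻¹) {0}ᶜ := by
  refine ContDiffOn.inv ?_ fun σ hσ => nsq_coe_ne_zero hσ
  have (i : Fin 2) : ContDiff ℝ ∞ fun σ : Spinor => ‖σ i‖ ^ 2 :=
    (contDiff_norm_sq ℝ).comp (contDiff_apply ℝ ℂ i)
  exact (Complex.ofRealCLM.contDiff.comp ((this 0).add (this 1))).contDiffOn

/-- With `n` incoming fields, the holomorphic degree of the derivative is `2 - (n + 1)`, and the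
fields restore `n`. The evaluation on `quat σ` contributes `t`, and the factor `1 / nsq` contributes
`(t * star t)⁻¹`; with antiholomorphic degree `-1` from `h` the total is `(1,-2)`, for any `n`. -/
theorem isSection_vertexSection (hW : IsTwistorDomain W)
    (hU : ∀ σ : Spinor, σ ≠ 0 → line U σ ∈ W) (hh : IsWavefunction W 2 h) (Λ : ℂ)
    (L : List (Spinor → Twistor)) (hL : ∀ X ∈ L, IsSection 1 0 X) :
    IsSection 1 (-2) (vertexSection Λ U h L) := by
  constructor
  · refine contDiffOn_pi.2 fun i => ContDiffOn.sum fun j _ => contDiffOn_const.mul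
      (contDiffOn_inv_nsq.mul (ContDiffOn.sum fun α _ => ContDiffOn.mul ?_ ?_))
    · have h1 := contDiffOn_iterDel_map hW.isOpen hh.smooth (Ω := ({0}ᶜ : Set Spinor))
        (contDiff_line U).contDiffOn hU ((fun _ => Pi.single j 1) :: L) (by
          intro X hX
          rcases List.mem_cons.1 hX with rfl | hX
          · exact contDiffOn_const
          · exact (hL X hX).smooth)
      exact contDiffOn_pi.1 h1 α
    · have h1 : ContDiff ℝ ∞ fun σ : Spinor => line U (quat σ) :=
        (contDiff_line U).comp quatL.contDiff
      exact ((Complex.conjCLE : ℂ →L[ℝ] ℂ).contDiff.comp (contDiff_pi.1 h1 α)).contDiffOn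
  · intro σ hσ t ht
    have hs : star t ≠ 0 := star_ne_zero.2 ht
    have hLt : (L.map fun X => X (t • σ)) = (L.map fun X => X σ).map (t • ·) := by
      rw [List.map_map]
      refine List.map_congr_left fun X hX => ?_
      simpa using (hL X hX).homogeneous σ hσ t ht
    have hσW := hU σ hσ
    have key (j : Fin 4) :
        pullback U (iterDel h (Pi.single j 1 :: L.map fun X => X (t • σ))) (t • σ) (quat (t • σ)) =
        (t ^ 2 * (star t)⁻¹) *
          pullback U (iterDel h (Pi.single j 1 :: L.map fun X => X σ)) σ (quat σ) := by
      have h1 : iterDel h (Pi.single j 1 :: L.map fun X => X (t • σ)) (line U (t • σ)) =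
          (t * (star t)⁻¹) •
            iterDel h (Pi.single j 1 :: L.map fun X => X σ) (line U σ) := by
        rw [hLt, line_smul, iterDel_cons' hW.isOpen hh.smooth _ _ (hW.smul_mem _ hσW t ht),
          iterDel_map_smul hW.isOpen t _ (contDiffOn_del hW.isOpen hh.smooth _)
            (hW.smul_mem _ hσW t ht), ← iterDel_cons' hW.isOpen hh.smooth _ _
            (hW.smul_mem _ hσW t ht), iterDel_homogeneous hW.isOpen hW.smul_mem hh.smooth
            hh.isHomogeneousOn _ _ hσW t ht, smul_smul, zpow_neg_one, ← mul_assoc]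
        congr 2
        rw [← zpow_natCast, ← zpow_add₀ ht]
        have : ((L.map fun X => X σ).length : ℤ) + (2 - ((Pi.single j (1 : ℂ) ::
            L.map fun X => X σ : List Twistor).length : ℤ)) = 1 := by
          simp only [List.length_cons, List.length_map]; push_cast; ring
        rw [this, zpow_one]
      rw [quat_smul, pullback_smul_right]
      simp only [pullback, h1, Pi.smul_apply, smul_eq_mul, star_star, Finset.mul_sum]
      exact Finset.sum_congr rfl fun α _ => by ring
    ext i
    simp only [vertexSection, key, Pi.smul_apply, smul_eq_mul, Finset.mul_sum]
    refine Finset.sum_congr rfl fun j _ => ?_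
    have hn : (nsq (t • σ) : ℂ) = t * star t * nsq σ := by
      rw [coe_nsq, coe_nsq]
      simp only [Pi.smul_apply, smul_eq_mul, star_mul']
      ring
    have h0 := nsq_coe_ne_zero hσ
    rw [hn]
    simp only [zpow_neg, zpow_ofNat]
    field_simp

theorem vertexSection_affine (hW : IsTwistorDomain W)
    (hU : ∀ σ : Spinor, σ ≠ 0 → line U σ ∈ W) (hh : IsWavefunction W w h) (Λ : ℂ)
    (L : List (Spinor → Twistor)) (z : ℂ) :
    vertexSection Λ U h L (affine z) =
      einsteinField Λ U (iterDel h (L.map fun X => X (affine z))) z := by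
  ext i
  refine Finset.sum_congr rfl fun j _ => ?_
  rw [← pullback_affine hW hU hh]
  simp [pullback, iterDel, line]

/-! ### Contractions with the infinity twistor -/

/-- The two infinity twistors multiply to `Λ`, so the contact form turns its other argument into a
further derivative direction of `h`. The sign comes from the antisymmetry of `I^{IJ}`. -/
theorem contactForm_vertexSection_left (hW : IsTwistorDomain W)
    (hU : ∀ σ : Spinor, σ ≠ 0 → line U σ ∈ W) (hh : IsWavefunction W w h) (Λ : ℂ)
    (L : List (Spinor → Twistor)) (z : ℂ) (V : Twistor) :
    contactForm Λ (vertexSection Λ U h L (affine z)) V =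
      -Λ * pullback U (iterDel h (V :: L.map fun X => X (affine z))) (affine z) ![0, 1] := by
  have h1 := iterDel_cons_eq_sum hW.isOpen hh.smooth V (L.map fun X => X (affine z))
    (hU _ (affine_ne_zero z))
  have h2 : pullback U (iterDel h (V :: L.map fun X => X (affine z))) (affine z) ![0, 1] =
      ∑ j, V j * pullback U (iterDel h (Pi.single j 1 :: L.map fun X => X (affine z)))
        (affine z) ![0, 1] := by
    simp only [pullback, h1, Finset.sum_apply, Pi.smul_apply, smul_eq_mul, Finset.sum_mul,
      Finset.mul_sum]
    rw [Finset.sum_comm]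
    refine Finset.sum_congr rfl fun j _ => Finset.sum_congr rfl fun α _ => ?_
    rw [iterDel_cons' hW.isOpen hh.smooth _ _ (hU _ (affine_ne_zero z))]
    ring
  rw [h2]
  simp only [pullback_affine hW hU hh, contactForm, vertexSection, Fin.sum_univ_four,
    infinityLower, infinityUpper]
  simp
  ring

theorem contactForm_swap (Λ : ℂ) (X Y : Twistor) : contactForm Λ X Y = -contactForm Λ Y X := by
  simp [contactForm, Fin.sum_univ_four, infinityLower]
  ring

end Wavefunction

/-! ### Diagrams without cycles -/

namespace Diagram

variable {m : ℕ} {p : Diagram m}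

/-- The edge that leaves `c` ends at the white vertex `i`. -/
def Above (p : Diagram m) (i c : Fin m) : Prop := p c = Sum.inl i

/-- Every white vertex has a single outgoing edge, so one finite path to a black vertex already
shows that the descent from `i` terminates. -/
theorem Reaches.acc {j : Fin 2} {i : Fin m} (h : p.Reaches j i) : Acc p.Above i := by
  induction h with
  | black i s hi => exact ⟨i, fun y hy => by simp [Above, hi] at hy⟩
  | white i k hi _ ih =>
    refine ⟨i, fun y hy => ?_⟩
    obtain rfl : k = y := by simpa [Above, hi] using hy
    exact ih

theorem IsForest.wellFounded (hp : p.IsForest) : WellFounded p.Above :=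
  ⟨fun i => (hp.2 i).choose_spec.acc⟩

open Classical in
/-- The white vertices upstream of `i`, including `i`. -/
def upstream (p : Diagram m) (i : Fin m) : Finset (Fin m) :=
  {c | Relation.ReflTransGen p.Above i c}

/-- Whatever is upstream of `c` is upstream of `i`, but `i` itself is not upstream of `c`, as that
would close a cycle. -/
theorem IsForest.card_upstream_lt (hp : p.IsForest) {i c : Fin m} (h : p c = Sum.inl i) :
    (p.upstream c).card < (p.upstream i).card := by
  refine Finset.card_lt_card ((Finset.ssubset_iff_of_subset ?_).2 ⟨i, ?_, ?_⟩)
  · intro x hx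
    simp only [upstream, Finset.mem_filter_univ] at hx ⊢
    exact Relation.ReflTransGen.head h hx
  · simp [upstream, Relation.ReflTransGen.refl]
  · simp only [upstream, Finset.mem_filter_univ]
    intro hx
    exact hp.wellFounded.transGen.irrefl.irrefl i (Relation.TransGen.head' h hx)

theorem card_upstream_pos (i : Fin m) : 0 < (p.upstream i).card :=
  Finset.card_pos.2 ⟨i, by simp [upstream, Relation.ReflTransGen.refl]⟩

theorem card_upstream_le (i : Fin m) : (p.upstream i).card ≤ m := by
  simpa using Finset.card_le_univ (p.upstream i)

/-- Induction from the leaves towards the black vertices. -/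
theorem IsForest.induction (hp : p.IsForest) {P : Fin m → Prop}
    (h : ∀ i, (∀ c, p c = Sum.inl i → P c) → P i) (i : Fin m) : P i := by
  induction hk : (p.upstream i).card using Nat.strong_induction_on generalizing i with
  | _ k ih =>
    subst hk
    exact h i fun c hc => ih _ (hp.card_upstream_lt hc) c rfl

theorem mem_incoming {t : Target m} {i : Fin m} : i ∈ p.incoming t ↔ p i = t := by
  simp [incoming]

theorem nodup_incoming (t : Target m) : (p.incoming t).Nodup :=
  (List.nodup_finRange m).filter _

theorem incoming_congr {p' : Diagram m} {t t' : Target m} (h : ∀ i, p i = t ↔ p' i = t') :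
    p.incoming t = p'.incoming t' :=
  List.filter_congr fun i _ => by simp [h]

end Diagram

/-! ### Fields propagating along the edges of a forest -/

section Fields

variable {Λ : ℂ} {U : Fin 2 → Twistor} {ξ : Spinor} {m : ℕ} {h : Fin m → Twistor → Twistor}
  {p p' : Diagram m}

theorem vertexField_congr {X Y : Fin m → Spinor → Twistor} {i : Fin m}
    (hin : p.incoming (Sum.inl i) = p'.incoming (Sum.inl i))
    (hX : ∀ c ∈ p.incoming (Sum.inl i), X c = Y c) :
    vertexField Λ U h p X i = vertexField Λ U h p' Y i := by
  ext1 z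
  have : ((p.incoming (Sum.inl i)).map fun c => X c (affine z)) =
      (p'.incoming (Sum.inl i)).map fun c => Y c (affine z) := by
    rw [← hin]
    exact List.map_congr_left fun c hc => by rw [hX c hc]
  rw [vertexField, vertexField, this]

/-- The field that leaves a vertex depends only on what is upstream. -/
theorem edgeField_congr {Q : Fin m → Prop}
    (hQ : ∀ i, Q i → ∀ c, p c = Sum.inl i → Q c)
    (hin : ∀ i, Q i → p.incoming (Sum.inl i) = p'.incoming (Sum.inl i)) (i : Fin m) (hi : Q i) :
    edgeField Λ U ξ h p i = edgeField Λ U ξ h p' i := by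
  have key (k : ℕ) : ∀ i, Q i →
      edgeFieldAux Λ U ξ h p k i = edgeFieldAux Λ U ξ h p' k i := by
    induction k with
    | zero => intros; rfl
    | succ k ih =>
      intro i hi
      ext1 σ
      simp only [edgeFieldAux]
      rw [vertexField_congr (hin i hi)
        fun c hc => ih c (hQ i hi c (Diagram.mem_incoming.1 hc))]
  exact key m i hi

/-- The recursion depth is irrelevant once it is at least the number of vertices upstream, so the
default value at depth zero is never reached. -/
theorem edgeFieldAux_eq (hp : p.IsForest) (i : Fin m) :
    ∀ k, (p.upstream i).card ≤ k → ∀ l, (p.upstream i).card ≤ l →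
      edgeFieldAux Λ U ξ h p k i = edgeFieldAux Λ U ξ h p l i := by
  induction i using hp.induction with | h i ih => ?_
  intro k hk l hl
  have h0 := Diagram.card_upstream_pos (p := p) i
  obtain ⟨k, rfl⟩ := Nat.exists_eq_add_of_lt (h0.trans_le hk)
  obtain ⟨l, rfl⟩ := Nat.exists_eq_add_of_lt (h0.trans_le hl)
  ext1 σ
  simp only [edgeFieldAux]
  rw [vertexField_congr rfl]
  intro c hc
  have hc' := Diagram.mem_incoming.1 hc
  have := hp.card_upstream_lt hc'
  exact ih c hc' _ (by omega) _ (by omega)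

theorem edgeField_eq (hp : p.IsForest) (i : Fin m) :
    edgeField Λ U ξ h p i =
      contraction ξ (vertexField Λ U h p (edgeField Λ U ξ h p) i) := by
  -- Depth `m` already suffices; depth `m + 1` unfolds once to a contraction fed with fields of
  -- depth `m`.
  have h1 : edgeField Λ U ξ h p i = edgeFieldAux Λ U ξ h p (m + 1) i :=
    edgeFieldAux_eq hp i _ (Diagram.card_upstream_le i) _
      ((Diagram.card_upstream_le i).trans (Nat.le_succ m))
  rw [h1]
  rfl

variable (Λ U ξ h p) in
/-- The field at the white vertex `i` as a section over the line. -/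
def edgeSection (i : Fin m) : Spinor → Twistor :=
  vertexSection Λ U (h i) ((p.incoming (Sum.inl i)).map (edgeField Λ U ξ h p))

variable {W : Set Twistor} (hW : IsTwistorDomain W) (hU : ∀ σ : Spinor, σ ≠ 0 → line U σ ∈ W)
  (hh : ∀ i, IsWavefunction W 2 (h i)) (hξ : ξ ≠ 0) (hp : p.IsForest)

include hW hU hh

theorem edgeSection_affine (i : Fin m) : (fun z => edgeSection Λ U ξ h p i (affine z)) =
    vertexField Λ U h p (edgeField Λ U ξ h p) i := by
  ext1 z
  rw [edgeSection, vertexSection_affine hW hU (hh i), List.map_map]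
  rfl

include hp

theorem edgeField_eq_contraction (i : Fin m) : edgeField Λ U ξ h p i =
    contraction ξ (fun z => edgeSection Λ U ξ h p i (affine z)) := by
  rw [edgeSection_affine hW hU hh, edgeField_eq hp i]

theorem edgeField_self (i : Fin m) : edgeField Λ U ξ h p i ξ = 0 := by
  rw [edgeField_eq_contraction hW hU hh hp i, contraction_self]

include hξ

/-- Induction from the leaves: the contraction of a vertex field has the bidegree and the smoothness
that the next vertex requires of its incoming fields. -/
theorem isSection_edgeField (i : Fin m) : IsSection 1 0 (edgeField Λ U ξ h p i) := by
  induction i using hp.induction with | h i ih => ?_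
  rw [edgeField_eq_contraction hW hU hh hp i]
  refine isSection_contraction (isSection_vertexSection hW hU (hh i) _ _ fun X hX => ?_) hξ
  obtain ⟨c, hc, rfl⟩ := List.mem_map.1 hX
  exact ih c (Diagram.mem_incoming.1 hc)

theorem isSection_edgeSection (i : Fin m) : IsSection 1 (-2) (edgeSection Λ U ξ h p i) := by
  refine isSection_vertexSection hW hU (hh i) _ _ fun X hX => ?_
  obtain ⟨c, hc, rfl⟩ := List.mem_map.1 hX
  exact isSection_edgeField hW hU hh hξ hp c

theorem hasContraction_edgeField (i : Fin m) {σ : Spinor} (hσ : σ ≠ 0) :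
    HasContraction ξ (vertexField Λ U h p (edgeField Λ U ξ h p) i) σ
      (edgeField Λ U ξ h p i σ) := by
  rw [← edgeSection_affine hW hU hh, edgeField_eq_contraction hW hU hh hp i]
  exact hasContraction_contraction (isSection_edgeSection hW hU hh hξ hp i) hξ hσ

theorem del_edgeField_self (i : Fin m) (v : Spinor) : del (edgeField Λ U ξ h p i) ξ v = 0 := by
  rw [edgeField_eq_contraction hW hU hh hp i]
  exact del_contraction_self (isSection_edgeSection hW hU hh hξ hp i) hξ v

theorem delBar_edgeField_affine (i : Fin m) (z : ℂ) :
    delBar (fun z => edgeField Λ U ξ h p i (affine z)) z 1 =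
      (-2 * Real.pi * Complex.I) • edgeSection Λ U ξ h p i (affine z) := by
  rw [edgeField_eq_contraction hW hU hh hp i]
  exact delBar_contraction_affine (isSection_edgeSection hW hU hh hξ hp i) hξ z

end Fields

/-! ### Holomorphic one-forms on the worldsheet -/

theorem differentiable_of_delBar_eq_zero {g : ℂ → ℂ} (hg : Differentiable ℝ g)
    (h : ∀ z, delBar g z 1 = 0) : Differentiable ℂ g := by
  intro z
  rw [differentiableAt_complex_iff_differentiableAt_real]
  refine ⟨hg z, ?_⟩
  have h1 := fderiv_I_smul_eq g z 1
  have h2 := fderiv_eq_del_add_delBar g z 1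
  rw [h z, smul_zero, sub_zero, smul_eq_mul, mul_one] at h1
  rw [h z, add_zero] at h2
  rw [h1, h2]

theorem contDiff_affine : ContDiff ℝ ∞ affine := by
  refine contDiff_pi.2 fun i => ?_
  fin_cases i
  · exact contDiff_const
  · exact contDiff_id

/-- A global holomorphic one-form on the worldsheet with coefficients of degree `0` that vanishes at
one point is zero. -/
theorem oneForm_eq_zero {G : Spinor → Spinor → ℂ}
    (hadd : ∀ σ v w, G σ (v + w) = G σ v + G σ w) (hsmul : ∀ σ v (t : ℂ), G σ (t • v) = t * G σ v)
    (hself : ∀ σ, σ ≠ 0 → G σ σ = 0)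
    (hhom : ∀ σ, σ ≠ 0 → ∀ (t : ℂ), t ≠ 0 → ∀ v, G (t • σ) v = t * G σ v)
    (hcont : ∀ v, ContinuousOn (fun σ => G σ v) {0}ᶜ)
    (hol : Differentiable ℂ fun z => G (affine z) ![0, 1])
    {ξ : Spinor} (hξ : ξ ≠ 0) (hG : ∀ v, G ξ v = 0) {σ : Spinor} (hσ : σ ≠ 0) (v : Spinor) :
    G σ v = 0 := by
  -- The coefficient of `(σ dσ)`: it has degree zero and agrees with the affine coefficient on
  -- `affine z`.
  set κ : Spinor → ℂ := fun σ => (nsq σ : ℂ)⁻¹ * G σ (quat σ) with hκ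
  have hκc : ContinuousOn κ {0}ᶜ := by
    refine contDiffOn_inv_nsq.continuousOn.mul ?_
    have h1 (σ : Spinor) :
        G σ (quat σ) = -star (σ 1) * G σ ![1, 0] + star (σ 0) * G σ ![0, 1] := by
      rw [← hsmul, ← hsmul, ← hadd]
      congr 1
      ext i
      fin_cases i <;> simp
    simp only [h1]
    exact ((((continuous_apply 1).star).neg.continuousOn).mul (hcont _)).add
      (((continuous_apply 0).star.continuousOn).mul (hcont _))
  have hκh (σ : Spinor) (hσ : σ ≠ 0) (t : ℂ) (ht : t ≠ 0) : κ (t • σ) = κ σ := by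
    have hs : star t ≠ 0 := star_ne_zero.2 ht
    have hn : (nsq (t • σ) : ℂ) = t * star t * nsq σ := by
      rw [coe_nsq, coe_nsq]
      simp only [Pi.smul_apply, smul_eq_mul, star_mul']
      ring
    have h0 := nsq_coe_ne_zero hσ
    simp only [hκ]
    rw [hn, quat_smul, hhom σ hσ t ht, hsmul]
    field_simp
  have hκa (z : ℂ) : κ (affine z) = G (affine z) ![0, 1] := by
    have h1 := congrArg (G (affine z)) (nsq_affine_smul z)
    rw [hsmul, hadd, hsmul, hself _ (affine_ne_zero z), mul_zero, add_zero] at h1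
    simp only [hκ]
    rw [← h1, inv_mul_cancel_left₀ (nsq_coe_affine_ne_zero z)]
  -- Degree zero reduces the bound to the compact unit sphere; Liouville's theorem then applies to
  -- the entire function `κ (affine z)`.
  have hbdd : ∃ C, ∀ σ : Spinor, σ ≠ 0 → ‖κ σ‖ ≤ C := by
    obtain ⟨C, hC⟩ := (isCompact_sphere (0 : Spinor) 1).exists_bound_of_continuousOn
      (hκc.mono fun σ hσ => by
        rintro rfl
        simp at hσ)
    refine ⟨C, fun σ hσ => ?_⟩
    have hn : (‖σ‖ : ℂ) ≠ 0 := Complex.ofReal_ne_zero.2 (norm_ne_zero_iff.2 hσ)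
    rw [← hκh σ hσ _ (inv_ne_zero hn)]
    refine hC _ ?_
    simp [norm_smul, norm_ne_zero_iff.2 hσ]
  obtain ⟨C, hC⟩ := hbdd
  have hconst (z : ℂ) : κ (affine z) = κ (affine 0) := by
    rw [hκa, hκa]
    refine hol.apply_eq_apply_of_bounded ?_ z 0
    refine (isBounded_iff_forall_norm_le.2 ⟨C, ?_⟩)
    rintro _ ⟨z, rfl⟩
    change ‖G (affine z) _‖ ≤ C
    rw [← hκa]
    exact hC _ (affine_ne_zero z)
  have hchart (σ : Spinor) (hσ : σ 0 ≠ 0) : κ σ = κ (affine 0) := by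
    have h1 : σ = σ 0 • affine (σ 1 / σ 0) := by
      ext i
      fin_cases i
      · simp
      · simp; field_simp
    rw [h1, hκh _ (affine_ne_zero _) _ hσ, hconst]
  -- The point missed by the affine coordinate is reached by continuity; `ξ` may be that point.
  have hall (σ : Spinor) (hσ : σ ≠ 0) : κ σ = κ (affine 0) := by
    by_cases h0 : σ 0 = 0
    · have h1 : ContinuousAt κ σ := hκc.continuousAt (isOpen_compl_singleton.mem_nhds hσ)
      have h2 : Tendsto (fun t : ℂ => σ + t • (![1, 0] : Spinor)) (𝓝[≠] 0) (𝓝 σ) := by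
        have : Continuous fun t : ℂ => σ + t • (![1, 0] : Spinor) := by fun_prop
        simpa using (this.tendsto 0).mono_left nhdsWithin_le_nhds
      refine tendsto_nhds_unique (h1.tendsto.comp h2) (tendsto_const_nhds.congr' ?_)
      filter_upwards [self_mem_nhdsWithin] with t ht
      refine (hchart _ ?_).symm
      simpa [h0] using ht
    · exact hchart σ h0
  have hz : κ σ = 0 := by
    rw [hall σ hσ, ← hall ξ hξ]
    simp [hκ, hG]
  have hn := nsq_coe_ne_zero hσ
  have hq : G σ (quat σ) = 0 := (mul_eq_zero.1 hz).resolve_left (inv_ne_zero hn)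
  have h1 := congrArg (G σ) (nsq_smul_eq σ v)
  rw [hsmul, hadd, hsmul, hsmul, hself σ hσ, hq, mul_zero, mul_zero, add_zero] at h1
  exact (mul_eq_zero.1 h1).resolve_left hn

/-! ### The contraction of a vertex with the contact form -/

/-- The contact form as a continuous bilinear map. -/
def contactL (Λ : ℂ) : Twistor →L[ℂ] Twistor →L[ℂ] ℂ :=
  ∑ i, ∑ j, infinityLower Λ i j •
    (ContinuousLinearMap.proj (R := ℂ) (φ := fun _ : Fin 4 => ℂ) i).smulRight
      (ContinuousLinearMap.proj (R := ℂ) (φ := fun _ : Fin 4 => ℂ) j)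

theorem contactL_apply (Λ : ℂ) (X Y : Twistor) : contactL Λ X Y = contactForm Λ X Y := by
  simp [contactL, contactForm, mul_assoc]

section Vertex

variable {Λ : ℂ} {U : Fin 2 → Twistor} {W : Set Twistor} {h : Twistor → Twistor}

theorem pullback_iterDel_perm (hW : IsTwistorDomain W) (hU : ∀ σ : Spinor, σ ≠ 0 → line U σ ∈ W)
    {w : ℤ} (hh : IsWavefunction W w h) {vs ws : List Twistor} (hp : vs.Perm ws) {σ : Spinor}
    (hσ : σ ≠ 0) (v : Spinor) :
    pullback U (iterDel h vs) σ v = pullback U (iterDel h ws) σ v := by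
  rw [pullback, pullback, iterDel_perm hW.isOpen hh.smooth hp (hU σ hσ)]

theorem pullback_iterDel_line (hW : IsTwistorDomain W) (hU : ∀ σ : Spinor, σ ≠ 0 → line U σ ∈ W)
    {w : ℤ} (hh : IsWavefunction W w h) (vs : List Twistor) {σ : Spinor}
    (hσ : σ ≠ 0) (v : Spinor) :
    pullback U (iterDel h (line U σ :: vs)) σ v =
      ((w - vs.length : ℤ) : ℂ) * pullback U (iterDel h vs) σ v := by
  rw [pullback, iterDel_cons_self hW.isOpen hW.smul_mem hh.smooth hh.isHomogeneousOn vs (hU σ hσ),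
    pullback, Finset.mul_sum]
  simp only [Pi.smul_apply, smul_eq_mul, mul_assoc]

theorem line_affine_mem (hU : ∀ σ : Spinor, σ ≠ 0 → line U σ ∈ W) (z : ℂ) :
    line U (affine z) ∈ W := hU _ (affine_ne_zero z)

variable {ι : Type*} [DecidableEq ι]

/-- With `B` constant the contact form passes through the derivative and becomes a derivative of `h`
along `B`. The product rule then differentiates either the base point, giving `U 1`, or one of the
incoming fields. -/
theorem contactForm_del_vertexSection (hW : IsTwistorDomain W)
    (hU : ∀ σ : Spinor, σ ≠ 0 → line U σ ∈ W) (hh : IsWavefunction W 2 h)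
    {C : List ι} (hC : C.Nodup) {X : ι → Spinor → Twistor} (hX : ∀ c ∈ C, IsSection 1 0 (X c))
    (B : Twistor) (z : ℂ) :
    contactForm Λ B (del (fun z => vertexSection Λ U h (C.map X) (affine z)) z 1) =
      Λ * (pullback U (iterDel h (U 1 :: B :: C.map fun c => X c (affine z))) (affine z) ![0, 1] +
        (C.map fun c => pullback U (iterDel h (del (fun z => X c (affine z)) z 1 :: B ::
          (C.erase c).map fun c => X c (affine z))) (affine z) ![0, 1]).sum) := by
  have hs : IsSection 1 (-2) (vertexSection Λ U h (C.map X)) :=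
    isSection_vertexSection hW hU hh Λ _ fun Y hY => by
      obtain ⟨c, hc, rfl⟩ := List.mem_map.1 hY
      exact hX c hc
  have hd : DifferentiableAt ℝ (fun z => vertexSection Λ U h (C.map X) (affine z)) z :=
    (hs.differentiableAt (affine_ne_zero z)).comp z
      ((hasFDerivAt_affine z).restrictScalars ℝ).differentiableAt
  have h1 := del_clm_comp ((contactL Λ).flip B) hd 1
  simp only [ContinuousLinearMap.flip_apply, contactL_apply] at h1
  rw [contactForm_swap, ← h1]
  have hB := contDiffOn_del hW.isOpen hh.smooth B
  have h2 (y : ℂ) : contactForm Λ (vertexSection Λ U h (C.map X) (affine y)) B =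
      ∑ α, (-Λ * star (U 1 α)) •
        iterDel (fun Z => del h Z B) (C.map fun c => X c (affine y)) (line U (affine y)) α := by
    rw [contactForm_vertexSection_left hW hU hh, pullback, Finset.mul_sum, List.map_map]
    refine Finset.sum_congr rfl fun α _ => ?_
    rw [iterDel_cons' hW.isOpen hh.smooth _ _ (line_affine_mem hU y)]
    simp [line, Function.comp_def]
    ring
  simp only [h2]
  have hZ : HasFDerivAt (fun y => line U (affine y)) ((lineL U).comp
      (ContinuousLinearMap.toSpanSingleton ℂ (![0, 1] : Spinor))) z :=
    (hasFDerivAt_line U _).comp z (hasFDerivAt_affine z)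
  have hXd (c : ι) (hc : c ∈ C) : DifferentiableAt ℝ (fun y => X c (affine y)) z :=
    ((hX c hc).differentiableAt (affine_ne_zero z)).comp z
      ((hasFDerivAt_affine z).restrictScalars ℝ).differentiableAt
  have h3 := del_iterDel_map hW.isOpen hB hZ (Eventually.of_forall (line_affine_mem hU))
    (fun c y => X c (affine y)) C hC hXd 1
  have h4 : ((lineL U).comp (ContinuousLinearMap.toSpanSingleton ℂ (![0, 1] : Spinor))) 1 =
      U 1 := by
    simp [coe_lineL, line]
  rw [h4] at h3
  have hdi : DifferentiableAt ℝ (fun y => iterDel (fun Z => del h Z B)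
      (C.map fun c => X c (affine y)) (line U (affine y))) z := by
    have h5 := contDiffOn_iterDel_map hW.isOpen hB (Ω := (Set.univ : Set ℂ))
      ((contDiff_line U).comp contDiff_affine).contDiffOn (fun y _ => line_affine_mem hU y)
      (C.map fun c y => X c (affine y)) (by
        intro Y hY
        obtain ⟨c, hc, rfl⟩ := List.mem_map.1 hY
        exact (hX c hc).smooth.comp contDiff_affine.contDiffOn fun y _ => affine_ne_zero y)
    simp only [List.map_map, Function.comp_def] at h5
    exact h5.differentiableAt_of_isOpen isOpen_univ (Set.mem_univ z)
  have h6 (α : Fin 4) := del_clm_comp ((-Λ * star (U 1 α)) •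
    (ContinuousLinearMap.proj (R := ℂ) (φ := fun _ : Fin 4 => ℂ) α)) hdi 1
  simp only [smul_apply, ContinuousLinearMap.proj_apply] at h6
  rw [del_fun_sum _ fun α _ => (differentiableAt_pi.1 hdi α).fun_const_smul _]
  have hlist (l : List ι) (F : ι → Twistor) (α : Fin 4) :
      (l.map F).sum α = (l.map fun c => F c α).sum := by
    induction l with
    | nil => rfl
    | cons a l ih => simp [ih]
  have hsum (l : List ι) (F : ι → Fin 4 → ℂ) (k : Fin 4 → ℂ) :
      ∑ α, (l.map fun c => F c α).sum * k α = (l.map fun c => ∑ α, F c α * k α).sum := by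
    induction l with
    | nil => simp
    | cons a l ih => simp [add_mul, Finset.sum_add_distrib, ih]
  have hmem := line_affine_mem hU z
  have hswap (v : Twistor) (vs : List Twistor) :
      iterDel (fun Z => del h Z B) (v :: vs) (line U (affine z)) =
        iterDel h (v :: B :: vs) (line U (affine z)) := by
    rw [← iterDel_cons' hW.isOpen hh.smooth B _ hmem]
    exact iterDel_perm hW.isOpen hh.smooth (List.Perm.swap _ _ _) hmem
  simp only [hswap] at h3
  simp only [h6, h3]
  have hU1 (α : Fin 4) : line U ![0, 1] α = U 1 α := by simp [line]
  simp only [pullback, hU1, ← hsum, ← Finset.sum_add_distrib, Finset.mul_sum, Pi.add_apply, hlist,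
    ← Finset.sum_neg_distrib, smul_eq_mul]
  exact Finset.sum_congr rfl fun α _ => by ring

variable (Λ U h) in
/-- The `∂̄`-derivative of the contact form `τ` with a vertex in the slot of `Z` and `B` in the slot
of `dZ`, antisymmetrized. -/
def tauDefect (C : List ι) (X : ι → Spinor → Twistor) (B : ℂ → Twistor) (z : ℂ) : ℂ :=
  contactForm Λ (vertexSection Λ U h (C.map X) (affine z)) (del B z 1) +
    contactForm Λ (B z) (del (fun z => vertexSection Λ U h (C.map X) (affine z)) z 1)

/-- The sum over the ways to contract `Z` and `dZ` with one vertex and with at most one of the fields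
that flow into it vanishes. -/
theorem sum_tauDefect (hW : IsTwistorDomain W)
    (hU : ∀ σ : Spinor, σ ≠ 0 → line U σ ∈ W) (hh : IsWavefunction W 2 h)
    {C : List ι} (hC : C.Nodup) {X : ι → Spinor → Twistor} (hX : ∀ c ∈ C, IsSection 1 0 (X c))
    (z : ℂ) :
    tauDefect Λ U h C X (fun z => line U (affine z)) z +
      ∑ c ∈ C.toFinset, tauDefect Λ U h (C.erase c) X (fun z => X c (affine z)) z = 0 := by
  have h0 := affine_ne_zero z
  set Y : ι → Twistor := fun c => X c (affine z) with hY
  set D : ι → Twistor := fun c => del (fun z => X c (affine z)) z 1 with hD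
  set Θ : List Twistor → ℂ := fun vs => pullback U (iterDel h vs) (affine z) ![0, 1] with hΘ
  have hperm {vs ws : List Twistor} (h : vs.Perm ws) : Θ vs = Θ ws :=
    pullback_iterDel_perm hW hU hh h h0 _
  have hline : del (fun z => line U (affine z)) z 1 = U 1 := by
    rw [del_comp ((hasFDerivAt_line U _).restrictScalars ℝ).differentiableAt (hasFDerivAt_affine z),
      del_line]
    simp [line]
  -- the defect in terms of the pulled back wave function
  have hdef (C' : List ι) (hC' : C'.Nodup) (hX' : ∀ c ∈ C', IsSection 1 0 (X c))
      (B : ℂ → Twistor) : tauDefect Λ U h C' X B z = Λ * (-Θ (del B z 1 :: C'.map Y) +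
        (Θ (U 1 :: B z :: C'.map Y) +
          ∑ d ∈ C'.toFinset, Θ (D d :: B z :: (C'.erase d).map Y))) := by
    rw [tauDefect, contactForm_vertexSection_left hW hU hh,
      contactForm_del_vertexSection hW hU hh hC' hX', List.sum_toFinset _ hC', List.map_map]
    simp only [hΘ, hY, hD, Function.comp_def]
    ring
  have hlen (c : ι) (hc : c ∈ C.toFinset) : ((C.erase c).length : ℂ) = C.length - 1 := by
    rw [List.length_erase_of_mem (List.mem_toFinset.1 hc),
      Nat.cast_sub (List.length_pos_of_mem (List.mem_toFinset.1 hc)), Nat.cast_one]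
  -- Euler's identity with weight two, lowered by the derivatives along `v` and `vs`: `2 - (1 +
  -- vs.length)`.
  have hE (v : Twistor) (vs : List Twistor) :
      Θ (v :: line U (affine z) :: vs) = (1 - vs.length) * Θ (v :: vs) := by
    rw [hperm (List.Perm.swap _ _ _)]
    simp only [hΘ]
    rw [pullback_iterDel_line hW hU hh _ h0]
    push_cast [List.length_cons]
    ring
  have h1 : tauDefect Λ U h C X (fun z => line U (affine z)) z =
      Λ * (-C.length * Θ (U 1 :: C.map Y) +
        (2 - C.length) * ∑ c ∈ C.toFinset, Θ (D c :: (C.erase c).map Y)) := by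
    rw [hdef C hC hX, hline, hE, Finset.mul_sum, List.length_map]
    have : ∑ d ∈ C.toFinset, Θ (D d :: line U (affine z) :: (C.erase d).map Y) =
        ∑ d ∈ C.toFinset, (2 - C.length) * Θ (D d :: (C.erase d).map Y) := by
      refine Finset.sum_congr rfl fun d hd => ?_
      rw [hE, List.length_map, hlen d hd]
      ring
    rw [this]
    ring
  have hcons (v : Twistor) (l : List ι) (c : ι) (hc : c ∈ l) :
      Θ (v :: Y c :: (l.erase c).map Y) = Θ (v :: l.map Y) :=
    hperm (((List.perm_cons_erase hc).map Y).symm.cons v)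
  -- Moving `c` to the other slot of `τ` reproduces the same pulled-back derivatives, since `Y c`
  -- returns as a direction. Only the term with `D c` has the opposite sign, hence the correction
  -- `-2`.
  have h2 (c : ι) (hc : c ∈ C.toFinset) :
      tauDefect Λ U h (C.erase c) X (fun z => X c (affine z)) z =
      Λ * (Θ (U 1 :: C.map Y) + (∑ d ∈ C.toFinset, Θ (D d :: (C.erase d).map Y) -
        2 * Θ (D c :: (C.erase c).map Y))) := by
    have hc' := List.mem_toFinset.1 hc
    rw [hdef _ (hC.erase c) (fun d hd => hX d (List.mem_of_mem_erase hd))]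
    have h3 : ∑ d ∈ (C.erase c).toFinset, Θ (D d :: X c (affine z) :: ((C.erase c).erase d).map Y) =
        ∑ d ∈ C.toFinset.erase c, Θ (D d :: (C.erase d).map Y) := by
      refine Finset.sum_congr ?_ fun d hd => ?_
      · ext d
        simp [hC.mem_erase_iff]
      · have hd' := Finset.mem_erase.1 hd
        rw [List.erase_comm]
        exact hcons _ _ _ ((List.mem_erase_of_ne hd'.1.symm).2 hc')
    have h4 := Finset.add_sum_erase C.toFinset (fun d => Θ (D d :: (C.erase d).map Y)) hc
    rw [h3, ← h4]
    have h5 := hcons (U 1) C c hc'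
    simp only [hY] at h5 ⊢
    rw [h5]
    simp only [hD]
    ring
  -- Summing over `c` gives `N` and `N - 2` for `N = C.length`, against `-N` and `2 - N` from `h1`.
  rw [h1, Finset.sum_congr rfl h2, ← Finset.mul_sum, Finset.sum_add_distrib, Finset.sum_sub_distrib,
    ← Finset.mul_sum, Finset.sum_const, Finset.sum_const, List.toFinset_card_of_nodup hC,
    nsmul_eq_mul, nsmul_eq_mul]
  ring

end Vertex

/-! ### Operations on diagrams -/

namespace Diagram

variable {m : ℕ} {p : Diagram m} {j : Fin 2}

/-- Exchange the roles of `Z` and `dZ` in `τ_j`. -/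
def swap (j : Fin 2) (p : Diagram m) : Diagram m := fun i =>
  Equiv.swap (Sum.inr (j, Slot.tauZ)) (Sum.inr (j, Slot.tauDZ)) (p i)

theorem swap_swap (j : Fin 2) (p : Diagram m) : (p.swap j).swap j = p := by
  ext1 i; simp [swap]

theorem swap_eq_iff (i : Fin m) (t : Target m) : p.swap j i = t ↔
    p i = Equiv.swap (Sum.inr (j, Slot.tauZ)) (Sum.inr (j, Slot.tauDZ)) t := by
  rw [swap, Equiv.swap_apply_eq_iff]

theorem incoming_swap (t : Target m) : (p.swap j).incoming t =
    p.incoming (Equiv.swap (Sum.inr (j, Slot.tauZ)) (Sum.inr (j, Slot.tauDZ)) t) :=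
  incoming_congr fun i => swap_eq_iff i t

theorem incoming_swap_of_ne {t : Target m} (h1 : t ≠ Sum.inr (j, Slot.tauZ))
    (h2 : t ≠ Sum.inr (j, Slot.tauDZ)) : (p.swap j).incoming t = p.incoming t := by
  rw [incoming_swap, Equiv.swap_apply_of_ne_of_ne h1 h2]

theorem incoming_eq_nil {t : Target m} : p.incoming t = [] ↔ ∀ i, p i ≠ t := by
  rw [List.eq_nil_iff_forall_not_mem]
  simp only [mem_incoming, ne_eq]

theorem incoming_eq_singleton (hp : p.IsWick) {i : Fin m} {s : Slot} (hs : s ≠ Slot.wave)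
    (hi : p i = Sum.inr (j, s)) : p.incoming (Sum.inr (j, s)) = [i] := by
  have h1 : ∀ k, k ∈ p.incoming (Sum.inr (j, s)) ↔ k = i := fun k => by
    rw [mem_incoming]
    exact ⟨fun hk => hp k i j s hs hk hi, fun hk => hk ▸ hi⟩
  have h2 := (List.perm_ext_iff_of_nodup (nodup_incoming (p := p) (Sum.inr (j, s)))
    (List.nodup_singleton i)).2 (by simpa using h1)
  exact List.perm_singleton.1 h2

theorem incoming_update_of_ne {b : Fin m} {s t : Target m} (h1 : t ≠ p b) (h2 : t ≠ s) :
    incoming (Function.update p b s) t = p.incoming t :=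
  incoming_congr fun i => by
    rcases eq_or_ne i b with rfl | hi
    · rw [Function.update_self]
      exact ⟨fun h => absurd h.symm h2, fun h => absurd h.symm h1⟩
    · rw [Function.update_of_ne hi]

theorem incoming_update_old {b : Fin m} {s : Target m} (hs : s ≠ p b) :
    incoming (Function.update p b s) (p b) = (p.incoming (p b)).erase b := by
  rw [(nodup_incoming _).erase_eq_filter, incoming, incoming, List.filter_filter]
  refine List.filter_congr fun i _ => ?_
  rcases eq_or_ne i b with rfl | hi
  · simp [hs]
  · simp [hi]

end Diagram

/-! ### The fields in the slots of the contact form and their sources -/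

section Slots

variable {Λ : ℂ} {U : Fin 2 → Twistor} {ξ : Spinor} {m : ℕ} {h : Fin m → Twistor → Twistor}
  {p p' : Diagram m} {j : Fin 2}

theorem slotField_of_nil {t : Target m} (ht : ∀ i, p i ≠ t) :
    slotField Λ U ξ h p t = line U := by
  rw [slotField, Diagram.incoming_eq_nil.2 ht]

theorem slotField_of_eq (hp : p.IsWick) {i : Fin m} {s : Slot} (hs : s ≠ Slot.wave)
    (hi : p i = Sum.inr (j, s)) :
    slotField Λ U ξ h p (Sum.inr (j, s)) = edgeField Λ U ξ h p i := by
  rw [slotField, Diagram.incoming_eq_singleton hp hs hi]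

theorem slotField_congr {t t' : Target m} (ht : p.incoming t = p'.incoming t')
    (hX : ∀ c ∈ p.incoming t, edgeField Λ U ξ h p c = edgeField Λ U ξ h p' c) :
    slotField Λ U ξ h p t = slotField Λ U ξ h p' t' := by
  rw [slotField, slotField, ← ht]
  cases hl : p.incoming t with
  | nil => rfl
  | cons i l => exact hX i (by simp [hl])

theorem waveFactor_congr {e : Twistor → Twistor} {k : Fin 2}
    (ht : p.incoming (Sum.inr (k, Slot.wave)) = p'.incoming (Sum.inr (k, Slot.wave)))
    (hX : ∀ c ∈ p.incoming (Sum.inr (k, Slot.wave)),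
      edgeField Λ U ξ h p c = edgeField Λ U ξ h p' c) (σ v : Spinor) :
    waveFactor Λ U ξ h p e k σ v = waveFactor Λ U ξ h p' e k σ v := by
  rw [waveFactor, waveFactor, ← ht, List.map_congr_left fun c hc => by rw [hX c hc]]

/-- The exchange redirects only edges that end on `τ_j`; it leaves every edge between white vertices
in place. -/
theorem edgeField_swap (i : Fin m) :
    edgeField Λ U ξ h (p.swap j) i = edgeField Λ U ξ h p i :=
  edgeField_congr (Q := fun _ => True) (fun _ _ _ _ => trivial)
    (fun _ _ => Diagram.incoming_swap_of_ne (by simp) (by simp)) i trivial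

/-- Only the vertex `a` loses an incoming edge, and `a` is upstream of no other white vertex because
its own edge ends on `τ_j`. -/
theorem edgeField_update {a b : Fin m} {s : Slot} (ha : p a = Sum.inr (j, Slot.tauZ))
    (hb : p b = Sum.inl a) {i : Fin m} (hi : i ≠ a) :
    edgeField Λ U ξ h (Function.update p b (Sum.inr (j, s))) i = edgeField Λ U ξ h p i := by
  refine (edgeField_congr (Q := fun i => i ≠ a) (fun i hi c hc => ?_) (fun i hi => ?_) i hi).symm
  · rintro rfl
    simp [ha] at hc
  · refine (Diagram.incoming_update_of_ne ?_ ?_).symm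
    · rw [hb]; simpa using hi
    · simp

variable (Λ U ξ h p) in
/-- The source of the field in the slot `t`. -/
def slotSource (t : Target m) : Spinor → Twistor :=
  match p.incoming t with
  | [] => fun _ => 0
  | i :: _ => edgeSection Λ U ξ h p i

theorem slotSource_of_nil {t : Target m} (ht : ∀ i, p i ≠ t) :
    slotSource Λ U ξ h p t = fun _ => 0 := by
  rw [slotSource, Diagram.incoming_eq_nil.2 ht]

theorem slotSource_of_eq (hp : p.IsWick) {i : Fin m} {s : Slot} (hs : s ≠ Slot.wave)
    (hi : p i = Sum.inr (j, s)) :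
    slotSource Λ U ξ h p (Sum.inr (j, s)) = edgeSection Λ U ξ h p i := by
  rw [slotSource, Diagram.incoming_eq_singleton hp hs hi]

theorem edgeSection_swap (i : Fin m) :
    edgeSection Λ U ξ h (p.swap j) i = edgeSection Λ U ξ h p i := by
  rw [edgeSection, edgeSection, Diagram.incoming_swap_of_ne (by simp) (by simp),
    List.map_congr_left fun c _ => edgeField_swap c]

theorem slotField_swap (t : Target m) : slotField Λ U ξ h (p.swap j) t =
    slotField Λ U ξ h p (Equiv.swap (Sum.inr (j, Slot.tauZ)) (Sum.inr (j, Slot.tauDZ)) t) :=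
  slotField_congr (Diagram.incoming_swap t) fun c _ => edgeField_swap c

theorem slotSource_swap (t : Target m) : slotSource Λ U ξ h (p.swap j) t =
    slotSource Λ U ξ h p (Equiv.swap (Sum.inr (j, Slot.tauZ)) (Sum.inr (j, Slot.tauDZ)) t) := by
  rw [slotSource, slotSource, Diagram.incoming_swap]
  split
  · rfl
  · exact edgeSection_swap _

variable {W : Set Twistor} (hW : IsTwistorDomain W) (hU : ∀ σ : Spinor, σ ≠ 0 → line U σ ∈ W)
  (hh : ∀ i, IsWavefunction W 2 (h i)) (hξ : ξ ≠ 0) (hp : p.IsForest)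

theorem isSection_line (U : Fin 2 → Twistor) : IsSection 1 0 (line U) :=
  ⟨(contDiff_line U).contDiffOn, fun σ _ t _ => by
    rw [line_smul, zpow_one, zpow_zero, mul_one]⟩

include hW hU hh hξ hp

theorem isSection_slotField (t : Target m) : IsSection 1 0 (slotField Λ U ξ h p t) := by
  rw [slotField]
  split
  · exact isSection_line U
  · exact isSection_edgeField hW hU hh hξ hp _

theorem delBar_slotField_affine (t : Target m) (z : ℂ) :
    delBar (fun z => slotField Λ U ξ h p t (affine z)) z 1 =
      (-2 * Real.pi * Complex.I) • slotSource Λ U ξ h p t (affine z) := by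
  rw [slotField, slotSource]
  cases p.incoming t with
  | nil =>
    rw [smul_zero]
    exact delBar_eq_zero_of_hasFDerivAt ((hasFDerivAt_line U _).comp z (hasFDerivAt_affine z)) 1
  | cons i l => exact delBar_edgeField_affine hW hU hh hξ hp _ z

theorem differentiable_slotSource_affine (t : Target m) :
    Differentiable ℝ fun z => slotSource Λ U ξ h p t (affine z) := by
  intro z
  have : DifferentiableAt ℝ (slotSource Λ U ξ h p t) (affine z) := by
    rw [slotSource]
    split
    · exact differentiableAt_const _
    · exact (isSection_edgeSection hW hU hh hξ hp _).differentiableAt (affine_ne_zero z)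
  exact this.comp z ((hasFDerivAt_affine z).restrictScalars ℝ).differentiableAt

theorem contDiff_slotField_affine (t : Target m) :
    ContDiff ℝ ∞ fun z => slotField Λ U ξ h p t (affine z) := by
  rw [← contDiffOn_univ]
  exact (isSection_slotField hW hU hh hξ hp t).smooth.comp contDiff_affine.contDiffOn
    fun y _ => affine_ne_zero y

/-- `∂̄` commutes with `∂`, so it replaces the field in either slot by its source times `-2πi`. -/
theorem delBar_contactForm_slotField (t t' : Target m) (z : ℂ) :
    delBar (fun z => contactForm Λ (slotField Λ U ξ h p t (affine z))
      (del (fun z => slotField Λ U ξ h p t' (affine z)) z 1)) z 1 =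
    (-2 * Real.pi * Complex.I) *
      (contactForm Λ (slotSource Λ U ξ h p t (affine z))
        (del (fun z => slotField Λ U ξ h p t' (affine z)) z 1) +
      contactForm Λ (slotField Λ U ξ h p t (affine z))
        (del (fun z => slotSource Λ U ξ h p t' (affine z)) z 1)) := by
  have hs := contDiff_slotField_affine (Λ := Λ) (ξ := ξ) hW hU hh hξ hp t
  have hs' := contDiff_slotField_affine (Λ := Λ) (ξ := ξ) hW hU hh hξ hp t'
  have hd : DifferentiableAt ℝ
      (fun z => del (fun z => slotField Λ U ξ h p t' (affine z)) z 1) z :=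
    (contDiffOn_del isOpen_univ hs'.contDiffOn 1).differentiableAt_of_isOpen isOpen_univ
      (Set.mem_univ z)
  have h1 := delBar_bilinear (contactL Λ) (hs.differentiable (by simp) z) hd 1
  simp only [contactL_apply] at h1
  have h2 := del_clm_comp ((-2 * Real.pi * Complex.I : ℂ) • ContinuousLinearMap.id ℂ Twistor)
    (differentiable_slotSource_affine (Λ := Λ) (ξ := ξ) hW hU hh hξ hp t' z) 1
  simp only [smul_apply, ContinuousLinearMap.id_apply] at h2
  rw [h1, delBar_del_comm isOpen_univ hs'.contDiffOn (Set.mem_univ z)]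
  simp only [delBar_slotField_affine hW hU hh hξ hp]
  rw [h2]
  simp only [← contactL_apply, map_smul, smul_apply, smul_eq_mul]
  ring

end Slots

/-! ### Cancellation of the contractions with a contact form -/

/-- A set of diagrams with weights in which `τ_j` is contracted, closed under the exchange of `Z` and
`dZ` in `τ_j`, and under moving the edge that enters `dZ` to the vertex contracted with `Z` and
back. -/
structure IsTauClosed {m : ℕ} (j : Fin 2) (𝒞 : Finset (Diagram m)) (c : Diagram m → ℂ) :
    Prop where
  isForest : ∀ p ∈ 𝒞, p.IsForest
  exists_contraction : ∀ p ∈ 𝒞, ∃ i, p i = Sum.inr (j, Slot.tauZ) ∨ p i = Sum.inr (j, Slot.tauDZ)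
  swap_mem : ∀ p ∈ 𝒞, p.swap j ∈ 𝒞
  swap_weight : ∀ p ∈ 𝒞, c (p.swap j) = c p
  merge_mem : ∀ p ∈ 𝒞, ∀ a b, p a = Sum.inr (j, Slot.tauZ) → p b = Sum.inr (j, Slot.tauDZ) →
    Function.update p b (Sum.inl a) ∈ 𝒞
  split_mem : ∀ p ∈ 𝒞, ∀ a b, p a = Sum.inr (j, Slot.tauZ) → (∀ i, p i ≠ Sum.inr (j, Slot.tauDZ)) →
    p b = Sum.inl a → Function.update p b (Sum.inr (j, Slot.tauDZ)) ∈ 𝒞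
  split_weight : ∀ p ∈ 𝒞, ∀ a b, p a = Sum.inr (j, Slot.tauZ) →
    (∀ i, p i ≠ Sum.inr (j, Slot.tauDZ)) → p b = Sum.inl a →
      c (Function.update p b (Sum.inr (j, Slot.tauDZ))) = c p

section Cancellation

variable {Λ : ℂ} {U : Fin 2 → Twistor} {ξ : Spinor} {m : ℕ} {h : Fin m → Twistor → Twistor}
  {j : Fin 2} {𝒞 : Finset (Diagram m)} {c : Diagram m → ℂ}

theorem IsTauClosed.sum_swap (hC : IsTauClosed j 𝒞 c) (F : Diagram m → ℂ) :
    ∑ p ∈ 𝒞, c p * F (p.swap j) = ∑ p ∈ 𝒞, c p * F p := by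
  refine Finset.sum_bij' (fun p _ => p.swap j) (fun p _ => p.swap j) hC.swap_mem hC.swap_mem
    (fun p _ => p.swap_swap j) (fun p _ => p.swap_swap j) fun p hp => ?_
  rw [hC.swap_weight p hp]

/-- Diagrams with both `Z` and `dZ` contracted correspond to diagrams with only `Z` contracted and a
choice of an edge that enters the vertex contracted with `Z`. -/
theorem IsTauClosed.sum_split (hC : IsTauClosed j 𝒞 c) (F : Diagram m → ℂ)
    (hF : ∀ p ∈ 𝒞, (∀ i, p i ≠ Sum.inr (j, Slot.tauZ)) → F p = 0)
    (hF' : ∀ p ∈ 𝒞, ∀ a, p a = Sum.inr (j, Slot.tauZ) → (∀ i, p i ≠ Sum.inr (j, Slot.tauDZ)) →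
      F p + ∑ b ∈ (p.incoming (Sum.inl a)).toFinset,
        F (Function.update p b (Sum.inr (j, Slot.tauDZ))) = 0) :
    ∑ p ∈ 𝒞, c p * F p = 0 := by
  classical
  set Z : Target m := Sum.inr (j, Slot.tauZ) with hZ
  set D : Target m := Sum.inr (j, Slot.tauDZ) with hD
  have hZD : Z ≠ D := by simp [hZ, hD]
  have h0 : ∑ p ∈ 𝒞 with ¬ ∃ a, p a = Z, c p * F p = 0 := by
    refine Finset.sum_eq_zero fun p hp => ?_
    obtain ⟨hp, hn⟩ := Finset.mem_filter.1 hp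
    rw [hF p hp (by simpa using hn), mul_zero]
  rw [← Finset.sum_filter_add_sum_filter_not 𝒞 (fun p => ∃ a, p a = Z), h0, add_zero,
    ← Finset.sum_filter_add_sum_filter_not _ (fun p => ∀ i, p i ≠ D), Finset.filter_filter,
    Finset.filter_filter]
  set 𝒞₁ := 𝒞.filter fun p => (∃ a, p a = Z) ∧ ∀ i, p i ≠ D with hC1
  set 𝒞₂ := 𝒞.filter fun p => (∃ a, p a = Z) ∧ ¬ ∀ i, p i ≠ D with hC2
  -- A diagram with both slots filled, by `a` and `b`, is recovered uniquely from the diagram in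
  -- which `b` flows into `a` and the choice of `b` among the edges entering `a`.
  have hkey : ∑ p ∈ 𝒞₂, c p * F p = ∑ x ∈ 𝒞₁.sigma fun p =>
      Finset.univ.filter fun b => ∃ a, p a = Z ∧ p b = Sum.inl a,
      c x.1 * F (Function.update x.1 x.2 D) := by
    symm
    refine Finset.sum_bij (fun x _ => Function.update x.1 x.2 D) ?_ ?_ ?_ ?_
    · rintro ⟨p, b⟩ hx
      simp only [Finset.mem_sigma, hC1, Finset.mem_filter, Finset.mem_univ, true_and] at hx
      obtain ⟨⟨hp, -, hd⟩, a, ha, hb⟩ := hx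
      refine Finset.mem_filter.2 ⟨hC.split_mem p hp a b ha hd hb, ⟨a, ?_⟩, ?_⟩
      · have : a ≠ b := by rintro rfl; simp [ha, hZ] at hb
        simpa [Function.update_of_ne this] using ha
      · push Not
        exact ⟨b, by simp⟩
    · rintro ⟨p, b⟩ hx ⟨p', b'⟩ hx' heq
      simp only [Finset.mem_sigma, hC1, Finset.mem_filter, Finset.mem_univ, true_and] at hx hx'
      obtain ⟨⟨hp, -, hd⟩, a, ha, hb⟩ := hx
      obtain ⟨⟨hp', -, hd'⟩, a', ha', hb'⟩ := hx'
      -- The vertex that was moved is the only one whose edge ends in the slot of `dZ`.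
      have hbb : b = b' := by
        by_contra hne
        have := congrFun heq b
        simp only [Function.update_self, Function.update_of_ne hne] at this
        exact hd' b this.symm
      subst hbb
      have hag (i : Fin m) (hi : i ≠ b) : p i = p' i := by
        simpa [Function.update_of_ne hi] using congrFun heq i
      have hab : a ≠ b := by rintro rfl; simp [ha, hZ] at hb
      have haa : a = a' :=
        (hC.isForest p' hp').1 a a' j Slot.tauZ (by simp) (by rw [← hag a hab, ha]) ha'
      have : p = p' := by
        ext1 i
        rcases eq_or_ne i b with rfl | hi
        · rw [hb, hb', haa]
        · exact hag i hi
      rw [this]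
    · intro p hp
      obtain ⟨hp, ⟨a, ha⟩, hd⟩ := Finset.mem_filter.1 hp
      push Not at hd
      obtain ⟨b, hb⟩ := hd
      have hab : a ≠ b := by rintro rfl; exact hZD (ha.symm.trans hb)
      have ha' : Function.update p b (Sum.inl a) a = Z := by rw [Function.update_of_ne hab, ha]
      refine ⟨⟨Function.update p b (Sum.inl a), b⟩, ?_, ?_⟩
      · simp only [Finset.mem_sigma, hC1, Finset.mem_filter, Finset.mem_univ, true_and]
        refine ⟨⟨hC.merge_mem p hp a b ha hb, ⟨a, ha'⟩, fun i => ?_⟩, a, ha', by simp⟩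
        rcases eq_or_ne i b with rfl | hi
        · simp [hD]
        · rw [Function.update_of_ne hi]
          intro hi'
          exact hi ((hC.isForest p hp).1 i b j Slot.tauDZ (by simp) hi' hb)
      · simp [← hb]
    · rintro ⟨p, b⟩ hx
      simp only [Finset.mem_sigma, hC1, Finset.mem_filter, Finset.mem_univ, true_and] at hx
      obtain ⟨⟨hp, -, hd⟩, a, ha, hb⟩ := hx
      rw [hC.split_weight p hp a b ha hd hb]
  rw [hkey, Finset.sum_sigma, ← Finset.sum_add_distrib]
  refine Finset.sum_eq_zero fun p hp => ?_
  obtain ⟨hp, ⟨a, ha⟩, hd⟩ := Finset.mem_filter.1 hp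
  have hch : (Finset.univ.filter fun b => ∃ a, p a = Z ∧ p b = Sum.inl a) =
      (p.incoming (Sum.inl a)).toFinset := by
    ext b
    simp only [Finset.mem_filter, Finset.mem_univ, true_and, List.mem_toFinset,
      Diagram.mem_incoming]
    constructor
    · rintro ⟨a', ha', hb⟩
      rw [hb, (hC.isForest p hp).1 a' a j Slot.tauZ (by simp) ha' ha]
    · exact fun hb => ⟨a, ha, hb⟩
  rw [hch]
  dsimp only
  rw [← Finset.mul_sum, ← mul_add, hF' p hp a ha hd, mul_zero]

variable {W : Set Twistor} (hW : IsTwistorDomain W) (hU : ∀ σ : Spinor, σ ≠ 0 → line U σ ∈ W)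
  (hh : ∀ i, IsWavefunction W 2 (h i)) (hξ : ξ ≠ 0)

include hW hU hh hξ

/-- The sources of `τ_j` in all diagrams cancel. -/
theorem IsTauClosed.sum_source (hC : IsTauClosed j 𝒞 c) (z : ℂ) :
    ∑ p ∈ 𝒞, c p *
      (contactForm Λ (slotSource Λ U ξ h p (Sum.inr (j, Slot.tauZ)) (affine z))
        (del (fun z => slotField Λ U ξ h p (Sum.inr (j, Slot.tauDZ)) (affine z)) z 1) +
      contactForm Λ (slotField Λ U ξ h p (Sum.inr (j, Slot.tauDZ)) (affine z))
        (del (fun z => slotSource Λ U ξ h p (Sum.inr (j, Slot.tauZ)) (affine z)) z 1)) = 0 := by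
  -- Without an edge into the slot of `Z` there is no source; otherwise the sum over the ways to
  -- move an edge is the local identity `sum_tauDefect` at the vertex `a`.
  refine hC.sum_split (F := fun p => _) (fun p hp hn => ?_) fun p hp a ha hd => ?_
  · rw [slotSource_of_nil hn, del_const, ← contactL_apply, ← contactL_apply, map_zero, map_zero,
      zero_apply, add_zero]
  · have hf := hC.isForest p hp
    have h1 := sum_tauDefect (Λ := Λ) hW hU (hh a)
      (Diagram.nodup_incoming (p := p) (Sum.inl a)) (X := edgeField Λ U ξ h p)
      (fun c _ => isSection_edgeField hW hU hh hξ hf c) z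
    rw [← h1]
    congr 1
    · rw [slotSource_of_eq hf.1 (by simp) ha, slotField_of_nil hd]
      rfl
    · refine Finset.sum_congr rfl fun b hb => ?_
      have hb' : p b = Sum.inl a := Diagram.mem_incoming.1 (List.mem_toFinset.1 hb)
      have hab : a ≠ b := by rintro rfl; simp [ha] at hb'
      have hf' := hC.isForest _ (hC.split_mem p hp a b ha hd hb')
      rw [slotSource_of_eq hf'.1 (by simp) (i := a) (by rw [Function.update_of_ne hab, ha]),
        slotField_of_eq hf'.1 (by simp) (i := b) (by simp), edgeField_update ha hb' hab.symm,
        edgeSection, ← hb', Diagram.incoming_update_old (by simp [hb']), hb',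
        List.map_congr_left fun c hc => edgeField_update ha hb' ?_]
      · rfl
      · rintro rfl
        have := Diagram.mem_incoming.1 (List.mem_of_mem_erase hc)
        simp [ha] at this

/-- The sum over a closed set of diagrams in which `τ_j` is contracted vanishes. -/
theorem IsTauClosed.sum_tauFactor (hC : IsTauClosed j 𝒞 c) {σ : Spinor} (hσ : σ ≠ 0)
    (v : Spinor) : ∑ p ∈ 𝒞, c p * tauFactor Λ U ξ h p j σ v = 0 := by
  set Z : Target m := Sum.inr (j, Slot.tauZ) with hZ
  set D : Target m := Sum.inr (j, Slot.tauDZ) with hD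
  have hsec (p) (hp : p ∈ 𝒞) (t) : IsSection 1 0 (slotField Λ U ξ h p t) :=
    isSection_slotField hW hU hh hξ (hC.isForest p hp) t
  have hZD : Equiv.swap Z D Z = D := Equiv.swap_apply_left _ _
  have hDZ : Equiv.swap Z D D = Z := Equiv.swap_apply_right _ _
  have htau (p : Diagram m) (σ v : Spinor) : tauFactor Λ U ξ h p j σ v =
      contactL Λ (slotField Λ U ξ h p Z σ) (del (slotField Λ U ξ h p D) σ v) :=
    (contactL_apply _ _ _).symm
  have hg (p) (hp : p ∈ 𝒞) (z : ℂ) : tauFactor Λ U ξ h p j (affine z) ![0, 1] =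
      contactForm Λ (slotField Λ U ξ h p Z (affine z))
        (del (fun z => slotField Λ U ξ h p D (affine z)) z 1) := by
    rw [del_comp ((hsec p hp D).differentiableAt (affine_ne_zero z)) (hasFDerivAt_affine z)]
    simp [tauFactor, hZ, hD]
  refine oneForm_eq_zero (G := fun σ v => ∑ p ∈ 𝒞, c p * tauFactor Λ U ξ h p j σ v)
    (fun σ v w => ?_) (fun σ v t => ?_) (fun σ hσ => ?_) (fun σ hσ t ht v => ?_) (fun v => ?_) ?_
    hξ (fun v => ?_) hσ v
  · simp only [htau, del_add, map_add, mul_add, Finset.sum_add_distrib]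
  · simp only [htau, del_smul, map_smul, smul_eq_mul, Finset.mul_sum]
    exact Finset.sum_congr rfl fun p _ => by ring
  · have h1 (p) (hp : p ∈ 𝒞) : tauFactor Λ U ξ h p j σ σ =
        contactForm Λ (slotField Λ U ξ h p Z σ) (slotField Λ U ξ h p D σ) := by
      rw [tauFactor, del_self_of_isHomogeneousOn (hsec p hp D).homogeneous hσ
        ((hsec p hp D).differentiableAt hσ), Int.cast_one, one_smul]
    -- On `v = σ` Euler's identity removes the derivative, and the exchange of the slots shows that
    -- the sum equals its own negative.
    have h2 := hC.sum_swap fun p =>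
      contactForm Λ (slotField Λ U ξ h p Z σ) (slotField Λ U ξ h p D σ)
    simp only [slotField_swap, ← hZ, ← hD, hZD, hDZ] at h2
    have h3 : ∑ p ∈ 𝒞, c p *
        contactForm Λ (slotField Λ U ξ h p D σ) (slotField Λ U ξ h p Z σ) =
        -∑ p ∈ 𝒞, c p *
        contactForm Λ (slotField Λ U ξ h p Z σ) (slotField Λ U ξ h p D σ) := by
      rw [← Finset.sum_neg_distrib]
      exact Finset.sum_congr rfl fun p _ => by rw [contactForm_swap, mul_neg]
    rw [h3] at h2
    rw [Finset.sum_congr rfl fun p hp => by rw [h1 p hp]]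
    exact self_eq_neg.1 h2.symm
  · rw [Finset.mul_sum]
    refine Finset.sum_congr rfl fun p hp => ?_
    have h1 := (hsec p hp D).homogeneous.del_const isOpen_compl_singleton
      (fun x hx t ht => smul_ne_zero ht hx)
      (fun x hx => (hsec p hp D).differentiableAt hx) v σ hσ t ht
    dsimp only at h1
    rw [htau, htau, h1, (hsec p hp Z).homogeneous σ hσ t ht]
    simp
    ring
  · refine (ContDiffOn.continuousOn (𝕜 := ℝ) (n := ∞)) ?_
    refine ContDiffOn.sum fun p hp => contDiffOn_const.mul ?_
    simp only [htau]
    have h1 := (hsec p hp Z).smooth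
    have h2 := contDiffOn_del isOpen_compl_singleton (hsec p hp D).smooth v
    simp only [contactL_apply, contactForm]
    exact ContDiffOn.sum fun i _ => ContDiffOn.sum fun k _ =>
      (contDiffOn_const.mul (contDiffOn_pi.1 h1 i)).mul (contDiffOn_pi.1 h2 k)
  · have hsm (p) (hp : p ∈ 𝒞) : Differentiable ℝ fun z =>
        contactForm Λ (slotField Λ U ξ h p Z (affine z))
          (del (fun z => slotField Λ U ξ h p D (affine z)) z 1) := by
      have h1 := contDiff_slotField_affine (Λ := Λ) (ξ := ξ) hW hU hh hξ (hC.isForest p hp)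
      have h2 := contDiffOn_del isOpen_univ (h1 D).contDiffOn 1
      rw [contDiffOn_univ] at h2
      have h3 : ContDiff ℝ ∞ fun z => contactForm Λ (slotField Λ U ξ h p Z (affine z))
          (del (fun z => slotField Λ U ξ h p D (affine z)) z 1) := by
        simp only [contactForm]
        exact ContDiff.sum fun i _ => ContDiff.sum fun k _ =>
          (contDiff_const.mul (contDiff_pi.1 (h1 Z) i)).mul (contDiff_pi.1 h2 k)
      exact h3.differentiable (by simp)
    have he : (fun z => ∑ p ∈ 𝒞, c p * tauFactor Λ U ξ h p j (affine z) ![0, 1]) = fun z =>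
        ∑ p ∈ 𝒞, c p • contactForm Λ (slotField Λ U ξ h p Z (affine z))
          (del (fun z => slotField Λ U ξ h p D (affine z)) z 1) := by
      ext1 z
      exact Finset.sum_congr rfl fun p hp => by rw [hg p hp, smul_eq_mul]
    rw [he]
    refine differentiable_of_delBar_eq_zero
      (Differentiable.fun_sum fun p hp => (hsm p hp).fun_const_smul (c p)) fun z => ?_
    rw [delBar_fun_sum _ fun p hp => ((hsm p hp).fun_const_smul (c p)) z]
    have h1 (p) (hp : p ∈ 𝒞) : delBar (fun z => c p • contactForm Λ
        (slotField Λ U ξ h p Z (affine z))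
          (del (fun z => slotField Λ U ξ h p D (affine z)) z 1)) z 1 =
        (-2 * Real.pi * Complex.I) * (c p *
          contactForm Λ (slotSource Λ U ξ h p Z (affine z))
            (del (fun z => slotField Λ U ξ h p D (affine z)) z 1) +
          c p * contactForm Λ (slotField Λ U ξ h p Z (affine z))
            (del (fun z => slotSource Λ U ξ h p D (affine z)) z 1)) := by
      have h2 := delBar_clm_comp (c p • ContinuousLinearMap.id ℂ ℂ) (hsm p hp z) 1
      simp only [smul_apply, ContinuousLinearMap.id_apply] at h2
      rw [h2, delBar_contactForm_slotField hW hU hh hξ (hC.isForest p hp), smul_eq_mul]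
      ring
    rw [Finset.sum_congr rfl h1, ← Finset.mul_sum, Finset.sum_add_distrib]
    -- Relabelling by the exchange turns the terms with a source in the slot of `dZ` into terms with
    -- a source in the slot of `Z`, the form treated in `sum_source`.
    have h3 := hC.sum_swap fun p => contactForm Λ (slotField Λ U ξ h p D (affine z))
      (del (fun z => slotSource Λ U ξ h p Z (affine z)) z 1)
    simp only [slotField_swap, slotSource_swap, ← hZ, ← hD, hZD, hDZ] at h3
    rw [h3, ← Finset.sum_add_distrib]
    have h4 := hC.sum_source (Λ := Λ) hW hU hh hξ z
    simp only [mul_add] at h4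
    rw [h4, mul_zero]
  -- At `ξ` every diagram vanishes separately: a propagated field is zero there, and so is its
  -- `(1,0)`-derivative.
  · refine Finset.sum_eq_zero fun p hp => ?_
    have hf := hC.isForest p hp
    obtain ⟨i, hi | hi⟩ := hC.exists_contraction p hp
    · rw [htau, hZ, slotField_of_eq hf.1 (by simp) hi, edgeField_self hW hU hh hf, map_zero,
        zero_apply, mul_zero]
    · rw [htau, hD, slotField_of_eq hf.1 (by simp) hi, del_edgeField_self hW hU hh hξ hf, map_zero,
        mul_zero]

end Cancellation

/-! ### Classes of diagrams -/

namespace Diagram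

variable {m : ℕ} {p p' : Diagram m} {j : Fin 2}

theorem Reaches.transfer (hb : ∀ i k s, p i = Sum.inr (k, s) → p'.Reaches k i)
    (hw : ∀ i l, p i = Sum.inl l → ∀ k, p'.Reaches k l → p'.Reaches k i) {k : Fin 2} {i : Fin m}
    (h : p.Reaches k i) : p'.Reaches k i := by
  induction h with
  | black i s hi => exact hb i k s hi
  | white i l hi _ ih => exact hw i l hi k ih

theorem Reaches.eq_of_eq_inr {k : Fin 2} {i : Fin m} {s : Slot} (h : p.Reaches k i)
    (hi : p i = Sum.inr (j, s)) : k = j := by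
  cases h with
  | black _ s' hi' =>
    rw [hi] at hi'
    simp only [Sum.inr.injEq, Prod.mk.injEq] at hi'
    exact hi'.1.symm
  | white _ l hi' _ => simp [hi] at hi'

theorem exists_swap_inr (j k : Fin 2) (s : Slot) : ∃ s', (s ≠ Slot.wave → s' ≠ Slot.wave) ∧
    Equiv.swap (Sum.inr (j, Slot.tauZ)) (Sum.inr (j, Slot.tauDZ)) (Sum.inr (k, s) : Target m) =
      Sum.inr (k, s') := by
  by_cases h1 : (Sum.inr (k, s) : Target m) = Sum.inr (j, Slot.tauZ)
  · refine ⟨Slot.tauDZ, by simp, ?_⟩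
    rw [h1, Equiv.swap_apply_left]
    simp only [Sum.inr.injEq, Prod.mk.injEq] at h1
    rw [h1.1]
  by_cases h2 : (Sum.inr (k, s) : Target m) = Sum.inr (j, Slot.tauDZ)
  · refine ⟨Slot.tauZ, by simp, ?_⟩
    rw [h2, Equiv.swap_apply_right]
    simp only [Sum.inr.injEq, Prod.mk.injEq] at h2
    rw [h2.1]
  exact ⟨s, id, Equiv.swap_apply_of_ne_of_ne h1 h2⟩

theorem swap_reaches {k : Fin 2} {i : Fin m} (h : p.Reaches k i) : (p.swap j).Reaches k i := by
  refine h.transfer (fun i k s hi => ?_) fun i l hi k hk => ?_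
  · obtain ⟨s', -, hs'⟩ := exists_swap_inr (m := m) j k s
    exact Reaches.black i s' (by rw [swap, hi, hs'])
  · refine Reaches.white i l ?_ hk
    rw [swap, hi, Equiv.swap_apply_of_ne_of_ne (by simp) (by simp)]

theorem IsWick.swap (hp : p.IsWick) : (p.swap j).IsWick := by
  intro i l k s hs hi hl
  rw [swap_eq_iff] at hi hl
  obtain ⟨s', hs1, hs'⟩ := exists_swap_inr (m := m) j k s
  rw [hs'] at hi hl
  exact hp i l k s' (hs1 hs) hi hl

section Merge

variable {a b : Fin m} (ha : p a = Sum.inr (j, Slot.tauZ)) (hb : p b = Sum.inr (j, Slot.tauDZ))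

include ha hb

theorem merge_reaches {k : Fin 2} {i : Fin m} (h : p.Reaches k i) :
    Reaches (Function.update p b (Sum.inl a)) k i := by
  have hab : a ≠ b := by rintro rfl; simp [ha] at hb
  refine h.transfer (fun i k s hi => ?_) fun i l hi k hk => ?_
  · rcases eq_or_ne i b with rfl | hib
    · rw [hb] at hi
      simp only [Sum.inr.injEq, Prod.mk.injEq] at hi
      refine Reaches.white i a (by simp) (Reaches.black a Slot.tauZ ?_)
      rw [Function.update_of_ne hab, ha, hi.1]
    · exact Reaches.black i s (by rw [Function.update_of_ne hib, hi])
  · have hib : i ≠ b := by rintro rfl; simp [hb] at hi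
    exact Reaches.white i l (by rw [Function.update_of_ne hib, hi]) hk

end Merge

theorem IsWick.merge (hp : p.IsWick) (a b : Fin m) :
    IsWick (Function.update p b (Sum.inl a)) := by
  have key (i : Fin m) (t : Fin 2 × Slot)
      (hi : (Function.update p b (Sum.inl a) : Diagram m) i = Sum.inr t) : p i = Sum.inr t := by
    have hib : i ≠ b := by rintro rfl; simp at hi
    rwa [Function.update_of_ne hib] at hi
  exact fun i l k s hs hi hl => hp i l k s hs (key i _ hi) (key l _ hl)

section Split

variable {a b : Fin m} (ha : p a = Sum.inr (j, Slot.tauZ)) (hb : p b = Sum.inl a)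

include ha hb in
theorem split_reaches {k : Fin 2} {i : Fin m} (h : p.Reaches k i) :
    Reaches (Function.update p b (Sum.inr (j, Slot.tauDZ))) k i := by
  have hab : a ≠ b := by rintro rfl; simp [ha] at hb
  refine h.transfer (fun i k s hi => ?_) fun i l hi k hk => ?_
  · have hib : i ≠ b := by rintro rfl; simp [hb] at hi
    exact Reaches.black i s (by rw [Function.update_of_ne hib, hi])
  · rcases eq_or_ne i b with rfl | hib
    · obtain rfl : a = l := by simpa [hb] using hi
      -- Any black vertex reached through `a` is `j`, so redirecting the edge of `b` to `τ_j`
      -- directly does not change where `b` arrives.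
      rw [hk.eq_of_eq_inr (j := j) (s := Slot.tauZ) (by rw [Function.update_of_ne hab, ha])]
      exact Reaches.black i Slot.tauDZ (by simp)
    · exact Reaches.white i l (by rw [Function.update_of_ne hib, hi]) hk

/-- The slot of `dZ` must be free beforehand, for it may be contracted only once. -/
theorem IsWick.split (hp : p.IsWick) (hd : ∀ i, p i ≠ Sum.inr (j, Slot.tauDZ)) (b : Fin m) :
    IsWick (Function.update p b (Sum.inr (j, Slot.tauDZ))) := by
  have key (i l : Fin m) (hib : i ≠ b) (k : Fin 2) (s : Slot) (hs : s ≠ Slot.wave)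
      (hi : (Function.update p b (Sum.inr (j, Slot.tauDZ)) : Diagram m) i = Sum.inr (k, s))
      (hl : (Function.update p b (Sum.inr (j, Slot.tauDZ)) : Diagram m) l = Sum.inr (k, s)) :
      i = l := by
    rw [Function.update_of_ne hib] at hi
    rcases eq_or_ne l b with rfl | hlb
    · rw [Function.update_self] at hl
      exact absurd (hi.trans hl.symm) (hd i)
    · rw [Function.update_of_ne hlb] at hl
      exact hp i l k s hs hi hl
  intro i l k s hs hi hl
  rcases eq_or_ne i b with rfl | hib
  · by_contra hne
    exact hne (key l i (Ne.symm hne) k s hs hl hi).symm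
  · exact key i l hib k s hs hi hl

end Split

/-- Some `Y` is contracted with `τ_j`. -/
def HasTauAt (j : Fin 2) (p : Diagram m) : Prop :=
  ∃ i, p i = Sum.inr (j, Slot.tauZ) ∨ p i = Sum.inr (j, Slot.tauDZ)

theorem hasTauContraction_iff : p.HasTauContraction ↔ p.HasTauAt 0 ∨ p.HasTauAt 1 := by
  constructor
  · rintro ⟨i, j, s, hs, hi⟩
    have h : p.HasTauAt j := ⟨i, by cases s <;> simp_all⟩
    fin_cases j
    · exact Or.inl h
    · exact Or.inr h
  · rintro (⟨i, hi | hi⟩ | ⟨i, hi | hi⟩) <;> exact ⟨i, _, _, by simp, hi⟩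

theorem hasTauAt_congr {k : Fin 2}
    (h : ∀ s, p.incoming (Sum.inr (k, s)) = p'.incoming (Sum.inr (k, s))) :
    p.HasTauAt k ↔ p'.HasTauAt k := by
  simp only [HasTauAt, ← mem_incoming, h]

end Diagram

/-! ### Weights of the diagrams and cancellation in the correlator -/

section Weights

variable {Λ : ℂ} {U : Fin 2 → Twistor} {ξ : Spinor} {m : ℕ} {h : Fin m → Twistor → Twistor}

variable (Λ U ξ h) in
/-- The factors of a diagram other than `τ_j`, where `k` is the other black vertex. -/
def restFactor (e : Fin 2 → Twistor → Twistor) (s v w : Fin 2 → Spinor) (j k : Fin 2)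
    (p : Diagram m) : ℂ :=
  waveFactor Λ U ξ h p (e j) j (s j) (w j) *
    (waveFactor Λ U ξ h p (e k) k (s k) (w k) * tauFactor Λ U ξ h p k (s k) (v k))

theorem restFactor_congr {e : Fin 2 → Twistor → Twistor} {s v w : Fin 2 → Spinor} {j k : Fin 2}
    {p p' : Diagram m}
    (hj : p.incoming (Sum.inr (j, Slot.wave)) = p'.incoming (Sum.inr (j, Slot.wave)))
    (hk : ∀ s, p.incoming (Sum.inr (k, s)) = p'.incoming (Sum.inr (k, s)))
    (hX : ∀ c l s, p c = Sum.inr (l, s) → (l = k ∨ s = Slot.wave) →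
      edgeField Λ U ξ h p c = edgeField Λ U ξ h p' c) :
    restFactor Λ U ξ h e s v w j k p = restFactor Λ U ξ h e s v w j k p' := by
  have h1 (l s) (hl : l = k ∨ s = Slot.wave) : ∀ c ∈ p.incoming (Sum.inr (l, s)),
      edgeField Λ U ξ h p c = edgeField Λ U ξ h p' c := fun c hc =>
    hX c l s (Diagram.mem_incoming.1 hc) hl
  rw [restFactor, restFactor, waveFactor_congr hj (h1 _ _ (Or.inr rfl)),
    waveFactor_congr (hk _) (h1 _ _ (Or.inr rfl)), tauFactor, tauFactor,
    slotField_congr (hk _) (h1 _ _ (Or.inl rfl)), slotField_congr (hk _) (h1 _ _ (Or.inl rfl))]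

open Classical in
-- The moves at `τ_j` preserve reachability and disturb neither the other black vertex nor any
-- wave-function slot, so the remaining factors are a constant weight. The predicate `Q` allows any
-- condition on whether the other contact form is contracted.
theorem isTauClosed_filter {P : Diagram m → Prop} (hPF : ∀ p, P p → p.IsForest)
    (hP : ∀ p p' : Diagram m, P p → p'.IsWick → (∀ k i, p.Reaches k i → p'.Reaches k i) → P p')
    (e : Fin 2 → Twistor → Twistor) (s v w : Fin 2 → Spinor) {j k : Fin 2} (hjk : k ≠ j)
    {Q : Prop → Prop} :
    IsTauClosed j {p : Diagram m | P p ∧ Q (p.HasTauAt k) ∧ p.HasTauAt j}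
      (restFactor Λ U ξ h e s v w j k) := by
  have hmem (p : Diagram m) : p ∈ (Finset.univ.filter fun p : Diagram m =>
      P p ∧ Q (p.HasTauAt k) ∧ p.HasTauAt j) ↔ P p ∧ Q (p.HasTauAt k) ∧ p.HasTauAt j := by simp
  have hsw (p : Diagram m) (l : Fin 2) (t : Slot) (hl : l = k ∨ t = Slot.wave) :
      (p.swap j).incoming (Sum.inr (l, t)) = p.incoming (Sum.inr (l, t)) := by
    refine Diagram.incoming_swap_of_ne ?_ ?_ <;>
    · rintro ⟨⟩
      rcases hl with rfl | hl
      · exact hjk rfl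
      · cases hl
  have hne (l : Fin 2) (t : Slot) (hl : l = k ∨ t = Slot.wave) {t' : Slot} (ht' : t' ≠ Slot.wave) :
      (Sum.inr (l, t) : Target m) ≠ Sum.inr (j, t') := by
    rintro ⟨⟩
    rcases hl with rfl | hl
    · exact hjk rfl
    · exact ht' hl
  have hsplit (p : Diagram m) (a b : Fin m) (hb : p b = Sum.inl a) (l : Fin 2) (t : Slot)
      (hl : l = k ∨ t = Slot.wave) :
      p.incoming (Sum.inr (l, t)) =
        Diagram.incoming (Function.update p b (Sum.inr (j, Slot.tauDZ))) (Sum.inr (l, t)) :=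
    (Diagram.incoming_update_of_ne (by rw [hb]; simp) (hne l t hl (by simp))).symm
  constructor
  · exact fun p hp => hPF p ((hmem p).1 hp).1
  · exact fun p hp => ((hmem p).1 hp).2.2
  · intro p hp
    obtain ⟨h1, h2, i, hi⟩ := (hmem p).1 hp
    refine (hmem _).2 ⟨hP p _ h1 (hPF p h1).1.swap fun k i hi => Diagram.swap_reaches hi, ?_, i, ?_⟩
    · rwa [Diagram.hasTauAt_congr fun t => hsw p k t (Or.inl rfl)]
    · rcases hi with hi | hi
      · exact Or.inr (by rw [Diagram.swap, hi, Equiv.swap_apply_left])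
      · exact Or.inl (by rw [Diagram.swap, hi, Equiv.swap_apply_right])
  · exact fun p _ => restFactor_congr (hsw p j _ (Or.inr rfl))
      (fun t => hsw p k t (Or.inl rfl)) fun c _ _ _ _ => edgeField_swap c
  · intro p hp a b ha hb
    obtain ⟨h1, h2, -⟩ := (hmem p).1 hp
    have hab : a ≠ b := by rintro rfl; simp [ha] at hb
    refine (hmem _).2 ⟨hP p _ h1 ((hPF p h1).1.merge a b)
      fun k i hi => Diagram.merge_reaches ha hb hi, ?_, a, Or.inl ?_⟩
    · rwa [Diagram.hasTauAt_congr fun t => Diagram.incoming_update_of_ne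
        (by rw [hb]; exact hne k t (Or.inl rfl) (by simp)) (by simp)]
    · rw [Function.update_of_ne hab, ha]
  · intro p hp a b ha hd hb
    obtain ⟨h1, h2, -⟩ := (hmem p).1 hp
    refine (hmem _).2 ⟨hP p _ h1 ((hPF p h1).1.split hd b)
      fun k i hi => Diagram.split_reaches ha hb hi, ?_, b, Or.inr (by simp)⟩
    rwa [← Diagram.hasTauAt_congr fun t => hsplit p a b hb k t (Or.inl rfl)]
  · intro p hp a b ha hd hb
    refine (restFactor_congr (hsplit p a b hb j _ (Or.inr rfl))
      (fun t => hsplit p a b hb k t (Or.inl rfl)) fun c l t hc hl => ?_).symm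
    refine (edgeField_update ha hb ?_).symm
    rintro rfl
    exact hne l t hl (t' := Slot.tauZ) (by simp) (hc.symm.trans ha)

variable {W : Set Twistor} (hW : IsTwistorDomain W) (hU : ∀ σ : Spinor, σ ≠ 0 → line U σ ∈ W)
  (hh : ∀ i, IsWavefunction W 2 (h i)) (hξ : ξ ≠ 0)

include hW hU hh hξ

open Classical in
/-- The diagrams with a contraction with some `τ_j` cancel. -/
theorem correlator_eq {P : Diagram m → Prop} (hPF : ∀ p, P p → p.IsForest)
    (hP : ∀ p p' : Diagram m, P p → p'.IsWick → (∀ k i, p.Reaches k i → p'.Reaches k i) → P p')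
    (e : Fin 2 → Twistor → Twistor) {s : Fin 2 → Spinor} (hs : ∀ j, s j ≠ 0)
    (v w : Fin 2 → Spinor) :
    correlator Λ U ξ h P e s v w =
      correlator Λ U ξ h (fun p => P p ∧ ¬ p.HasTauContraction) e s v w := by
  -- Cancellation at `τ_0` is unconditional on `τ_1`; the one at `τ_1` then runs over diagrams that
  -- do not touch `τ_0`, so no diagram is counted twice.
  have h0 := (isTauClosed_filter (Λ := Λ) (U := U) (ξ := ξ) (h := h) hPF hP e s v w
    (j := 0) (k := 1) (by simp) (Q := fun _ => True)).sum_tauFactor (Λ := Λ) hW hU hh hξ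
    (hs 0) (v 0)
  have h1 := (isTauClosed_filter (Λ := Λ) (U := U) (ξ := ξ) (h := h) hPF hP e s v w
    (j := 1) (k := 0) (by simp) (Q := Not)).sum_tauFactor (Λ := Λ) hW hU hh hξ
    (hs 1) (v 1)
  simp only [true_and] at h0
  simp only [correlator, contribution]
  rw [← Finset.sum_smul, ← Finset.sum_smul]
  congr 1
  have e0 (p : Diagram m) :
      ∏ j, waveFactor Λ U ξ h p (e j) j (s j) (w j) * tauFactor Λ U ξ h p j (s j) (v j) =
      restFactor Λ U ξ h e s v w 0 1 p * tauFactor Λ U ξ h p 0 (s 0) (v 0) := by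
    rw [Fin.prod_univ_two, restFactor]; ring
  have e1 (p : Diagram m) :
      ∏ j, waveFactor Λ U ξ h p (e j) j (s j) (w j) * tauFactor Λ U ξ h p j (s j) (v j) =
      restFactor Λ U ξ h e s v w 1 0 p * tauFactor Λ U ξ h p 1 (s 1) (v 1) := by
    rw [Fin.prod_univ_two, restFactor]; ring
  simp only [← e0] at h0
  simp only [← e1] at h1
  rw [← Finset.sum_filter_add_sum_filter_not (Finset.filter P _) (fun p => p.HasTauAt 0),
    Finset.filter_filter, Finset.filter_filter, h0, zero_add,
    ← Finset.sum_filter_add_sum_filter_not _ (fun p => p.HasTauAt 1),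
    Finset.filter_filter, Finset.filter_filter]
  simp only [and_assoc]
  refine (add_eq_right.2 (by convert h1)).trans ?_
  refine Finset.sum_congr (Finset.filter_congr fun p _ => ?_) fun p _ => rfl
  rw [Diagram.hasTauContraction_iff, not_or]

end Weights

/-! ### A single vertex operator -/

theorem edgeField_eq_contractionEinstein {Λ : ℂ} {U : Fin 2 → Twistor} {ξ : Spinor}
    {h : Twistor → Twistor} {p : Diagram 1} (hp : ∀ i k, p i ≠ Sum.inl k) (i : Fin 1) :
    vertexField Λ U (fun _ => h) p (edgeField Λ U ξ (fun _ => h) p) i = einsteinField Λ U h ∧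
      edgeField Λ U ξ (fun _ => h) p i = contractionEinstein Λ U ξ h := by
  have h1 (X : Fin 1 → Spinor → Twistor) :
      vertexField Λ U (fun _ => h) p X i = einsteinField Λ U h := by
    ext1 z
    rw [vertexField, Diagram.incoming_eq_nil.2 fun k => hp k i]
    rfl
  refine ⟨h1 _, ?_⟩
  ext1 σ
  simp only [edgeField, edgeFieldAux, h1]
  rfl

theorem isForest_const (t : Fin 2 × Slot) : Diagram.IsForest (m := 1) fun _ => Sum.inr t :=
  ⟨fun _ _ _ _ _ _ _ => Subsingleton.elim _ _, fun i => ⟨t.1, Diagram.Reaches.black i t.2 rfl⟩⟩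

open Classical in
-- The two terms of the contraction are the two diagrams with one white vertex attached to `τ_0`.
-- They are exchanged by `swap`, while moving edges would require a second white vertex.
theorem contractionTau_eq_zero {Λ : ℂ} {U : Fin 2 → Twistor} {ξ : Spinor} {W : Set Twistor}
    {h : Twistor → Twistor} (hW : IsTwistorDomain W) (hU : ∀ σ : Spinor, σ ≠ 0 → line U σ ∈ W)
    (hh : IsWavefunction W 2 h) (hξ : ξ ≠ 0) {σ : Spinor} (hσ : σ ≠ 0) (v : Spinor) :
    contractionTau Λ U ξ h σ v = 0 := by
  set Z : Diagram 1 := fun _ => Sum.inr (0, Slot.tauZ) with hZ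
  set D : Diagram 1 := fun _ => Sum.inr (0, Slot.tauDZ) with hD
  have hmem (p : Diagram 1) : p ∈ ({Z, D} : Finset (Diagram 1)) ↔ p = Z ∨ p = D := by simp
  have hC : IsTauClosed 0 {Z, D} fun _ => 1 := by
    constructor
    · intro p hp
      rcases (hmem p).1 hp with rfl | rfl
      · exact isForest_const _
      · exact isForest_const _
    · intro p hp
      rcases (hmem p).1 hp with rfl | rfl
      · exact ⟨0, Or.inl rfl⟩
      · exact ⟨0, Or.inr rfl⟩
    · intro p hp
      rcases (hmem p).1 hp with rfl | rfl
      · exact (hmem _).2 (Or.inr (funext fun i => Equiv.swap_apply_left _ _))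
      · exact (hmem _).2 (Or.inl (funext fun i => Equiv.swap_apply_right _ _))
    · exact fun _ _ => rfl
    · intro p hp a b ha hb
      rw [Subsingleton.elim b a, ha] at hb
      simp at hb
    · intro p hp a b ha _ hb
      rw [Subsingleton.elim b a, ha] at hb
      simp at hb
    · exact fun _ _ _ _ _ _ _ => rfl
  have h1 := hC.sum_tauFactor (Λ := Λ) (h := fun _ => h) hW hU (fun _ => hh) hξ hσ v
  have hne : Z ≠ D := fun h => by simpa [hZ, hD] using congrFun h 0
  rw [Finset.sum_pair hne, one_mul, one_mul] at h1
  rw [← h1, contractionTau, tauFactor, tauFactor,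
    slotField_of_eq (isForest_const _).1 (by simp) (i := 0) (p := Z) rfl,
    slotField_of_eq (isForest_const _).1 (by simp) (i := 0) (p := D) rfl,
    slotField_of_nil (p := Z) (by simp [hZ]), slotField_of_nil (p := D) (by simp [hD]),
    (edgeField_eq_contractionEinstein (p := Z) (by simp [hZ]) 0).2,
    (edgeField_eq_contractionEinstein (p := D) (by simp [hD]) 0).2]

end TwistorString

end

/-! ### Assembly of the two statements -/

theorem mainTheorem4 (Λ : ℂ) (W : Set Twistor) (hW : IsTwistorDomain W)
    (U : Fin 2 → Twistor) (hU : ∀ σ : Spinor, σ ≠ 0 → line U σ ∈ W) (ξ : Spinor) :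
    -- The contraction of the contact form with an Einstein vertex operator
    (∀ h : Twistor → Twistor, IsWavefunction W 2 h →
      ∀ σ : Spinor, bracket ξ σ ≠ 0 →
        HasContraction ξ (einsteinField Λ U h) σ (contractionEinstein Λ U ξ h σ) ∧
        DifferentiableAt ℝ (contractionEinstein Λ U ξ h) σ ∧
        ∀ v : Spinor, contractionTau Λ U ξ h σ v = 0) ∧
    -- The MHV correlator
    (∀ (m : ℕ) (h : Fin m → Twistor → Twistor), (∀ i, IsWavefunction W 2 (h i)) →
      (∀ p : Diagram m, p.IsForest → ∀ i, ∀ σ : Spinor, bracket ξ σ ≠ 0 →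
        HasContraction ξ (vertexField Λ U h p (edgeField Λ U ξ h p) i) σ
          (edgeField Λ U ξ h p i σ) ∧
        DifferentiableAt ℝ (edgeField Λ U ξ h p i) σ) ∧
      ∀ e : Fin 2 → Twistor → Twistor, (∀ j, IsWavefunction W (-6) (e j)) →
        ∀ s v w : Fin 2 → Spinor, (∀ j, bracket ξ (s j) ≠ 0) →
          correlator Λ U ξ h Diagram.IsTree e s v w =
            correlator Λ U ξ h (fun p => p.IsTree ∧ ¬ p.HasTauContraction) e s v w ∧
          correlator Λ U ξ h Diagram.IsForest e s v w =
            correlator Λ U ξ h (fun p => p.IsForest ∧ ¬ p.HasTauContraction) e s v w) := by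
  refine ⟨fun h hh σ hσ => ?_, fun m h hh => ⟨fun p hp i σ hσ => ?_, fun e _ s v w hs => ?_⟩⟩
  · have hξ : ξ ≠ 0 := by rintro rfl; simp [bracket] at hσ
    have hσ0 := ne_zero_of_bracket hσ
    -- With a single white vertex nothing flows into it, so the slot its edge ends on does not
    -- affect the field; any choice serves.
    have hf := isForest_const (0, Slot.wave)
    obtain ⟨h1, h2⟩ := edgeField_eq_contractionEinstein (Λ := Λ) (U := U) (ξ := ξ) (h := h)
      (p := fun _ => Sum.inr (0, Slot.wave)) (by simp) 0
    have h3 := hasContraction_edgeField hW hU (fun _ => hh) hξ hf 0 hσ0 (Λ := Λ)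
    have h4 := isSection_edgeField hW hU (fun _ => hh) hξ hf 0 (Λ := Λ)
    rw [h1, h2] at h3
    rw [h2] at h4
    exact ⟨h3, h4.differentiableAt hσ0, contractionTau_eq_zero hW hU hh hξ hσ0⟩
  · have hξ : ξ ≠ 0 := by rintro rfl; simp [bracket] at hσ
    have hσ0 := ne_zero_of_bracket hσ
    exact ⟨hasContraction_edgeField hW hU hh hξ hp i hσ0,
      (isSection_edgeField hW hU hh hξ hp i).differentiableAt hσ0⟩
  · have hξ : ξ ≠ 0 := by rintro rfl; simpa [bracket] using hs 0
    have hs0 (j) := ne_zero_of_bracket (hs j)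
    -- Since the moves preserve which black vertex is reached, a tree attached to one black vertex
    -- stays attached to the same one.
    exact ⟨correlator_eq hW hU hh hξ (fun p hp => ⟨hp.1, fun i => ⟨_, hp.2.choose_spec i⟩⟩)
        (fun p p' hp hw hr => ⟨hw, hp.2.choose, fun i => hr _ i (hp.2.choose_spec i)⟩) e hs0 v w,
      correlator_eq hW hU hh hξ (fun p hp => hp)
        (fun p p' hp hw hr => ⟨hw, fun i => ⟨_, hr _ i (hp.2 i).choose_spec⟩⟩) e hs0 v w⟩
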